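/- Let $\mathbb{F}$ be an algebraically closed field. Let $\mathcal{M}$ be the set of rational maps $f\colon \operatorname{dom} f\dashrightarrow\mathbb{P}^{\dim f}$ over $\mathbb{F}$ with $\operatorname{dom} f\in\{\mathbb{P}^2,\mathbb{P}^1\times\mathbb{P}^1\}$ whose components are forms of the same (bi-)degree with constant greatest common divisor, and such that the Zariski closure $\operatorname{img} f$ of the image does not lie in a hyperplane. Let $p_1,\dots,p_r$ be the base points of $f\in\mathcal{M}$, including the infinitely near ones, with multiplicities $m_1,\dots,m_r>0$ (the multiplicities at these points of a general member of the linear series spanned by the components). Classes are elements of the lattice generated by $e_0$ with $e_0^2=1$ if $\operatorname{dom} f=\mathbb{P}^2$, respectively by $\ell_0,\ell_1$ with $\ell_0^2=\ell_1^2=0$, $\ell_0\cdot\ell_1=1$ if $\operatorname{dom} f=\mathbb{P}^1\times\mathbb{P}^1$, together with a generator $e_q$ for each point $q$ that lies on, or is infinitely near to a point of, $\operatorname{dom} f$; here $e_q^2=-1$ and all other products of generators are zero. Write $e_i:=e_{p_i}$. The class of $f$ is $[f]=d\,e_0-\sum_i m_i e_i$ if $\operatorname{dom} f=\mathbb{P}^2$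 and the components have degree $d$, and $[f]=d_1\ell_0+d_2\ell_1-\sum_i m_i e_i$ if $\operatorname{dom} f=\mathbb{P}^1\times\mathbb{P}^1$ and the components have bidegree $(d_1,d_2)$. The canonical class is $\kappa_f=-3e_0+\sum_i e_i$, respectively $\kappa_f=-2\ell_0-2\ell_1+\sum_i e_i$. The number $\gcd[f]$ is the greatest common divisor of the coefficients of $[f]$. For a class $c$ with (bi-)degree $\delta$ and nonnegative multiplicities $\mu_q$, i.e. with coefficient $-\mu_q$ at $e_q$, let $V_c$ be the vector space of forms of (bi-)degree $\delta$ that have multiplicity at least $\mu_q$ at each $q$ (equivalently, the global sections of $c$; $V_c=0$ if the (bi-)degree is not nonnegative), and let $h^0(c)=\dim V_c$. If $h^0(c)>0$, let $\langle c\rangle$ denote the class of the map whose components form a basis of the moving part of $V_c$, i.e. of $V_c$ divided by the greatest common divisor of its elements. We say that $f\in\mathcal{M}$ is *characterized by B1* if all of the following hold: * it is not the case that $\dim f<h^0([f])-1$; * with $c:=[f]+\kappa_f$, it is not the case that $h^0(c)>1$ and $\neg\bigl([f]^2>\langle c\rangle^2=c\cdot\langle c\rangle=0\bigr)$; * it is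 not the case that $\gcd[f]>1$; * $h^0([f])=3$, $[f]^2=1$ and $\operatorname{img} f\cong\mathbb{P}^2$. For $f,g\in\mathcal{M}$ let $\mathcal{P}(f,g)$ be the set of biregular maps $p\colon\mathbb{P}^{\dim f}\to\mathbb{P}^{\dim g}$ with $p(\operatorname{img} f)=\operatorname{img} g$, and let $\mathcal{R}(f,g)$ be the set of birational maps $r\colon\operatorname{dom} f\dashrightarrow\operatorname{dom} g$ such that $p\circ f=g\circ r$ for some $p\in\mathcal{P}(f,g)$. Let $\mathcal{I}_{\mathbb{P}^2}$ be the set of $c=(c_0,\dots,c_8)\in\mathbb{F}^9$ such that the matrix with rows $(c_0,c_1,c_2)$, $(c_3,c_4,c_5)$, $(c_6,c_7,c_8)$ has nonzero determinant and its first nonzero entry is $1$, and let $r_c\colon\mathbb{P}^2\to\mathbb{P}^2$ be the linear automorphism given by this matrix. **Proposition.** If $f,g\in\mathcal{M}$ are both characterized by B1, then $\dim f=\dim g=2$, the map $g\colon\operatorname{dom} g\dashrightarrow\mathbb{P}^2$ is birational, and $$\mathcal{R}(f,g)\ \subseteq\ \{\,g^{-1}\circ r_c\circ f \mid c\in\mathcal{I}_{\mathbb{P}^2}\,\}.$$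 -/

import Mathlib

namespace SurfIso

open MvPolynomial

noncomputable section

/-! ### Points, forms and rational maps of the spaces `(ℙ^m)^k`

All spaces that occur are powers of a projective space: `ℙ^n` is `Pt F 1 n`, and the two possible
domains `ℙ²` and `ℙ¹ × ℙ¹` are `Pt F 1 2` and `Pt F 2 1`. -/

/-- The closed points of `(ℙ^m)^k` over the field `F`. -/
abbrev Pt (F : Type*) [Field F] (k m : ℕ) : Type _ := Fin k → Projectivization F (Fin (m + 1) → F)

/-- The (multi-)homogeneous coordinate ring of `(ℙ^m)^k`. The variable `X (i, j)` is
the `j`-th homogeneous coordinate of the `i`-th factor. -/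
abbrev Coord (F : Type*) [Field F] (k m : ℕ) : Type _ := MvPolynomial (Fin k × Fin (m + 1)) F

/-- The space of forms of multidegree `d`. It is zero when some `d i` is negative. -/
def forms (F : Type*) [Field F] (k m : ℕ) (d : Fin k → ℤ) : Submodule F (Coord F k m) :=
  weightedHomogeneousSubmodule F (fun v : Fin k × Fin (m + 1) => (Pi.single v.1 1 : Fin k → ℤ)) d

variable {F : Type*} [Field F]

/-- The value of a polynomial at a chosen vector of homogeneous coordinates of a point.
For a form, whether this vanishes does not depend on the choice, and neither do the ratios
of the values of forms of equal degree. -/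
def val {k m : ℕ} (x : Pt F k m) (h : Coord F k m) : F :=
  MvPolynomial.eval (fun v : Fin k × Fin (m + 1) => (x v.1).rep v.2) h

/-- `P` holds on some nonempty Zariski open subset of the (irreducible) variety `(ℙ^m)^k`. -/
def Generic {k m : ℕ} (P : Pt F k m → Prop) : Prop :=
  ∃ (d : Fin k → ℤ) (h : Coord F k m), h ∈ forms F k m d ∧ h ≠ 0 ∧ ∀ x, val x h ≠ 0 → P x

/-- The smallest Zariski closed subset of `(ℙ^m)^k` that contains `A`. -/
def zariskiClosure {k m : ℕ} (A : Set (Pt F k m)) : Set (Pt F k m) :=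
  {y | ∀ (d : Fin k → ℤ) (h : Coord F k m), h ∈ forms F k m d →
    (∀ z ∈ A, val z h = 0) → val y h = 0}

/-- `φ` is a morphism of varieties on the closed set `A`: near every point of `A` each of the
components of `φ` is given by forms of the same degree. (Multiplying these forms by a form
that vanishes outside a given open neighbourhood, one may
assume that they define `φ` wherever they do not all vanish.) -/
def IsRegularOn {k m l n : ℕ} (A : Set (Pt F k m)) (φ : Pt F k m → Pt F l n) : Prop :=
  ∀ x ∈ A, ∀ j : Fin l, ∃ (d : Fin k → ℤ) (G : Fin (n + 1) → Coord F k m),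
    (∀ a, G a ∈ forms F k m d) ∧ (fun a => val x (G a)) ≠ 0 ∧
    ∀ x' ∈ A, ∀ h : (fun a => val x' (G a)) ≠ 0, φ x' j = Projectivization.mk F _ h

/-- Two closed sets are isomorphic as varieties. -/
def VarIso {k m l n : ℕ} (A : Set (Pt F k m)) (B : Set (Pt F l n)) : Prop :=
  ∃ (φ : Pt F k m → Pt F l n) (ψ : Pt F l n → Pt F k m),
    Set.MapsTo φ A B ∧ Set.MapsTo ψ B A ∧ Set.InvOn ψ φ A B ∧
    IsRegularOn A φ ∧ IsRegularOn B ψ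

variable (F) in
/-- A representative of a rational map `(ℙ^m)^k ⇢ (ℙ^n)^l`: for each factor of the target
a tuple of forms of the same multidegree that are not all zero. -/
structure RatMap (k m l n : ℕ) where
  deg : Fin l → Fin k → ℤ
  comp : Fin l → Fin (n + 1) → Coord F k m
  homog : ∀ j a, comp j a ∈ forms F k m (deg j)
  nonzero : ∀ j, comp j ≠ 0

namespace RatMap

variable {k m l n : ℕ}

/-- The forms of `r` define its value at `x`, and this value is `y`. -/
def Sends (r : RatMap F k m l n) (x : Pt F k m) (y : Pt F l n) : Prop :=
  ∀ j, ∃ h : (fun a => val x (r.comp j a)) ≠ 0, y j = Projectivization.mk F _ h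

/-- The Zariski closure of the image. -/
def img (r : RatMap F k m l n) : Set (Pt F l n) :=
  zariskiClosure {y | ∃ x, r.Sends x y}

/-- `s ∘ r` and `r ∘ s` are the identity, as rational maps. -/
def IsInverse (r : RatMap F k m l n) (s : RatMap F l n k m) : Prop :=
  Generic (fun x => ∃ y, r.Sends x y ∧ s.Sends y x) ∧
  Generic (fun y => ∃ x, s.Sends y x ∧ r.Sends x y)

/-- `r` is birational. -/
def IsBirational (r : RatMap F k m l n) : Prop := ∃ s, r.IsInverse s

/-- A map to `ℙ^n` seen as a map to `ℙ^n'` when `n = n'`. -/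
def castTarget {n' : ℕ} (h : n = n') (r : RatMap F k m l n) : RatMap F k m l n' := h ▸ r

end RatMap

/-! ### The set of maps `𝓜` -/

/-- The two possible domains `ℙ²` and `ℙ¹ × ℙ¹`. -/
inductive Dom
  | plane
  | quadric

/-- The number of factors of the domain. -/
def Dom.k : Dom → ℕ
  | plane => 1
  | quadric => 2

/-- The dimension of each of the factors of the domain. -/
def Dom.m : Dom → ℕ
  | plane => 2
  | quadric => 1

variable (F) in
/-- The set `𝓜` of rational maps `f : dom f ⇢ ℙ^(dim f)`, given by components without
common factor, such that `img f` does not lie in a hyperplane. -/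
structure PMap where
  dom : Dom
  dim : ℕ
  map : RatMap F dom.k dom.m 1 dim
  gcd_const : ∀ q : Coord F dom.k dom.m, (∀ a, q ∣ map.comp 0 a) → IsUnit q
  nondegenerate : ∀ u : Fin (dim + 1) → F, u ≠ 0 →
    ∃ y ∈ map.img, ∑ a, u a * (y 0).rep a ≠ 0

/-! ### Infinitely near points and multiplicities

A point of the domain or infinitely near to it is encoded by a point `p` of the domain and
a list of directions. The affine plane around `p` has local coordinates
`X 0`, `X 1` centred at `p`. The points of the exceptional curve of the blowup of the origin are
the directions `(1 : t)` with `t : F`, encoded as `some t`, and `(0 : 1)`, encoded as `none`. Again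
there are standard coordinates centred at such a point, so that the process continues. -/

/-- Local coordinate ring `F[X 0, X 1]`. -/
abbrev Loc (F : Type*) [Field F] : Type _ := MvPolynomial (Fin 2) F

/-- The numbering of the two local coordinates: the `a`-th affine coordinate
of the `i`-th factor. -/
def Dom.locIdx : (D : Dom) → Fin D.k → Fin D.m → Fin 2
  | plane, _, a => a
  | quadric, i, _ => i

/-- The index of a homogeneous coordinate that is not zero at the given point. -/
def pivot {m : ℕ} (p : Projectivization F (Fin (m + 1) → F)) : Fin (m + 1) :=
  (Function.ne_iff.mp p.rep_nonzero).choose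

/-- Dehomogenization in affine coordinates that are centred at `p`: in each of the factors the pivot
coordinate becomes `1` and the others become `p_j / p_pivot` plus a local coordinate. -/
def dehom (D : Dom) (p : Pt F D.k D.m) : Coord F D.k D.m →ₐ[F] Loc F :=
  MvPolynomial.aeval fun v : Fin D.k × Fin (D.m + 1) =>
    Fin.insertNth (α := fun _ => Loc F) (pivot (p v.1)) 1
      (fun a => C ((p v.1).rep ((pivot (p v.1)).succAbove a) / (p v.1).rep (pivot (p v.1)))
        + X (D.locIdx v.1 a)) v.2

/-- The blowup of the origin, in the coordinates centred at the given direction. -/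
def blow : Option F → (Loc F →ₐ[F] Loc F)
  | some t => MvPolynomial.aeval ![X 0, X 0 * (X 1 + C t)]
  | none => MvPolynomial.aeval ![X 0 * X 1, X 1]

/-- The equation of the exceptional curve in these coordinates. -/
def exc : Option F → Loc F
  | some _ => X 0
  | none => X 1

variable (F) in
/-- The maximal ideal of the origin; `v` has multiplicity at least `e` at the origin iff
`v ∈ (origin F) ^ e`. -/
def origin : Ideal (Loc F) := Ideal.span {X 0, X 1}

/-- The multiplicity at the origin of a general member of a nonzero linear system. -/
def locMult (V : Submodule F (Loc F)) : ℕ := sSup {e : ℕ | ∀ v ∈ V, v ∈ origin F ^ e}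

/-- The strict transform of a linear system (that is, of its general member) under the blowup
of the origin: each pulled back member is divided by `exc t ^ locMult V`. -/
def transform (V : Submodule F (Loc F)) (t : Option F) : Submodule F (Loc F) :=
  (V.map (blow t).toLinearMap).comap (LinearMap.mulLeft F (exc t ^ locMult V))

/-- Points of the domain `D` (empty list) and points infinitely near to those. -/
abbrev Bubble (F : Type*) [Field F] (D : Dom) : Type _ := Pt F D.k D.m × List (Option F)

/-- The multiplicity at a point, possibly infinitely near, of a general
member of a linear system of forms. The base points of `V` are the points where
this is positive. -/
def mult {D : Dom} (V : Submodule F (Coord F D.k D.m)) (q : Bubble F D) : ℕ :=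
  locMult (q.2.foldl transform (V.map (dehom D q.1).toLinearMap))

/-! ### Classes -/

variable (F) in
/-- The class `deg - ∑ q, mult q * e_q`. Here `deg` is `d e_0` for the plane and
`d_1 l_0 + d_2 l_1` for the quadric, and
`e_q` is the class of the total transform of the exceptional curve over `q`.
The coefficients are zero outside a finite set for all classes that are considered below. -/
@[ext]
structure Cls (D : Dom) where
  deg : Fin D.k → ℤ
  mult : Bubble F D → ℤ

/-- The intersection product on the classes of `ℙ²` or `ℙ¹ × ℙ¹` itself. -/
def Dom.pair : (D : Dom) → (Fin D.k → ℤ) → (Fin D.k → ℤ) → ℤ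
  | plane, d, d' => d (0 : Fin 1) * d' (0 : Fin 1)
  | quadric, d, d' => d (0 : Fin 2) * d' (1 : Fin 2) + d (1 : Fin 2) * d' (0 : Fin 2)

namespace Cls

variable {D : Dom}

instance : Add (Cls F D) := ⟨fun c c' => ⟨c.deg + c'.deg, c.mult + c'.mult⟩⟩

/-- The intersection product: `e_q ^ 2 = -1`, and distinct `e_q` and the classes from `D` are
orthogonal to each other. -/
def inter (c c' : Cls F D) : ℤ := D.pair c.deg c'.deg - ∑ᶠ q, c.mult q * c'.mult q

/-- The (nonnegative) greatest common divisor of the coefficients. -/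
def gcd (c : Cls F D) : ℕ := sSup {e : ℕ | (∀ i, (e : ℤ) ∣ c.deg i) ∧ ∀ q, (e : ℤ) ∣ c.mult q}

/-- The vector space `V_c` of the forms of degree `c.deg` that have
multiplicity at least `c.mult q` at `q` for all `q` (where `c.mult q ≥ 0` for all `q`). At infinitely
near points, this refers to
the transform `w l` for which `c.mult q` times the exceptional curve has been taken out
of the pullback at each preceding `q`, so `V_c` is the space of global sections of `c`. -/
def space (c : Cls F D) : Submodule F (Coord F D.k D.m) where
  carrier := {v | v ∈ forms F D.k D.m c.deg ∧ ∀ p : Pt F D.k D.m,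
    ∃ w : List (Option F) → Loc F, w [] = dehom D p v ∧
      ∀ l, w l ∈ origin F ^ (c.mult (p, l)).toNat ∧
        ∀ t, blow t (w l) = exc t ^ (c.mult (p, l)).toNat * w (l ++ [t])}
  zero_mem' := ⟨Submodule.zero_mem _, fun p => ⟨fun _ => 0, by simp⟩⟩
  add_mem' := by
    rintro v v' ⟨hv, hw⟩ ⟨hv', hw'⟩
    refine ⟨Submodule.add_mem _ hv hv', fun p => ?_⟩
    obtain ⟨w, h0, h⟩ := hw p
    obtain ⟨w', h0', h'⟩ := hw' p
    refine ⟨fun l => w l + w' l, by simp [h0, h0'], fun l => ⟨?_, fun t => ?_⟩⟩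
    · exact Ideal.add_mem _ (h l).1 (h' l).1
    · rw [map_add, (h l).2 t, (h' l).2 t, mul_add]
  smul_mem' := by
    rintro a v ⟨hv, hw⟩
    refine ⟨Submodule.smul_mem _ a hv, fun p => ?_⟩
    obtain ⟨w, h0, h⟩ := hw p
    refine ⟨fun l => a • w l, by simp [h0], fun l => ⟨?_, fun t => ?_⟩⟩
    · exact Submodule.smul_of_tower_mem _ a (h l).1
    · rw [map_smul, (h l).2 t, mul_smul_comm]

/-- `h⁰(c) = dim V_c`. -/
def h0 (c : Cls F D) : ℕ := Module.finrank F c.space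

end Cls

/-- `q` is a greatest common divisor of the members of `V`. -/
def IsGcd {D : Dom} (V : Submodule F (Coord F D.k D.m)) (q : Coord F D.k D.m) : Prop :=
  (∀ v ∈ V, q ∣ v) ∧ ∀ r, (∀ v ∈ V, r ∣ v) → r ∣ q

/-- The moving part of a nonzero `V`: the members divided by their greatest common divisor.
(The latter is unique up to a nonzero constant, which does not matter.) -/
def movingPart {D : Dom} (V : Submodule F (Coord F D.k D.m)) : Submodule F (Coord F D.k D.m) :=
  ⨅ q ∈ {q | IsGcd V q}, V.comap (LinearMap.mulLeft F q)

open Classical in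
/-- The degree of the elements of a nonzero vector space of forms of the same degree. -/
def formDeg {D : Dom} (V : Submodule F (Coord F D.k D.m)) : Fin D.k → ℤ :=
  if h : ∃ d, V ≠ ⊥ ∧ V ≤ forms F D.k D.m d then h.choose else 0

/-- The moving part of a class `c` with `h⁰(c) > 0`, that is, the class of the parametric map of
`c`, whose components form a basis of the moving part of `V_c`. -/
def Cls.moving {D : Dom} (c : Cls F D) : Cls F D where
  deg := formDeg (movingPart c.space)
  mult q := SurfIso.mult (movingPart c.space) q

namespace PMap

/-- The vector space generated by the components. -/
def assoc (f : PMap F) : Submodule F (Coord F f.dom.k f.dom.m) :=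
  Submodule.span F (Set.range (f.map.comp 0))

/-- The Zariski closure of the image of `f`. -/
def img (f : PMap F) : Set (Pt F 1 f.dim) := f.map.img

/-- The class `[f]`. -/
def cls (f : PMap F) : Cls F f.dom where
  deg := f.map.deg 0
  mult q := SurfIso.mult f.assoc q

open Classical in
/-- The canonical class `κ_f`: it is `-3 e_0 + ∑ e_q` respectively `-2 l_0 - 2 l_1 + ∑ e_q`,
with the sum over the base points `q` of `f`. -/
def canon (f : PMap F) : Cls F f.dom where
  deg _ := -((f.dom.m : ℤ) + 1)
  mult q := if 0 < SurfIso.mult f.assoc q then -1 else 0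

/-- The condition of the reducer that completes the linear series. -/
def c0 (f : PMap F) : Prop := (f.dim : ℤ) < (f.cls.h0 : ℤ) - 1

/-- The condition of the reducer that passes to the adjoint class. -/
def c1 (f : PMap F) : Prop :=
  1 < (f.cls + f.canon).h0 ∧
  ¬ ((f.cls + f.canon).moving.inter (f.cls + f.canon).moving < f.cls.inter f.cls ∧
      (f.cls + f.canon).moving.inter (f.cls + f.canon).moving
        = (f.cls + f.canon).inter (f.cls + f.canon).moving ∧
      (f.cls + f.canon).inter (f.cls + f.canon).moving = 0)

/-- The condition of the reducer that divides the class by its greatest common divisor. -/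
def c2 (f : PMap F) : Prop := 1 < f.cls.gcd

/-- `f` is characterized by base case B1. -/
def IsB1 (f : PMap F) : Prop :=
  ¬ f.c0 ∧ ¬ f.c1 ∧ ¬ f.c2 ∧
  f.cls.h0 = 3 ∧ f.cls.inter f.cls = 1 ∧ VarIso f.img (Set.univ : Set (Pt F 1 2))

end PMap

/-! ### Projective isomorphisms and compatible reparametrizations -/

/-- The projective isomorphisms: the biregular maps between the ambient projective spaces
that map `img f` onto `img g`. (When `dim f = dim g`, these are automorphisms of `ℙ^(dim f)`.) -/
def projIso (f g : PMap F) : Set (Pt F 1 f.dim ≃ Pt F 1 g.dim) :=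
  {p | IsRegularOn Set.univ p ∧ IsRegularOn Set.univ p.symm ∧ p '' f.img = g.img}

/-- The compatible reparametrizations: the (representatives of) birational maps `r` between
the domains such that `p ∘ f = g ∘ r`, as rational maps, for some projective isomorphism `p`. -/
def reparam (f g : PMap F) : Set (RatMap F f.dom.k f.dom.m g.dom.k g.dom.m) :=
  {r | r.IsBirational ∧ ∃ p ∈ projIso f g,
    Generic fun x => ∃ y z, f.map.Sends x y ∧ r.Sends x z ∧ g.map.Sends z (p y)}

/-- The `3 × 3` matrix with the rows `(c_0, c_1, c_2)`, `(c_3, c_4, c_5)`, `(c_6, c_7, c_8)`. -/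
def mat (c : Fin 9 → F) : Matrix (Fin 3) (Fin 3) F :=
  !![c 0, c 1, c 2; c 3, c 4, c 5; c 6, c 7, c 8]

variable (F) in
/-- The index set of the normalized matrices: the determinant is not zero and the first nonzero
entry is one. -/
def normIdx : Set (Fin 9 → F) :=
  {c | (mat c).det ≠ 0 ∧ ∃ i, c i = 1 ∧ ∀ j < i, c j = 0}

/-- The linear automorphism `r_c` of `ℙ²`. -/
def linAut (c : Fin 9 → F) (hc : c ∈ normIdx F) : Pt F 1 2 → Pt F 1 2 := fun y i =>
  Projectivization.map (Matrix.toLin' (mat c))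
    (Matrix.mulVec_injective_iff_isUnit.mpr
      ((Matrix.isUnit_iff_isUnit_det _).mpr (isUnit_iff_ne_zero.mpr hc.1))) (y i)

end

end SurfIso

open SurfIso

/-!
The class of a map `f` that is characterized by B1 has three-dimensional `h⁰`, and the `dim f + 1`
independent components of `f` are among its global sections, so that `dim f = 2`: the components
span a net `V`. No nonzero form `Φ` vanishes on the image, whose closure is isomorphic to `ℙ²`
(`dominant_of_varIso`): the isomorphism makes the coordinates of `ℙ²` ratios of forms on the image.
The forms of degree `n` in the latter are independent modulo `Φ`, so they make up a space whose
dimension is quadratic in `n`, while the space of forms modulo `Φ` has only linear growth.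

That a dominant net with self-intersection one defines a birational map (`exists_isInverse`) is a
consequence of Noether's inequality. Let `X_a`, `X_b` be two coordinates of the same factor of the
domain. If they were linearly independent over the function field of the target, then the forms
`X_a P(f) + X_b Q(f)`, with forms `P`, `Q` of degree `n`, would make up a space of dimension
`(n + 1)(n + 2)`. As passing `s` times through a point imposes `s(s + 1)/2` conditions, one of these
forms would have multiplicity `s = n + c + 1` at a general point `x`, where `c` is the degree of
`X_a` on members of `V`. Its multiplicities at the base points of `V` are at least `n` times those
of `V`. The intersection with a general member of `V` through `x` would then be too large:
`n V² + c ≥ s` fails because `V² = 1`. Hence `X_a P(f) + X_b Q(f) = 0` for some `P` and `Q`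
(`exists_linear_relation`), and the ratio of `X_a` and `X_b` is a rational function of the components
of `f`. The argument needs that a general member of `V` through `x` has no component in common
with a given form. This holds because `f` contracts no curve to a general point of its image
(`generic_not_contracted`).

Noether's inequality (`noether_inequality`) is obtained from dimension counts. Locally
(`local_noether`), the part of order at least `k` of the ideal of two germs is compared with
the ideals of their strict transforms on the blowup, for a large `k`. Globally (`bezout`), the
forms of large degree surject onto their jets at finitely many points, and the second difference
of the Hilbert function is the intersection product.

Finally, if `p ∘ f = g ∘ r`, then `r = g⁻¹ ∘ p ∘ f`, where `p` is a biregular map of the plane to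
itself. Such a map is given by a triple of forms without common zero (`exists_global_forms`).
Composing it with the triple of its inverse gives the coordinates times a form without zeros, that
is, a constant. So the triples are linear (`exists_eq_linAut`).
-/

namespace SurfIso
open MvPolynomial
noncomputable section
variable {F : Type*} [Field F]

/-! ### Dimension counts for linear maps -/

section Dimension
variable {V W : Type*} [AddCommGroup V] [Module F V] [AddCommGroup W] [Module F W]

lemma finrank_quotient_le_range (f : V →ₗ[F] W) [FiniteDimensional F (LinearMap.range f)]
    {S : Submodule F V} (h : LinearMap.ker f ≤ S) :
    Module.finrank F (V ⧸ S) ≤ Module.finrank F (LinearMap.range f) := by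
  rw [← f.quotKerEquivRange.finrank_eq]
  have : FiniteDimensional F (V ⧸ LinearMap.ker f) := f.quotKerEquivRange.symm.finiteDimensional
  exact LinearMap.finrank_le_finrank_of_surjective (f := Submodule.factor h)
    (Submodule.factor_surjective h)

lemma finrank_range_le_quotient (f : V →ₗ[F] W) {S : Submodule F V}
    [FiniteDimensional F (V ⧸ S)] (h : S ≤ LinearMap.ker f) :
    Module.finrank F (LinearMap.range f) ≤ Module.finrank F (V ⧸ S) := by
  rw [← f.quotKerEquivRange.finrank_eq]
  exact LinearMap.finrank_le_finrank_of_surjective (f := Submodule.factor h)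
    (Submodule.factor_surjective h)

end Dimension

/-! ### Powers of the maximal ideal of the origin -/

lemma origin_eq : origin F = idealOfVars (Fin 2) F := by
  unfold origin idealOfVars
  congr 1
  ext x
  simp [Fin.exists_fin_two, eq_comm]

lemma mem_origin_pow_iff (n : ℕ) (v : Loc F) :
    v ∈ origin F ^ n ↔ ∀ x : Fin 2 →₀ ℕ, x.degree < n → v.coeff x = 0 := by
  rw [origin_eq, mem_pow_idealOfVars_iff']

lemma mem_origin_iff (v : Loc F) : v ∈ origin F ↔ v.coeff 0 = 0 := by
  rw [← pow_one (origin F), mem_origin_pow_iff]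
  constructor
  · intro h; exact h 0 (by simp)
  · intro h x hx
    have : x = 0 := by rw [← Finsupp.degree_eq_zero_iff]; omega
    rw [this, h]

lemma X_mem_origin (i : Fin 2) : (X i : Loc F) ∈ origin F := by
  rw [mem_origin_iff]; simp

lemma exists_notMem_origin_pow {v : Loc F} (hv : v ≠ 0) : ∃ n, v ∉ origin F ^ n := by
  obtain ⟨x, hx⟩ := ne_zero_iff.mp hv
  exact ⟨x.degree + 1, fun h => hx ((mem_origin_pow_iff _ _).mp h x (Nat.lt_succ_self _))⟩

/-- Every nonzero polynomial has an exact order at the origin. -/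
lemma exists_order {v : Loc F} (hv : v ≠ 0) :
    ∃ n, v ∈ origin F ^ n ∧ v ∉ origin F ^ (n + 1) := by
  classical
  have h := exists_notMem_origin_pow hv
  refine ⟨Nat.find h - 1, ?_, ?_⟩
  · by_contra hc
    by_cases h0 : Nat.find h = 0
    · apply hc; simp [h0]
    · exact Nat.find_min h (Nat.sub_one_lt h0) hc
  · have h0 : Nat.find h ≠ 0 := fun h0 => by
      have := Nat.find_spec h
      rw [h0] at this; simp at this
    rw [Nat.sub_add_cancel (Nat.one_le_iff_ne_zero.mpr h0)]
    exact Nat.find_spec h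

/-- The associated graded ring of the local ring at the origin is a domain: if `a` has exact
order `μ` then multiplication by `a` raises orders by exactly `μ`. -/
lemma mem_origin_pow_of_mul_mem {a w : Loc F} {μ n : ℕ} (ha : a ∉ origin F ^ (μ + 1))
    (h : a * w ∈ origin F ^ (n + μ)) : w ∈ origin F ^ n := by
  by_cases hw : w = 0
  · rw [hw]; exact Ideal.zero_mem _
  obtain ⟨j, hj, hj'⟩ := exists_order hw
  by_cases hjn : n ≤ j
  · exact Ideal.pow_le_pow_right hjn hj
  have ha0 : a ≠ 0 := by rintro rfl; exact ha (Ideal.zero_mem _)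
  obtain ⟨i, hi, hi'⟩ := exists_order ha0
  have hiμ : i ≤ μ := by
    by_contra hc
    exact ha (Ideal.pow_le_pow_right (by omega) hi)
  exfalso
  have key : ∀ (v : Loc F) (e : ℕ), v ∈ origin F ^ e → v ∉ origin F ^ (e + 1) →
      homogeneousComponent e v ≠ 0 := by
    intro v e hv hv' h0
    apply hv'
    rw [mem_origin_pow_iff] at hv ⊢
    intro x hx
    rcases Nat.lt_succ_iff_lt_or_eq.mp hx with hx | hx
    · exact hv x hx
    · have := congrArg (coeff x) h0
      rwa [coeff_homogeneousComponent, if_pos hx, coeff_zero] at this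
  have hmul : homogeneousComponent (i + j) (a * w)
      = homogeneousComponent i a * homogeneousComponent j w := by
    have low : ∀ (v : Loc F) (e : ℕ), v ∈ origin F ^ e →
        v - homogeneousComponent e v ∈ origin F ^ (e + 1) := by
      intro v e hv
      rw [mem_origin_pow_iff] at hv ⊢
      intro x hx
      rw [coeff_sub, coeff_homogeneousComponent]
      split_ifs with h
      · ring
      · rw [hv x (by omega), sub_zero]
    have h1 : a * w - homogeneousComponent i a * homogeneousComponent j w
        ∈ origin F ^ (i + j + 1) := by
      have e : a * w - homogeneousComponent i a * homogeneousComponent j w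
        = (a - homogeneousComponent i a) * w
          + homogeneousComponent i a * (w - homogeneousComponent j w) := by ring
      have hia : homogeneousComponent i a ∈ origin F ^ i := by
        have := Ideal.sub_mem _ hi (Ideal.pow_le_pow_right (Nat.le_succ i) (low a i hi))
        simpa using this
      rw [e]
      refine Ideal.add_mem _ ?_ ?_
      · have := Ideal.mul_mem_mul (low a i hi) hj
        rw [← pow_add] at this
        convert this using 2; ring
      · have := Ideal.mul_mem_mul hia (low w j hj)
        rwa [← pow_add, ← add_assoc] at this
    have h2 : homogeneousComponent (i + j)
        (a * w - homogeneousComponent i a * homogeneousComponent j w) = 0 := by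
      ext x
      rw [coeff_homogeneousComponent, coeff_zero]
      split_ifs with hx
      · exact (mem_origin_pow_iff _ _).mp h1 x (by omega)
      · rfl
    rw [map_sub, sub_eq_zero] at h2
    rw [h2]
    exact homogeneousComponent_of_mem
      ((homogeneousComponent_isHomogeneous i a).mul (homogeneousComponent_isHomogeneous j w))
      |>.trans (by simp)
  refine mul_ne_zero (key a i hi hi') (key w j hj hj') ?_
  rw [← hmul]
  ext x
  rw [coeff_homogeneousComponent, coeff_zero]
  split_ifs with hx
  · exact (mem_origin_pow_iff _ _).mp h x (by omega)
  · rfl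

/-- A polynomial that does not vanish at the origin is invertible modulo each power of the
maximal ideal. -/
lemma exists_inverse_mod_origin_pow {Q : Loc F} (hQ : Q ∉ origin F) (K : ℕ) :
    ∃ R, Q * R - 1 ∈ origin F ^ K := by
  rw [mem_origin_iff] at hQ
  set c := Q.coeff 0
  set n : Loc F := 1 - C c⁻¹ * Q
  have hn : n ∈ origin F := by
    rw [mem_origin_iff]
    simp [n, c, coeff_sub, inv_mul_cancel₀ hQ]
  refine ⟨C c⁻¹ * ∑ i ∈ Finset.range K, n ^ i, ?_⟩
  have h := mul_neg_geom_sum n K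
  have e : Q * (C c⁻¹ * ∑ i ∈ Finset.range K, n ^ i) - 1 = - n ^ K := by
    have : (1 - n) = C c⁻¹ * Q := by simp [n]
    rw [this] at h
    linear_combination h
  rw [e]
  exact Ideal.neg_mem_iff _ |>.mpr (Ideal.pow_mem_pow hn K)

/-- The number of monomials of degree less than `k` in two variables. -/
def tri (k : ℕ) : ℕ := ∑ i ∈ Finset.range k, (i + 1)

lemma two_mul_tri (k : ℕ) : 2 * tri k = k * (k + 1) := by
  induction k with
  | zero => simp [tri]
  | succ n ih =>
    rw [tri, Finset.sum_range_succ, ← tri, mul_add, ih]; ring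

lemma coeff_family_surjective {σ ι : Type*} [Finite ι] (e : ι → σ →₀ ℕ)
    (he : Function.Injective e) :
    Function.Surjective (LinearMap.pi fun i => MvPolynomial.lcoeff F (e i) :
      MvPolynomial σ F →ₗ[F] ι → F) := by
  classical
  have := Fintype.ofFinite ι
  intro c
  refine ⟨∑ i, monomial (e i) (c i), ?_⟩
  funext j
  simp [coeff_monomial, he.eq_iff]

/-- The exponents of the monomials of degree less than `k`. -/
def lowExp (k : ℕ) (p : (i : Fin k) × Fin (i.1 + 1)) : Fin 2 →₀ ℕ :=
  Finsupp.single 0 p.2.1 + Finsupp.single 1 (p.1.1 - p.2.1)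

lemma degree_fin2 (x : Fin 2 →₀ ℕ) : x.degree = x 0 + x 1 := by
  rw [Finsupp.degree_eq_sum, Fin.sum_univ_two]

lemma lowExp_zero (k : ℕ) (p) : lowExp k p 0 = p.2.1 := by simp [lowExp]

lemma lowExp_one (k : ℕ) (p) : lowExp k p 1 = p.1.1 - p.2.1 := by simp [lowExp]

lemma lowExp_injective (k : ℕ) : Function.Injective (lowExp k) := by
  rintro ⟨⟨i, hi⟩, ⟨j, hj⟩⟩ ⟨⟨i', hi'⟩, ⟨j', hj'⟩⟩ h
  have h0 := DFunLike.congr_fun h 0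
  have h1 := DFunLike.congr_fun h 1
  simp only [lowExp_zero, lowExp_one] at h0 h1 hj hj'
  obtain rfl : j = j' := h0
  obtain rfl : i = i' := by omega
  rfl

lemma exists_lowExp {k : ℕ} {x : Fin 2 →₀ ℕ} (hx : x.degree < k) : ∃ p, lowExp k p = x := by
  rw [degree_fin2] at hx
  refine ⟨⟨⟨x 0 + x 1, hx⟩, ⟨x 0, by simp⟩⟩, ?_⟩
  ext i
  fin_cases i
  · simp [lowExp]
  · simp [lowExp]

lemma degree_lowExp (k : ℕ) (p) : (lowExp k p).degree < k := by
  rw [degree_fin2, lowExp_zero, lowExp_one]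
  have := p.1.2
  have := p.2.2
  omega

/-- Powers of the maximal ideal, as linear subspaces. -/
abbrev originPow (F : Type*) [Field F] (k : ℕ) : Submodule F (Loc F) :=
  (origin F ^ k).restrictScalars F

lemma ker_lowCoeff (k : ℕ) :
    LinearMap.ker (LinearMap.pi fun i => MvPolynomial.lcoeff F (lowExp k i) :
      Loc F →ₗ[F] _ → F) = originPow F k := by
  ext v
  simp only [LinearMap.mem_ker, Submodule.restrictScalars_mem, mem_origin_pow_iff]
  constructor
  · intro h x hx
    obtain ⟨p, rfl⟩ := exists_lowExp hx
    exact congrFun h p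
  · intro h
    funext p
    exact h _ (degree_lowExp k p)

/-- Coefficients of degree less than `k` are coordinates modulo `origin ^ k`. -/
def jetEquiv (F : Type*) [Field F] (k : ℕ) :
    (Loc F ⧸ originPow F k) ≃ₗ[F] ((i : Fin k) × Fin (i.1 + 1) → F) :=
  (Submodule.quotEquivOfEq _ _ (ker_lowCoeff k).symm).trans
    (LinearMap.quotKerEquivOfSurjective _ (coeff_family_surjective _ (lowExp_injective k)))

lemma finrank_jets (k : ℕ) : Module.finrank F (Loc F ⧸ originPow F k) = tri k := by
  rw [(jetEquiv F k).finrank_eq, Module.finrank_fintype_fun_eq_card, Fintype.card_sigma, tri,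
    Finset.sum_range]
  simp

instance (k : ℕ) : FiniteDimensional F (Loc F ⧸ originPow F k) :=
  (jetEquiv F k).symm.finiteDimensional

lemma finiteDimensional_of_originPow_le {k : ℕ} {J : Submodule F (Loc F)} (h : originPow F k ≤ J) :
    FiniteDimensional F (Loc F ⧸ J) :=
  Module.Finite.of_surjective (Submodule.factor h) (Submodule.factor_surjective h)


/-! ### Division by powers of the exceptional curve -/

lemma exc_ne_zero (t : Option F) : exc t ≠ 0 := by
  cases t <;> exact X_ne_zero _

lemma exc_mem_origin (t : Option F) : exc t ∈ origin F := by
  cases t <;> exact X_mem_origin _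

lemma exc_pow_mul_cancel {t : Option F} {m : ℕ} {v w : Loc F}
    (h : exc t ^ m * v = exc t ^ m * w) : v = w :=
  mul_left_cancel₀ (pow_ne_zero m (exc_ne_zero t)) h

lemma blow_mem_span (t : Option F) {v : Loc F} (hv : v ∈ origin F) :
    blow t v ∈ Ideal.span {exc t} := by
  have h : origin F ≤ (Ideal.span {exc t}).comap (blow t) := by
    unfold origin
    rw [Ideal.span_le]
    rintro x hx
    rw [SetLike.mem_coe, Ideal.mem_comap, Ideal.mem_span_singleton]
    rcases hx with rfl | rfl <;> cases t <;> simp [blow, exc]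
  exact h hv

lemma exc_pow_dvd_blow (t : Option F) {m : ℕ} {v : Loc F} (hv : v ∈ origin F ^ m) :
    exc t ^ m ∣ blow t v := by
  rw [← Ideal.mem_span_singleton, ← Ideal.span_singleton_pow]
  have h : (origin F) ≤ (Ideal.span {exc t}).comap (blow t) := fun x hx => blow_mem_span t hx
  have h2 : (origin F) ^ m ≤ ((Ideal.span {exc t}) ^ m).comap (blow t) :=
    (Ideal.pow_right_mono h m).trans (Ideal.le_comap_pow _ m)
  exact h2 hv

/-- A linear map that divides multiples of `exc t ^ m` by `exc t ^ m`. -/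
def divExc (t : Option F) (m : ℕ) : Loc F →ₗ[F] Loc F :=
  (LinearMap.exists_leftInverse_of_injective (LinearMap.mulLeft F (exc t ^ m))
    (LinearMap.ker_eq_bot.mpr fun _ _ h => exc_pow_mul_cancel h)).choose

lemma divExc_mul (t : Option F) (m : ℕ) (v : Loc F) : divExc t m (exc t ^ m * v) = v := by
  have h := (LinearMap.exists_leftInverse_of_injective (LinearMap.mulLeft F (exc t ^ m))
    (LinearMap.ker_eq_bot.mpr fun _ _ h => exc_pow_mul_cancel h)).choose_spec
  exact LinearMap.congr_fun h v

/-- The pullback under the blowup of the origin, with `m` times the exceptional curve taken out.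
It has this meaning on `origin F ^ m` and is an arbitrary linear extension elsewhere. -/
def virt (t : Option F) (m : ℕ) : Loc F →ₗ[F] Loc F := divExc t m ∘ₗ (blow t).toLinearMap

lemma virt_eq {t : Option F} {m : ℕ} {v w : Loc F} (h : blow t v = exc t ^ m * w) :
    virt t m v = w := by
  simp [virt, h, divExc_mul]

lemma exc_pow_mul_virt (t : Option F) {m : ℕ} {v : Loc F} (hv : v ∈ origin F ^ m) :
    exc t ^ m * virt t m v = blow t v := by
  obtain ⟨w, hw⟩ := exc_pow_dvd_blow t hv
  rw [virt_eq hw, hw]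

lemma virt_mul (t : Option F) {m n : ℕ} {v w : Loc F} (hv : v ∈ origin F ^ m)
    (hw : w ∈ origin F ^ n) : virt t (m + n) (v * w) = virt t m v * virt t n w := by
  apply virt_eq
  rw [map_mul, ← exc_pow_mul_virt t hv, ← exc_pow_mul_virt t hw]
  ring

lemma virt_one (t : Option F) : virt t 0 1 = 1 := virt_eq (by simp)

lemma virt_mem (t : Option F) {m n : ℕ} {v : Loc F} (hv : v ∈ origin F ^ (m + n)) :
    virt t m v ∈ origin F ^ n := by
  obtain ⟨w, hw⟩ := exc_pow_dvd_blow t hv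
  rw [virt_eq (w := exc t ^ n * w) (by rw [hw]; ring)]
  exact Ideal.mul_mem_right _ _ (Ideal.pow_mem_pow (exc_mem_origin t) n)

/-! ### Jets at several points of the exceptional curve -/

/-- A linear form whose strict transform meets the exceptional curve in the direction `t`. -/
def dirForm : Option F → Loc F
  | some t => X 1 - C t * X 0
  | none => X 0

lemma dirForm_mem (t : Option F) : dirForm t ∈ origin F := by
  cases t with
  | none => exact X_mem_origin _
  | some t =>
    exact Ideal.sub_mem _ (X_mem_origin _) (Ideal.mul_mem_left _ _ (X_mem_origin _))

lemma virt_dirForm_self (t : Option F) : virt t 1 (dirForm t) ∈ origin F := by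
  cases t with
  | none =>
    rw [virt_eq (w := X 0) (by simp [blow, dirForm, exc]; ring)]
    exact X_mem_origin _
  | some t =>
    rw [virt_eq (w := X 1) (by simp [blow, dirForm, exc]; ring)]
    exact X_mem_origin _

lemma virt_dirForm_ne {t s : Option F} (h : t ≠ s) : virt t 1 (dirForm s) ∉ origin F := by
  cases t with
  | none =>
    cases s with
    | none => exact absurd rfl h
    | some s =>
      rw [virt_eq (w := 1 - C s * X 0) (by simp [blow, dirForm, exc]; ring), mem_origin_iff]
      simp [coeff_sub]
  | some t =>
    cases s with
    | none =>
      rw [virt_eq (w := 1) (by simp [blow, dirForm, exc]), mem_origin_iff]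
      simp
    | some s =>
      rw [virt_eq (w := X 1 + C (t - s)) (by simp [blow, dirForm, exc]; ring), mem_origin_iff]
      simp only [coeff_add, coeff_zero_X, coeff_zero_C, zero_add]
      exact sub_ne_zero.mpr fun e => h (by rw [e])

lemma origin_isPrime : (origin F).IsPrime := by
  refine ⟨?_, ?_⟩
  · rw [Ideal.ne_top_iff_one, mem_origin_iff]; simp
  · intro x y h
    simp only [mem_origin_iff] at h ⊢
    have : (x * y).coeff 0 = x.coeff 0 * y.coeff 0 := by
      simp only [← constantCoeff_eq, map_mul]
    rw [this] at h
    exact mul_eq_zero.mp h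

lemma exists_virt_monomial (t : Option F) {k K : ℕ} (hk : K ≤ k) (x : Fin 2 →₀ ℕ)
    (hx : x.degree < K) (c : F) :
    ∃ v ∈ origin F ^ k, virt t k v = monomial x c := by
  rw [degree_fin2] at hx
  have hm : monomial x c = C c * (X 0 ^ x 0 * X 1 ^ x 1) := by
    rw [monomial_eq, Finsupp.prod_fintype _ _ (by simp), Fin.prod_univ_two]
  cases t with
  | none =>
    refine ⟨C c * (X 1 ^ (k + x 1 - x 0) * X 0 ^ x 0), ?_, ?_⟩
    · refine Ideal.mul_mem_left _ _ ?_
      have := Ideal.mul_mem_mul (Ideal.pow_mem_pow (X_mem_origin (F := F) 1) (k + x 1 - x 0))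
        (Ideal.pow_mem_pow (X_mem_origin (F := F) 0) (x 0))
      rw [← pow_add] at this
      exact Ideal.pow_le_pow_right (by omega) this
    · apply virt_eq
      rw [hm]
      have e : (X 1 : Loc F) ^ k * X 1 ^ x 1 = X 1 ^ (k + x 1 - x 0) * X 1 ^ x 0 := by
        rw [← pow_add, ← pow_add]; congr 1; omega
      simp only [blow, exc, map_mul, algHom_C, algebraMap_eq, map_pow, aeval_X]
      simp only [Matrix.cons_val_zero, Matrix.cons_val_one, mul_pow]
      linear_combination (-C c * X 0 ^ x 0) * e
  | some t =>
    refine ⟨C c * (X 0 ^ (k + x 0 - x 1) * (X 1 - C t * X 0) ^ x 1), ?_, ?_⟩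
    · refine Ideal.mul_mem_left _ _ ?_
      have := Ideal.mul_mem_mul (Ideal.pow_mem_pow (X_mem_origin (F := F) 0) (k + x 0 - x 1))
        (Ideal.pow_mem_pow (dirForm_mem (some t)) (x 1))
      rw [← pow_add] at this
      exact Ideal.pow_le_pow_right (by omega) this
    · apply virt_eq
      rw [hm]
      have e : (X 0 : Loc F) ^ k * X 0 ^ x 0 = X 0 ^ (k + x 0 - x 1) * X 0 ^ x 1 := by
        rw [← pow_add, ← pow_add]; congr 1; omega
      have e2 : (X 0 * (X 1 + C t) - C t * X 0 : Loc F) = X 0 * X 1 := by ring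
      simp only [blow, exc, map_mul, algHom_C, algebraMap_eq, map_pow, aeval_X, map_sub]
      simp only [Matrix.cons_val_zero, Matrix.cons_val_one, e2, mul_pow]
      linear_combination (-C c * X 1 ^ x 1) * e

/-- If a linear map takes all monomials of degree less than `K` as values on `S`, then it takes all
values there, up to terms of order `K`. -/
lemma exists_sub_mem_of_monomials {V : Type*} [AddCommGroup V] [Module F V] (S : Submodule F V)
    (T : V →ₗ[F] Loc F) (K : ℕ)
    (h : ∀ (x : Fin 2 →₀ ℕ) (c : F), x.degree < K → ∃ v ∈ S, T v = monomial x c) (g : Loc F) :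
    ∃ v ∈ S, T v - g ∈ origin F ^ K := by
  suffices H : g ∈ S.map T ⊔ originPow F K by
    obtain ⟨_, ⟨v, hv, rfl⟩, z, hz, e⟩ := Submodule.mem_sup.mp H
    refine ⟨v, hv, ?_⟩
    rw [← e, sub_add_cancel_left]
    exact (Ideal.neg_mem_iff _).mpr hz
  rw [g.as_sum]
  refine Submodule.sum_mem _ fun x _ => ?_
  by_cases hx : x.degree < K
  · obtain ⟨v, hv, e⟩ := h x (g.coeff x) hx
    rw [← e]
    exact Submodule.mem_sup_left ⟨v, hv, rfl⟩
  · refine Submodule.mem_sup_right ?_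
    rw [Submodule.restrictScalars_mem, mem_origin_pow_iff]
    intro y hy
    rw [coeff_monomial, if_neg]
    rintro rfl
    exact hx hy

lemma virt_prod_dirForm_pow (t : Option F) (τ : Finset (Option F)) (K : ℕ) :
    (∏ s ∈ τ, dirForm s ^ K) ∈ origin F ^ (K * τ.card) ∧
    virt t (K * τ.card) (∏ s ∈ τ, dirForm s ^ K) = ∏ s ∈ τ, virt t 1 (dirForm s) ^ K := by
  classical
  have hp : ∀ (s : Option F) (n : ℕ), virt t n (dirForm s ^ n) = virt t 1 (dirForm s) ^ n := by
    intro s n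
    induction n with
    | zero => simp [virt_one]
    | succ n ih =>
      rw [pow_succ, virt_mul t (Ideal.pow_mem_pow (dirForm_mem s) n)
        (by simpa using dirForm_mem s), ih, pow_succ]
  induction τ using Finset.induction_on with
  | empty => simp [virt_one]
  | insert a τ ha ih =>
    rw [Finset.prod_insert ha, Finset.prod_insert ha, Finset.card_insert_of_notMem ha,
      mul_add, mul_one, add_comm (K * _), ← hp]
    have h1 := Ideal.pow_mem_pow (dirForm_mem a) K
    refine ⟨?_, ?_⟩
    · rw [pow_add]; exact Ideal.mul_mem_mul h1 ih.1
    · rw [virt_mul t h1 ih.1, ih.2]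

/-- Members of a high power of the maximal ideal can have arbitrary jets at finitely
many points of the exceptional curve: the negative of this curve is relatively ample. -/
lemma exists_virt_jets (τ : Finset (Option F)) (K : ℕ) {k : ℕ} (hk : K * τ.card + K ≤ k)
    (g : Option F → Loc F) :
    ∃ w ∈ origin F ^ k, ∀ t ∈ τ, virt t k w - g t ∈ origin F ^ K := by
  classical
  have one : ∀ t ∈ τ, ∃ w ∈ origin F ^ k, virt t k w - g t ∈ origin F ^ K ∧
      ∀ s ∈ τ, s ≠ t → virt s k w ∈ origin F ^ K := by
    intro t ht
    -- A product of linear forms takes care of the other points. It does not vanish at `t`, so that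
    -- there it can be compensated for by an inverse modulo `origin F ^ K`.
    set τ' := τ.erase t
    set e := K * τ'.card
    have he : e + K ≤ k := by
      have : τ'.card ≤ τ.card := Finset.card_le_card (Finset.erase_subset _ _)
      have := Nat.mul_le_mul_left K this
      omega
    set q := ∏ s ∈ τ', dirForm s ^ K
    have hq : q ∈ origin F ^ e := (virt_prod_dirForm_pow t τ' K).1
    have hQ : virt t e q ∉ origin F := by
      rw [(virt_prod_dirForm_pow t τ' K).2]
      intro h
      obtain ⟨s, hs, h⟩ := (origin_isPrime.prod_mem_iff).mp h
      exact virt_dirForm_ne (Finset.ne_of_mem_erase hs).symm (origin_isPrime.mem_of_pow_mem _ h)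
    obtain ⟨R, hR⟩ := exists_inverse_mod_origin_pow hQ K
    obtain ⟨v, hv, hv'⟩ := exists_sub_mem_of_monomials (originPow F (k - e)) (virt t (k - e)) K
      (fun x c hx => exists_virt_monomial t (by omega) x hx c) (R * g t)
    have hk' : e + (k - e) = k := by omega
    have hmul : ∀ s, virt s k (q * v) = virt s e q * virt s (k - e) v := by
      intro s
      conv_lhs => rw [← hk']
      exact virt_mul s hq hv
    refine ⟨q * v, ?_, ?_, ?_⟩
    · rw [← hk', pow_add]; exact Ideal.mul_mem_mul hq hv
    · rw [hmul]
      have : virt t e q * virt t (k - e) v - g t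
        = virt t e q * (virt t (k - e) v - R * g t) + g t * (virt t e q * R - 1) := by ring
      rw [this]
      exact Ideal.add_mem _ (Ideal.mul_mem_left _ _ hv') (Ideal.mul_mem_left _ _ hR)
    · intro s hs hst
      rw [hmul, (virt_prod_dirForm_pow s τ' K).2]
      refine Ideal.mul_mem_right _ _ ?_
      rw [← Finset.mul_prod_erase _ _ (Finset.mem_erase.mpr ⟨hst, hs⟩)]
      exact Ideal.mul_mem_right _ _ (Ideal.pow_mem_pow (virt_dirForm_self s) K)
  choose! w hw h1 h2 using one
  refine ⟨∑ t ∈ τ, w t, Ideal.sum_mem _ hw, fun t ht => ?_⟩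
  rw [map_sum, ← Finset.add_sum_erase _ _ ht, add_sub_right_comm]
  refine Ideal.add_mem _ (h1 t ht) (Ideal.sum_mem _ fun s hs => ?_)
  exact h2 s (Finset.mem_of_mem_erase hs) t ht (Finset.ne_of_mem_erase hs).symm


/-! ### The local form of Noether's inequality -/

/-- The ideal generated by two curve germs, up to terms of order `K`, as a linear subspace.
Its codimension is a lower bound for their intersection number at the origin. -/
def interSpace (a b : Loc F) (K : ℕ) : Submodule F (Loc F) :=
  (Ideal.span {a, b} ⊔ origin F ^ K).restrictScalars F

/-- The intersection number at the origin, computed up to terms of order `K`. -/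
def interNum (a b : Loc F) (K : ℕ) : ℕ := Module.finrank F (Loc F ⧸ interSpace a b K)

lemma originPow_le_interSpace (a b : Loc F) (K : ℕ) : originPow F K ≤ interSpace a b K :=
  fun _ h => Ideal.mem_sup_right h

instance (a b : Loc F) (K : ℕ) : FiniteDimensional F (Loc F ⧸ interSpace a b K) :=
  finiteDimensional_of_originPow_le (originPow_le_interSpace a b K)

lemma left_mem_interSpace (a b : Loc F) (K : ℕ) (u : Loc F) : u * a ∈ interSpace a b K :=
  Ideal.mem_sup_left (Ideal.mul_mem_left _ _ (Ideal.subset_span (by simp)))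

lemma right_mem_interSpace (a b : Loc F) (K : ℕ) (u : Loc F) : u * b ∈ interSpace a b K :=
  Ideal.mem_sup_left (Ideal.mul_mem_left _ _ (Ideal.subset_span (by simp)))

lemma interSpace_mono (a b : Loc F) {K K' : ℕ} (h : K ≤ K') :
    interSpace a b K' ≤ interSpace a b K :=
  fun _ hv => (sup_le_sup_left (Ideal.pow_le_pow_right h) (Ideal.span {a, b}) :
    Ideal.span {a, b} ⊔ origin F ^ K' ≤ Ideal.span {a, b} ⊔ origin F ^ K) hv

lemma interNum_mono (a b : Loc F) {K K' : ℕ} (h : K ≤ K') : interNum a b K ≤ interNum a b K' :=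
  LinearMap.finrank_le_finrank_of_surjective (f := Submodule.factor (interSpace_mono a b h))
    (Submodule.factor_surjective _)

/-- The members of order at least `k` of the ideal of two germs of orders `μ` and `c` that are
visible on the blowup. -/
def blowSpace (a b : Loc F) (μ c k K : ℕ) : Submodule F (Loc F) :=
  (Ideal.span {a} * origin F ^ (k - μ) ⊔ Ideal.span {b} * origin F ^ (k - c)
    ⊔ origin F ^ K).restrictScalars F

/-- The syzygies `(b w, -a w)` bound the number of conditions that distinguish the ideal `(a, b)`
from its part of order at least `k`. -/
lemma finrank_blowSpace_le {a b : Loc F} {μ c k K : ℕ} (ha' : a ∉ origin F ^ (μ + 1)) (hk : μ + c ≤ k) :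
    Module.finrank F (Loc F ⧸ blowSpace a b μ c k K) + tri (k - μ - c)
      ≤ interNum a b K + tri (k - μ) + tri (k - c) := by
  set I' := blowSpace a b μ c k K with hI'
  have hKI : originPow F K ≤ I' := fun _ h => Ideal.mem_sup_right h
  have : FiniteDimensional F (Loc F ⧸ I') := finiteDimensional_of_originPow_le hKI
  -- the map `(u, v) ↦ u a + v b` modulo `I'`
  let θ₀ : Loc F × Loc F →ₗ[F] Loc F :=
    (LinearMap.mulRight F a).coprod (LinearMap.mulRight F b)
  have hle : (originPow F (k - μ)).prod (originPow F (k - c)) ≤ I'.comap θ₀ := by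
    rintro ⟨u, v⟩ ⟨hu, hv⟩
    change u * a + v * b ∈ Ideal.span {a} * origin F ^ (k - μ) ⊔
      Ideal.span {b} * origin F ^ (k - c) ⊔ origin F ^ K
    refine Ideal.mem_sup_left (Submodule.add_mem_sup ?_ ?_)
    · rw [mul_comm u]; exact Ideal.mul_mem_mul (Ideal.mem_span_singleton_self a) hu
    · rw [mul_comm v]; exact Ideal.mul_mem_mul (Ideal.mem_span_singleton_self b) hv
  let θ : Loc F × Loc F →ₗ[F] Loc F ⧸ I' := I'.mkQ ∘ₗ θ₀
  -- the quotient of the source of `θ` by obvious elements of its kernel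
  let N := (Loc F ⧸ originPow F (k - μ)) × (Loc F ⧸ originPow F (k - c))
  let π : Loc F × Loc F →ₗ[F] N := (originPow F (k - μ)).mkQ.prodMap (originPow F (k - c)).mkQ
  let γ₀ : Loc F →ₗ[F] Loc F × Loc F := (LinearMap.mulLeft F b).prod (-LinearMap.mulLeft F a)
  let γ : Loc F →ₗ[F] N := π ∘ₗ γ₀
  have hγker : LinearMap.ker γ ≤ originPow F (k - μ - c) := by
    intro w hw
    have h2 : -(a * w) ∈ originPow F (k - c) := by
      have := congrArg Prod.snd (LinearMap.mem_ker.mp hw)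
      exact (Submodule.Quotient.mk_eq_zero _).mp this
    have h3 : a * w ∈ origin F ^ (k - μ - c + μ) := by
      rw [show k - μ - c + μ = k - c by omega]
      exact (Ideal.neg_mem_iff _).mp h2
    exact mem_origin_pow_of_mul_mem ha' h3
  have hπ : Function.Surjective π := by
    rintro ⟨x, y⟩
    obtain ⟨u, rfl⟩ := Submodule.mkQ_surjective _ x
    obtain ⟨v, rfl⟩ := Submodule.mkQ_surjective _ y
    exact ⟨(u, v), rfl⟩
  have hπker : LinearMap.ker π ≤ LinearMap.ker θ := by
    rintro ⟨u, v⟩ h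
    have h1 := (Submodule.Quotient.mk_eq_zero _).mp (congrArg Prod.fst (LinearMap.mem_ker.mp h))
    have h2 := (Submodule.Quotient.mk_eq_zero _).mp (congrArg Prod.snd (LinearMap.mem_ker.mp h))
    exact (Submodule.Quotient.mk_eq_zero _).mpr (hle ⟨h1, h2⟩)
  have hγ1 : tri (k - μ - c) ≤ Module.finrank F (LinearMap.range γ) := by
    rw [← finrank_jets (F := F)]
    exact finrank_quotient_le_range γ hγker
  -- count dimensions in the source of `θ`
  have hθ : Module.finrank F (LinearMap.range θ) + tri (k - μ - c) ≤ tri (k - μ) + tri (k - c) := by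
    let S := LinearMap.range γ
    have hS : S.comap π ≤ LinearMap.ker θ := by
      intro z hz
      obtain ⟨w, hw⟩ := hz
      have h1 : z - γ₀ w ∈ LinearMap.ker θ := by
        refine hπker ?_
        rw [LinearMap.mem_ker, map_sub, sub_eq_zero]
        exact hw.symm
      have h2 : γ₀ w ∈ LinearMap.ker θ := by
        have : θ₀ (γ₀ w) = 0 := by
          change b * w * a + -(a * w) * b = 0
          ring
        rw [LinearMap.mem_ker]
        change I'.mkQ (θ₀ (γ₀ w)) = 0
        rw [this, map_zero]
      have := Submodule.add_mem _ h1 h2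
      rwa [sub_add_cancel] at this
    have e : ((Loc F × Loc F) ⧸ S.comap π) ≃ₗ[F] N ⧸ S :=
      (Submodule.quotEquivOfEq _ _ (by
        rw [LinearMap.ker_comp, Submodule.ker_mkQ])).trans
      (LinearMap.quotKerEquivOfSurjective (S.mkQ ∘ₗ π)
        ((Submodule.mkQ_surjective S).comp hπ))
    have : FiniteDimensional F ((Loc F × Loc F) ⧸ S.comap π) := e.symm.finiteDimensional
    have h1 := finrank_range_le_quotient θ hS
    rw [e.finrank_eq] at h1
    have h2 := S.finrank_quotient_add_finrank
    have h4 : Module.finrank F S = Module.finrank F (LinearMap.range γ) := rfl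
    have h3 : Module.finrank F N = tri (k - μ) + tri (k - c) := by
      rw [Module.finrank_prod, finrank_jets, finrank_jets]
    omega
  have hII : I' ≤ interSpace a b K := by
    change (Ideal.span {a} * origin F ^ (k - μ) ⊔ Ideal.span {b} * origin F ^ (k - c)
      ⊔ origin F ^ K) ≤ Ideal.span {a, b} ⊔ origin F ^ K
    refine sup_le_sup_right (sup_le ?_ ?_) _
    · exact Ideal.mul_le_left.trans (Ideal.span_mono (s := {a}) (t := {a, b}) (by simp))
    · exact Ideal.mul_le_left.trans (Ideal.span_mono (s := {b}) (t := {a, b}) (by simp))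
  have hker : LinearMap.ker (Submodule.factor hII) ≤ LinearMap.range θ := by
    intro x hx
    obtain ⟨v, rfl⟩ := Submodule.mkQ_surjective _ x
    have hv : v ∈ interSpace a b K := (Submodule.Quotient.mk_eq_zero _).mp (LinearMap.mem_ker.mp hx)
    obtain ⟨y, hy, z, hz, rfl⟩ := Submodule.mem_sup.mp
      (show v ∈ Ideal.span {a, b} ⊔ origin F ^ K from hv)
    obtain ⟨u, w, rfl⟩ := Ideal.mem_span_pair.mp hy
    refine ⟨(u, w), ?_⟩
    change I'.mkQ (u * a + w * b) = I'.mkQ (u * a + w * b + z)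
    rw [map_add _ _ z]
    have : I'.mkQ z = 0 := (Submodule.Quotient.mk_eq_zero _).mpr (hKI hz)
    rw [this, add_zero]
  have h1 := (Submodule.factor hII).finrank_range_add_finrank_ker
  rw [LinearMap.range_eq_top.mpr (Submodule.factor_surjective hII), finrank_top] at h1
  have h2 := Submodule.finrank_mono hker
  unfold interNum
  omega

/-- Restricting members of order at least `k` to the blowup bounds their number modulo the
ideal `(a, b)` from below by the intersection numbers on the exceptional curve. -/
lemma le_finrank_blowSpace {a b : Loc F} {μ c : ℕ} (ha : a ∈ origin F ^ μ) (hb : b ∈ origin F ^ c)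
    (τ : Finset (Option F)) (K : ℕ) {k : ℕ} (hk : μ + c ≤ k) (hk' : K * τ.card + K ≤ k) :
    tri k + ∑ t ∈ τ, interNum (virt t μ a) (virt t c b) K
      ≤ Module.finrank F (Loc F ⧸ blowSpace a b μ c k (k + K)) := by
  set I' := blowSpace a b μ c k (k + K) with hI'
  have hKI : originPow F (k + K) ≤ I' := fun _ h => Ideal.mem_sup_right h
  have : FiniteDimensional F (Loc F ⧸ I') := finiteDimensional_of_originPow_le hKI
  let J : τ → Submodule F (Loc F) := fun t => interSpace (virt t.1 μ a) (virt t.1 c b) K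
  let Λ : Loc F →ₗ[F] (Loc F ⧸ originPow F k) × ((t : τ) → Loc F ⧸ J t) :=
    (originPow F k).mkQ.prod (LinearMap.pi fun t => (J t).mkQ ∘ₗ virt t.1 k)
  -- jets on the blowup can be prescribed without a change of the jet of order `k` at the origin
  have hΛ : Function.Surjective Λ := by
    rintro ⟨x, y⟩
    obtain ⟨u, rfl⟩ := Submodule.mkQ_surjective _ x
    choose g hg using fun t => Submodule.mkQ_surjective (J t) (y t)
    classical
    obtain ⟨w, hw, hw'⟩ := exists_virt_jets τ K hk'
      (fun t => if h : t ∈ τ then g ⟨t, h⟩ - virt t k u else 0)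
    refine ⟨u + w, Prod.ext ?_ ?_⟩
    · change (originPow F k).mkQ (u + w) = (originPow F k).mkQ u
      rw [map_add]
      have : (originPow F k).mkQ w = 0 := (Submodule.Quotient.mk_eq_zero _).mpr hw
      rw [this, add_zero]
    · funext t
      change (J t).mkQ (virt t.1 k (u + w)) = y t
      rw [← hg]
      have h := hw' t.1 t.2
      rw [dif_pos t.2] at h
      refine (Submodule.Quotient.eq _).mpr (originPow_le_interSpace _ _ K ?_)
      rw [map_add]
      have e : virt t.1 k u + virt t.1 k w - g t
        = virt t.1 k w - (g ⟨t.1, t.2⟩ - virt t.1 k u) := by ring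
      rw [e]; exact h
  have hker : I' ≤ LinearMap.ker Λ := by
    have hmul : ∀ z d, z ∈ origin F ^ d → d ≤ k → ∀ v ∈ origin F ^ (k - d),
        z * v ∈ origin F ^ k ∧
        ∀ t : Option F, virt t k (z * v) = virt t d z * virt t (k - d) v := by
      intro z d hz hd v hv
      have hk' : d + (k - d) = k := by omega
      refine ⟨?_, ?_⟩
      · rw [← hk', pow_add]; exact Ideal.mul_mem_mul hz hv
      · intro t
        conv_lhs => rw [← hk']
        exact virt_mul t hz hv
    intro v hv
    obtain ⟨y, hy, z, hz, rfl⟩ := Submodule.mem_sup.mp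
      (show v ∈ Ideal.span {a} * origin F ^ (k - μ) ⊔ Ideal.span {b} * origin F ^ (k - c)
        ⊔ origin F ^ (k + K) from hv)
    obtain ⟨y1, hy1, y2, hy2, rfl⟩ := Submodule.mem_sup.mp hy
    obtain ⟨u1, hu1, rfl⟩ := Ideal.mem_span_singleton_mul.mp hy1
    obtain ⟨u2, hu2, rfl⟩ := Ideal.mem_span_singleton_mul.mp hy2
    obtain ⟨m1, e1⟩ := hmul a μ ha (by omega) u1 hu1
    obtain ⟨m2, e2⟩ := hmul b c hb (by omega) u2 hu2
    rw [LinearMap.mem_ker]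
    refine Prod.ext ?_ ?_
    · refine (Submodule.Quotient.mk_eq_zero _).mpr ?_
      exact Ideal.add_mem _ (Ideal.add_mem _ m1 m2) (Ideal.pow_le_pow_right (by omega) hz)
    · funext t
      refine (Submodule.Quotient.mk_eq_zero _).mpr ?_
      rw [map_add, map_add, e1, e2]
      refine Submodule.add_mem _ (Submodule.add_mem _ ?_ ?_) ?_
      · rw [mul_comm]; exact left_mem_interSpace _ _ _ _
      · rw [mul_comm]; exact right_mem_interSpace _ _ _ _
      · exact originPow_le_interSpace _ _ _ (virt_mem t.1 hz)
  have h := finrank_range_le_quotient Λ hker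
  rw [LinearMap.range_eq_top.mpr hΛ, finrank_top, Module.finrank_prod, finrank_jets,
    Module.finrank_pi_fintype] at h
  rw [← Finset.sum_coe_sort τ]
  exact h

/-- Noether's inequality for one blowup. -/
lemma local_noether_step {a b : Loc F} {μ c : ℕ} (ha : a ∈ origin F ^ μ)
    (ha' : a ∉ origin F ^ (μ + 1)) (hb : b ∈ origin F ^ c) (τ : Finset (Option F)) (K : ℕ) :
    ∃ K', μ * c + ∑ t ∈ τ, interNum (virt t μ a) (virt t c b) K ≤ interNum a b K' := by
  set k := μ + c + (K * τ.card + K)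
  refine ⟨k + K, ?_⟩
  have h1 := le_finrank_blowSpace ha hb τ K (k := k) (by omega) (by omega)
  have h2 := finrank_blowSpace_le (b := b) (c := c) (k := k) (K := k + K) ha' (by omega)
  -- the second difference of `tri`
  have key : tri k + tri (k - μ - c) = μ * c + tri (k - μ) + tri (k - c) := by
    obtain ⟨j, hj⟩ : ∃ j, k = μ + c + j := ⟨_, rfl⟩
    have e0 : k - μ - c = j := by omega
    have e1 : k - μ = c + j := by omega
    have e2 : k - c = μ + j := by omega
    rw [e0, e1, e2, hj]
    have t1 := two_mul_tri (μ + c + j)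
    have t2 := two_mul_tri j
    have t3 := two_mul_tri (c + j)
    have t4 := two_mul_tri (μ + j)
    nlinarith
  omega

/-- `w l` is what remains at the infinitely near point `l` of the pullback of the germ `v` when
`c l'` times the exceptional curve is taken out at each preceding `l'`, and `v` has virtual
multiplicities at least `c`. -/
def IsVirtual (c : List (Option F) → ℕ) (w : List (Option F) → Loc F) : Prop :=
  ∀ l, w l ∈ origin F ^ c l ∧ ∀ t, blow t (w l) = exc t ^ c l * w (l ++ [t])

lemma sum_biUnion_le {ι κ : Type*} [DecidableEq κ] (s : Finset ι) (t : ι → Finset κ) (f : κ → ℕ) :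
    ∑ x ∈ s.biUnion t, f x ≤ ∑ i ∈ s, ∑ x ∈ t i, f x := by
  classical
  induction s using Finset.induction_on with
  | empty => simp
  | insert i s hi ih =>
    rw [Finset.biUnion_insert, Finset.sum_insert hi]
    have := Finset.sum_union_inter (s₁ := t i) (s₂ := s.biUnion t) (f := f)
    omega

lemma IsVirtual.cons {c : List (Option F) → ℕ} {w : List (Option F) → Loc F} (h : IsVirtual c w)
    (t : Option F) : IsVirtual (fun l => c (t :: l)) (fun l => w (t :: l)) :=
  fun l => ⟨(h (t :: l)).1, fun s => (h (t :: l)).2 s⟩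

/-- Noether's inequality: the intersection number of two germs is at least the sum of the products
of their multiplicities at the infinitely near points. For the second germ these may be virtual
multiplicities, but for the first germ they have to be exact. -/
lemma local_noether (n : ℕ) : ∀ (T : Finset (List (Option F))) (μ c : List (Option F) → ℕ)
    (a b : List (Option F) → Loc F), (∀ l ∈ T, l.length < n) → IsVirtual μ a → IsVirtual c b →
    (∀ l l', l ++ l' ∈ T → a l ∉ origin F ^ (μ l + 1)) →
    ∃ K, ∑ l ∈ T, μ l * c l ≤ interNum (a []) (b []) K := by
  classical
  induction n with
  | zero =>
    intro T μ c a b hT _ _ _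
    have : T = ∅ := Finset.eq_empty_of_forall_notMem fun l hl => by simpa using hT l hl
    exact ⟨0, by simp [this]⟩
  | succ n ih =>
    intro T μ c a b hT ha hb hex
    by_cases hT0 : T = ∅
    · exact ⟨0, by simp [hT0]⟩
    obtain ⟨l0, hl0⟩ := Finset.nonempty_iff_ne_empty.mpr hT0
    have hroot := hex [] l0 hl0
    let τ : Finset (Option F) := (T.image List.head?).biUnion Option.toFinset
    let T' : Option F → Finset (List (Option F)) := fun t =>
      T.preimage (fun l => t :: l) (fun _ _ _ _ h => by simpa using h)
    have hτ : ∀ t l, t :: l ∈ T → t ∈ τ := by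
      intro t l h
      simp only [τ, Finset.mem_biUnion, Finset.mem_image, Option.mem_toFinset]
      exact ⟨some t, ⟨_, h, rfl⟩, rfl⟩
    have hch : ∀ t : Option F, ∃ K, ∑ l ∈ T' t, μ (t :: l) * c (t :: l)
        ≤ interNum (a [t]) (b [t]) K := by
      intro t
      refine ih (T' t) _ _ (fun l => a (t :: l)) (fun l => b (t :: l)) ?_ (ha.cons t) (hb.cons t) ?_
      · intro l hl
        have := hT _ (Finset.mem_preimage.mp hl)
        simpa using this
      · intro l l' hl
        have h : t :: (l ++ l') ∈ T := Finset.mem_preimage.mp hl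
        exact hex (t :: l) l' h
    choose K hK using hch
    obtain ⟨K', hK'⟩ := local_noether_step (ha []).1 hroot (hb []).1 τ (τ.sup K)
    refine ⟨K', le_trans ?_ hK'⟩
    have hva : ∀ t, virt t (μ []) (a []) = a [t] := fun t => virt_eq ((ha []).2 t)
    have hvb : ∀ t, virt t (c []) (b []) = b [t] := fun t => virt_eq ((hb []).2 t)
    simp only [hva, hvb]
    have hsub : T ⊆ insert [] (τ.biUnion fun t => (T' t).image (fun l => t :: l)) := by
      intro l hl
      cases l with
      | nil => simp
      | cons t l =>
        refine Finset.mem_insert_of_mem (Finset.mem_biUnion.mpr ⟨t, hτ t l hl, ?_⟩)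
        exact Finset.mem_image.mpr ⟨l, Finset.mem_preimage.mpr hl, rfl⟩
    refine (Finset.sum_le_sum_of_subset hsub).trans ?_
    rw [Finset.sum_insert (by simp)]
    refine Nat.add_le_add_left ((sum_biUnion_le _ _ _).trans (Finset.sum_le_sum fun t ht => ?_)) _
    rw [Finset.sum_image (fun _ _ _ _ h => by simpa using h)]
    exact (hK t).trans (interNum_mono _ _ (Finset.le_sup ht))


/-! ### Forms -/

section Forms
variable {k m : ℕ}

lemma weight_apply (x : Fin k × Fin (m + 1) →₀ ℕ) (i : Fin k) :
    Finsupp.weight (fun v : Fin k × Fin (m + 1) => (Pi.single v.1 1 : Fin k → ℤ)) x i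
      = ∑ j, (x (i, j) : ℤ) := by
  rw [Finsupp.weight_apply, Finsupp.sum_fintype _ _ (by simp), Finset.sum_apply,
    Fintype.sum_prod_type, Finset.sum_eq_single i]
  · simp
  · intro i' _ hi
    simp [Ne.symm hi]
  · simp

lemma mem_forms_iff {d : Fin k → ℤ} {h : Coord F k m} :
    h ∈ forms F k m d ↔ ∀ x, h.coeff x ≠ 0 → ∀ i, ∑ j, (x (i, j) : ℤ) = d i := by
  unfold forms
  rw [mem_weightedHomogeneousSubmodule]
  simp only [IsWeightedHomogeneous, funext_iff, weight_apply]

lemma X_mem_forms (v : Fin k × Fin (m + 1)) : (X v : Coord F k m) ∈ forms F k m (Pi.single v.1 1) :=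
  isWeightedHomogeneous_X _ _ _

lemma mul_mem_forms {d e : Fin k → ℤ} {g h : Coord F k m} (hg : g ∈ forms F k m d)
    (hh : h ∈ forms F k m e) : g * h ∈ forms F k m (d + e) :=
  IsWeightedHomogeneous.mul hg hh

lemma pow_mem_forms {d : Fin k → ℤ} {g : Coord F k m} (hg : g ∈ forms F k m d) (n : ℕ) :
    g ^ n ∈ forms F k m (n • d) :=
  IsWeightedHomogeneous.pow hg n

lemma prod_mem_forms {ι : Type*} (s : Finset ι) {d : ι → Fin k → ℤ} {g : ι → Coord F k m}
    (hg : ∀ i ∈ s, g i ∈ forms F k m (d i)) : ∏ i ∈ s, g i ∈ forms F k m (∑ i ∈ s, d i) :=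
  IsWeightedHomogeneous.prod s g d hg

lemma C_mem_forms (c : F) : (C c : Coord F k m) ∈ forms F k m 0 :=
  isWeightedHomogeneous_C _ _

lemma deg_nonneg {d : Fin k → ℤ} {h : Coord F k m} (hh : h ∈ forms F k m d) (h0 : h ≠ 0)
    (i : Fin k) : 0 ≤ d i := by
  obtain ⟨x, hx⟩ := ne_zero_iff.mp h0
  rw [← mem_forms_iff.mp hh x hx i]
  positivity

/-- The quotient of two forms, when it is a polynomial, is a form. -/
lemma mem_forms_of_mul_mem {d e : Fin k → ℤ} {g h : Coord F k m} (hg : g ∈ forms F k m d)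
    (hg0 : g ≠ 0) (hgh : g * h ∈ forms F k m e) : h ∈ forms F k m (e - d) := by
  classical
  let w := fun v : Fin k × Fin (m + 1) => (Pi.single v.1 1 : Fin k → ℤ)
  let _ : GradedAlgebra (weightedHomogeneousSubmodule F w) := weightedGradedAlgebra F w
  have h1 := DirectSum.coe_decompose_mul_add_of_left_mem
    (weightedHomogeneousSubmodule F w) (i := d) (j := e - d) (a := g) (b := h) hg
  rw [add_sub_cancel, DirectSum.decompose_of_mem_same (weightedHomogeneousSubmodule F w)
    (show g * h ∈ weightedHomogeneousSubmodule F w e from hgh)] at h1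
  rw [mul_left_cancel₀ hg0 h1]
  exact SetLike.coe_mem _

/-- Substituting forms into a form gives a form. -/
lemma aeval_mem_forms {k' m' : ℕ} {d : Fin k → ℤ} {h : Coord F k m} (hh : h ∈ forms F k m d)
    {e : Fin k → Fin k' → ℤ} {g : Fin k × Fin (m + 1) → Coord F k' m'}
    (hg : ∀ v, g v ∈ forms F k' m' (e v.1)) : aeval g h ∈ forms F k' m' (∑ i, d i • e i) := by
  rw [aeval_def, eval₂_eq']
  refine Submodule.sum_mem _ fun x hx => ?_
  have h1 : ∏ v, g v ^ x v ∈ forms F k' m' (∑ v : Fin k × Fin (m + 1), x v • e v.1) :=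
    prod_mem_forms _ fun v _ => pow_mem_forms (hg v) _
  have h2 : ∑ v : Fin k × Fin (m + 1), x v • e v.1 = ∑ i, d i • e i := by
    rw [Fintype.sum_prod_type]
    refine Finset.sum_congr rfl fun i _ => ?_
    change ∑ j, x (i, j) • e i = _
    rw [← Finset.sum_smul, ← mem_forms_iff.mp hh x (mem_support_iff.mp hx) i]
    rw [← Nat.cast_sum, natCast_zsmul]
  rw [← h2, algebraMap_eq, ← smul_eq_C_mul]
  exact Submodule.smul_mem _ _ h1

/-- Forms are homogeneous functions. -/
lemma aeval_smul_form {A : Type*} [CommRing A] [Algebra F A] {d : Fin k → ℤ} {h : Coord F k m}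
    (hh : h ∈ forms F k m d) (c : Fin k → A) (u : Fin k × Fin (m + 1) → A) :
    aeval (fun v => c v.1 * u v) h = (∏ i, c i ^ (d i).toNat) * aeval u h := by
  rw [aeval_def, aeval_def, eval₂_eq', eval₂_eq', Finset.mul_sum]
  refine Finset.sum_congr rfl fun x hx => ?_
  have h1 : ∀ i, ∑ j, x (i, j) = (d i).toNat := by
    intro i
    rw [← mem_forms_iff.mp hh x (mem_support_iff.mp hx) i, ← Nat.cast_sum, Int.toNat_natCast]
  simp only [mul_pow, Finset.prod_mul_distrib]
  rw [Fintype.prod_prod_type (fun v : Fin k × Fin (m + 1) => c v.1 ^ x v)]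
  simp only [Finset.prod_pow_eq_pow_sum, h1]
  ring

lemma eval_smul_form {d : Fin k → ℤ} {h : Coord F k m}
    (hh : h ∈ forms F k m d) (c : Fin k → F) (u : Fin k × Fin (m + 1) → F) :
    eval (fun v => c v.1 * u v) h = (∏ i, c i ^ (d i).toNat) * eval u h := by
  exact aeval_smul_form hh c u

/-- The point with given homogeneous coordinates. -/
def pt (u : Fin k → Fin (m + 1) → F) (hu : ∀ i, u i ≠ 0) : Pt F k m :=
  fun i => Projectivization.mk F (u i) (hu i)

lemma exists_rep_pt (u : Fin k → Fin (m + 1) → F) (hu : ∀ i, u i ≠ 0) :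
    ∃ c : Fin k → F, (∀ i, c i ≠ 0) ∧ ∀ i j, (pt u hu i).rep j = c i * u i j := by
  choose c hc using fun i => Projectivization.exists_smul_eq_mk_rep F (u i) (hu i)
  refine ⟨fun i => (c i : F), fun i => (c i).ne_zero, fun i j => ?_⟩
  exact (congrFun (hc i) j).symm

/-- Forms of equal degree have the values given by arbitrary homogeneous coordinates, up to a
common factor. -/
lemma exists_val_pt (u : Fin k → Fin (m + 1) → F) (hu : ∀ i, u i ≠ 0) (d : Fin k → ℤ) :
    ∃ c : F, c ≠ 0 ∧ ∀ h ∈ forms F k m d, val (pt u hu) h = c * eval (fun v => u v.1 v.2) h := by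
  obtain ⟨c, hc, hr⟩ := exists_rep_pt u hu
  refine ⟨∏ i, c i ^ (d i).toNat, Finset.prod_ne_zero_iff.mpr fun i _ => pow_ne_zero _ (hc i), ?_⟩
  intro h hh
  rw [← eval_smul_form hh]
  unfold val
  congr 2
  funext v
  exact hr v.1 v.2

lemma val_pt_ne_zero_iff (u : Fin k → Fin (m + 1) → F) (hu : ∀ i, u i ≠ 0) {d : Fin k → ℤ}
    {h : Coord F k m} (hh : h ∈ forms F k m d) :
    val (pt u hu) h ≠ 0 ↔ eval (fun v => u v.1 v.2) h ≠ 0 := by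
  obtain ⟨c, hc, e⟩ := exists_val_pt u hu d
  rw [e h hh]
  simp [hc]

lemma eq_pt (x : Pt F k m) : x = pt (fun i => (x i).rep) (fun i => (x i).rep_nonzero) := by
  funext i; exact ((x i).mk_rep).symm

lemma val_mul (x : Pt F k m) (g h : Coord F k m) : val x (g * h) = val x g * val x h := by
  simp [val]

lemma val_prod {ι : Type*} (s : Finset ι) (x : Pt F k m) (g : ι → Coord F k m) :
    val x (∏ i ∈ s, g i) = ∏ i ∈ s, val x (g i) := by
  simp [val, map_prod]

/-- A nonzero form does not vanish everywhere. -/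
lemma exists_val_ne_zero [Infinite F] {h : Coord F k m} {d : Fin k → ℤ}
    (hh : h ∈ forms F k m d) (h0 : h ≠ 0) : ∃ x : Pt F k m, val x h ≠ 0 := by
  have h1 : h * ∏ i : Fin k, X (i, (0 : Fin (m + 1))) ≠ 0 :=
    mul_ne_zero h0 (Finset.prod_ne_zero_iff.mpr fun i _ => X_ne_zero _)
  obtain ⟨u, hu⟩ : ∃ u, eval u (h * ∏ i : Fin k, X (i, (0 : Fin (m + 1)))) ≠ 0 := by
    by_contra! hc
    exact h1 (MvPolynomial.funext fun u => by rw [hc, map_zero])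
  rw [map_mul, map_prod] at hu
  have h2 := left_ne_zero_of_mul hu
  have h3 := right_ne_zero_of_mul hu
  rw [Finset.prod_ne_zero_iff] at h3
  have hne : ∀ i : Fin k, (fun j => u (i, j)) ≠ 0 := fun i h => h3 i (Finset.mem_univ _) (by
    rw [eval_X]; exact congrFun h 0)
  refine ⟨pt (fun i j => u (i, j)) hne, (val_pt_ne_zero_iff _ _ hh).mpr ?_⟩
  exact h2

lemma eq_zero_of_val [Infinite F] {h : Coord F k m} {d : Fin k → ℤ}
    (hh : h ∈ forms F k m d) (h0 : ∀ x : Pt F k m, val x h = 0) : h = 0 := by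
  by_contra hc
  obtain ⟨x, hx⟩ := exists_val_ne_zero hh hc
  exact hx (h0 x)

/-- Distinct points are separated by a linear form in the coordinates of one of the factors. -/
lemma exists_separating_form {p q : Pt F k m} (h : p ≠ q) :
    ∃ (i : Fin k) (l : Coord F k m), l ∈ forms F k m (Pi.single i 1) ∧ val q l = 0 ∧
      val p l ≠ 0 := by
  obtain ⟨i, hi⟩ := Function.ne_iff.mp h
  obtain ⟨a, ha⟩ := Function.ne_iff.mp (q i).rep_nonzero
  have : ∃ b, (q i).rep a * (p i).rep b - (q i).rep b * (p i).rep a ≠ 0 := by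
    by_contra! hc
    apply hi
    rw [← (p i).mk_rep, ← (q i).mk_rep, Projectivization.mk_eq_mk_iff']
    refine ⟨(p i).rep a / (q i).rep a, ?_⟩
    funext b
    have := hc b
    simp only [Pi.smul_apply, smul_eq_mul]
    field_simp [show (q i).rep a ≠ 0 from ha]
    linear_combination -this
  obtain ⟨b, hb⟩ := this
  refine ⟨i, C ((q i).rep a) * X (i, b) - C ((q i).rep b) * X (i, a), ?_, ?_, ?_⟩
  · rw [← smul_eq_C_mul, ← smul_eq_C_mul]
    exact Submodule.sub_mem _ (Submodule.smul_mem _ _ (X_mem_forms _))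
      (Submodule.smul_mem _ _ (X_mem_forms _))
  · simp [val]; ring
  · simpa [val] using hb

end Forms

/-! ### Dimensions of spaces of forms -/

lemma finrank_forms_of_exponents {k m : ℕ} {d : Fin k → ℤ} {ι : Type*} [Fintype ι]
    (e : ι → Fin k × Fin (m + 1) →₀ ℕ) (he : Function.Injective e)
    (hr : ∀ x : Fin k × Fin (m + 1) →₀ ℕ, (∀ i, ∑ j, (x (i, j) : ℤ) = d i) ↔ ∃ i, e i = x) :
    FiniteDimensional F (forms F k m d) ∧ Module.finrank F (forms F k m d) = Fintype.card ι := by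
  classical
  let T : forms F k m d →ₗ[F] ι → F :=
    (LinearMap.pi fun i => MvPolynomial.lcoeff F (e i)) ∘ₗ (forms F k m d).subtype
  have hT : Function.Bijective T := by
    constructor
    · rw [← LinearMap.ker_eq_bot, LinearMap.ker_eq_bot']
      rintro ⟨h, hh⟩ h0
      refine Subtype.ext (MvPolynomial.ext _ _ fun x => ?_)
      by_contra hx
      obtain ⟨i, rfl⟩ := (hr x).mp (mem_forms_iff.mp hh x hx)
      exact hx (congrFun h0 i)
    · intro c
      refine ⟨⟨∑ i, monomial (e i) (c i), Submodule.sum_mem _ fun i _ => ?_⟩, ?_⟩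
      · rw [mem_forms_iff]
        intro x hx
        rw [coeff_monomial] at hx
        have : e i = x := by
          by_contra hc
          rw [if_neg hc] at hx
          exact hx rfl
        exact (hr x).mpr ⟨i, this⟩
      · funext j
        simp [T, coeff_monomial, he.eq_iff]
  let T' := LinearEquiv.ofBijective T hT
  exact ⟨T'.symm.finiteDimensional, by rw [T'.finrank_eq, Module.finrank_fintype_fun_eq_card]⟩

lemma finrank_forms_plane' (n : ℕ) : FiniteDimensional F (forms F 1 2 fun _ => (n : ℤ)) ∧
    Module.finrank F (forms F 1 2 fun _ => (n : ℤ)) = tri (n + 1) := by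
  have h := finrank_forms_of_exponents (F := F) (k := 1) (m := 2) (d := fun _ => (n : ℤ))
    (ι := (i : Fin (n + 1)) × Fin (i.1 + 1))
    (fun p => Finsupp.single (0, 0) (n - p.1.1) + Finsupp.single (0, 1) p.2.1
      + Finsupp.single (0, 2) (p.1.1 - p.2.1)) ?_ ?_
  · refine ⟨h.1, h.2.trans ?_⟩
    rw [Fintype.card_sigma, tri, Finset.sum_range]
    simp
  · rintro ⟨⟨i, hi⟩, ⟨j, hj⟩⟩ ⟨⟨i', hi'⟩, ⟨j', hj'⟩⟩ h
    have h1 := DFunLike.congr_fun h (0, 1)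
    have h2 := DFunLike.congr_fun h (0, 2)
    simp at h1 h2 hj hj'
    obtain rfl : j = j' := h1
    obtain rfl : i = i' := by omega
    rfl
  · intro x
    constructor
    · intro hx
      have hx := hx 0
      rw [Fin.sum_univ_three] at hx
      refine ⟨⟨⟨x (0, 1) + x (0, 2), by omega⟩, ⟨x (0, 1), by simp⟩⟩, ?_⟩
      ext ⟨i, j⟩
      fin_cases i; fin_cases j <;> simp
      omega
    · rintro ⟨⟨⟨i, hi⟩, ⟨j, hj⟩⟩, rfl⟩ i'
      fin_cases i'
      simp [Fin.sum_univ_three] at hj ⊢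
      omega

lemma finrank_forms_quadric' (n : Fin 2 → ℕ) :
    FiniteDimensional F (forms F 2 1 fun i => (n i : ℤ)) ∧
    Module.finrank F (forms F 2 1 fun i => (n i : ℤ)) = (n 0 + 1) * (n 1 + 1) := by
  have h := finrank_forms_of_exponents (F := F) (k := 2) (m := 1) (d := fun i => (n i : ℤ))
    (ι := Fin (n 0 + 1) × Fin (n 1 + 1))
    (fun p => Finsupp.single (0, 0) p.1.1 + Finsupp.single (0, 1) (n 0 - p.1.1)
      + (Finsupp.single (1, 0) p.2.1 + Finsupp.single (1, 1) (n 1 - p.2.1))) ?_ ?_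
  · refine ⟨h.1, h.2.trans ?_⟩
    simp
  · rintro ⟨⟨i, hi⟩, ⟨j, hj⟩⟩ ⟨⟨i', hi'⟩, ⟨j', hj'⟩⟩ h
    have h1 := DFunLike.congr_fun h (0, 0)
    have h2 := DFunLike.congr_fun h (1, 0)
    simp at h1 h2
    simp [h1, h2]
  · intro x
    constructor
    · intro hx
      have hx0 := hx 0
      have hx1 := hx 1
      rw [Fin.sum_univ_two] at hx0 hx1
      refine ⟨⟨⟨x (0, 0), by omega⟩, ⟨x (1, 0), by omega⟩⟩, ?_⟩
      ext ⟨i, j⟩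
      fin_cases i <;> fin_cases j <;> simp <;> omega
    · rintro ⟨⟨⟨i, hi⟩, ⟨j, hj⟩⟩, rfl⟩ i'
      fin_cases i' <;> simp [Fin.sum_univ_two] <;> omega

/-- The dimension of the space of forms of nonnegative degree `d`, as a polynomial in `d`. It is
doubled for the plane to avoid a division. -/
lemma finrank_forms_plane (d : Fin 1 → ℤ) (hd : ∀ i, 0 ≤ d i) :
    FiniteDimensional F (forms F 1 2 d) ∧
    2 * (Module.finrank F (forms F 1 2 d) : ℤ) = (d 0 + 1) * (d 0 + 2) := by
  obtain ⟨n, hn⟩ := Int.eq_ofNat_of_zero_le (hd 0)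
  obtain rfl : d = fun _ => (n : ℤ) := by funext i; rw [Subsingleton.elim i 0, hn]
  refine ⟨(finrank_forms_plane' n).1, ?_⟩
  rw [(finrank_forms_plane' n).2]
  have := two_mul_tri (n + 1)
  push_cast [← @Nat.cast_inj ℤ] at this
  rw [this]; ring

lemma finrank_forms_quadric (d : Fin 2 → ℤ) (hd : ∀ i, 0 ≤ d i) :
    FiniteDimensional F (forms F 2 1 d) ∧
    (Module.finrank F (forms F 2 1 d) : ℤ) = (d 0 + 1) * (d 1 + 1) := by
  choose n hn using fun i => Int.eq_ofNat_of_zero_le (hd i)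
  obtain rfl : d = fun i => (n i : ℤ) := funext hn
  refine ⟨(finrank_forms_quadric' n).1, ?_⟩
  rw [(finrank_forms_quadric' n).2]
  push_cast; rfl

lemma finiteDimensional_forms (D : Dom) (d : Fin D.k → ℤ) :
    FiniteDimensional F (forms F D.k D.m d) := by
  by_cases hd : ∀ i, 0 ≤ d i
  · cases D with
    | plane => exact (finrank_forms_plane d hd).1
    | quadric => exact (finrank_forms_quadric d hd).1
  · have : forms F D.k D.m d = ⊥ := by
      rw [eq_bot_iff]
      intro h hh
      by_contra h0
      exact hd fun i => deg_nonneg hh h0 i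
    rw [this]
    infer_instance

lemma plane_second_difference (a b E : Fin 1 → ℤ) {x y z t : ℤ}
    (hx : 2 * x = (E 0 + 1) * (E 0 + 2)) (hy : 2 * y = ((E - a) 0 + 1) * ((E - a) 0 + 2))
    (hz : 2 * z = ((E - b) 0 + 1) * ((E - b) 0 + 2))
    (ht : 2 * t = ((E - a - b) 0 + 1) * ((E - a - b) 0 + 2)) : x - y - z + t = a 0 * b 0 := by
  refine mul_left_cancel₀ (two_ne_zero (α := ℤ)) ?_
  rw [mul_add, mul_sub, mul_sub, hx, hy, hz, ht]
  simp only [Pi.sub_apply]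
  ring

lemma quadric_second_difference (a b E : Fin 2 → ℤ) {x y z t : ℤ}
    (hx : x = (E 0 + 1) * (E 1 + 1)) (hy : y = ((E - a) 0 + 1) * ((E - a) 1 + 1))
    (hz : z = ((E - b) 0 + 1) * ((E - b) 1 + 1))
    (ht : t = ((E - a - b) 0 + 1) * ((E - a - b) 1 + 1)) :
    x - y - z + t = a 0 * b 1 + a 1 * b 0 := by
  rw [hx, hy, hz, ht]
  simp only [Pi.sub_apply]
  ring

/-- The second difference of the Hilbert function is the intersection product. -/
lemma finrank_forms_second_difference (D : Dom) {a b E : Fin D.k → ℤ} (ha : ∀ i, 0 ≤ a i)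
    (hb : ∀ i, 0 ≤ b i) (hE : ∀ i, 0 ≤ (E - a - b) i) :
    (Module.finrank F (forms F D.k D.m E) : ℤ) - Module.finrank F (forms F D.k D.m (E - a))
      - Module.finrank F (forms F D.k D.m (E - b))
      + Module.finrank F (forms F D.k D.m (E - a - b)) = D.pair a b := by
  have h1 : ∀ i, 0 ≤ (E - a) i := fun i => by
    have := hE i; have := hb i; simp only [Pi.sub_apply] at *; omega
  have h2 : ∀ i, 0 ≤ (E - b) i := fun i => by
    have := hE i; have := ha i; simp only [Pi.sub_apply] at *; omega
  have h3 : ∀ i, 0 ≤ E i := fun i => by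
    have := h1 i; have := ha i; simp only [Pi.sub_apply] at *; omega
  cases D with
  | plane =>
    exact plane_second_difference a b E (finrank_forms_plane (F := F) E h3).2
      (finrank_forms_plane (F := F) _ h1).2 (finrank_forms_plane (F := F) _ h2).2
      (finrank_forms_plane (F := F) _ hE).2
  | quadric =>
    exact quadric_second_difference a b E (finrank_forms_quadric (F := F) E h3).2
      (finrank_forms_quadric (F := F) _ h1).2 (finrank_forms_quadric (F := F) _ h2).2
      (finrank_forms_quadric (F := F) _ hE).2


/-! ### Dehomogenization -/

section Dehom
variable {D : Dom}

lemma rep_pivot_ne_zero {m : ℕ} (p : Projectivization F (Fin (m + 1) → F)) :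
    p.rep (pivot p) ≠ 0 :=
  (Function.ne_iff.mp p.rep_nonzero).choose_spec

lemma dehom_X_pivot (p : Pt F D.k D.m) (i : Fin D.k) :
    dehom D p (X (i, pivot (p i))) = 1 := by
  simp [dehom]

lemma dehom_X_succAbove (p : Pt F D.k D.m) (i : Fin D.k) (a : Fin D.m) :
    dehom D p (X (i, (pivot (p i)).succAbove a))
      = C ((p i).rep ((pivot (p i)).succAbove a) / (p i).rep (pivot (p i)))
        + X (D.locIdx i a) := by
  simp [dehom]

/-- The local coordinates vanish at the point itself. -/
lemma constantCoeff_dehom (p : Pt F D.k D.m) (h : Coord F D.k D.m) :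
    constantCoeff (dehom D p h)
      = eval (fun v => ((p v.1).rep (pivot (p v.1)))⁻¹ * (p v.1).rep v.2) h := by
  have : (constantCoeff.comp (dehom D p : Coord F D.k D.m →+* Loc F))
      = eval (fun v => ((p v.1).rep (pivot (p v.1)))⁻¹ * (p v.1).rep v.2) := by
    refine MvPolynomial.ringHom_ext (fun c => by simp) ?_
    rintro ⟨i, j⟩
    rcases eq_or_ne j (pivot (p i)) with rfl | hj
    · simp [dehom_X_pivot, rep_pivot_ne_zero]
    · obtain ⟨a, rfl⟩ := Fin.exists_succAbove_eq hj
      simp [dehom_X_succAbove, div_eq_inv_mul]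
  exact RingHom.congr_fun this h

lemma dehom_mem_origin_iff (p : Pt F D.k D.m) {d : Fin D.k → ℤ} {h : Coord F D.k D.m}
    (hh : h ∈ forms F D.k D.m d) : dehom D p h ∈ origin F ↔ val p h = 0 := by
  rw [mem_origin_iff, ← constantCoeff_eq, constantCoeff_dehom,
    eval_smul_form hh (fun i => ((p i).rep (pivot (p i)))⁻¹) (fun v => (p v.1).rep v.2), val,
    mul_eq_zero, or_iff_right]
  exact Finset.prod_ne_zero_iff.mpr fun i _ => pow_ne_zero _ (inv_ne_zero (rep_pivot_ne_zero _))

lemma locIdx_injective : ∀ D : Dom, Function.Injective fun v : Fin D.k × Fin D.m => D.locIdx v.1 v.2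
  | .plane => by
    rintro ⟨i, a⟩ ⟨j, b⟩ h
    exact Prod.ext (Subsingleton.elim (α := Fin 1) _ _) h
  | .quadric => by
    rintro ⟨i, a⟩ ⟨j, b⟩ h
    exact Prod.ext h (Subsingleton.elim (α := Fin 1) _ _)

lemma exists_locIdx : ∀ (D : Dom) (z : Fin 2), ∃ i a, D.locIdx i a = z
  | .plane, z => ⟨(0 : Fin 1), z, rfl⟩
  | .quadric, z => ⟨z, (0 : Fin 1), rfl⟩

/-- A form does not vanish identically near a point. -/
lemma dehom_ne_zero [Infinite F] (p : Pt F D.k D.m) {d : Fin D.k → ℤ} {h : Coord F D.k D.m}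
    (hh : h ∈ forms F D.k D.m d) (h0 : h ≠ 0) : dehom D p h ≠ 0 := by
  have hq0 : h * ∏ i, X (i, pivot (p i)) ≠ 0 :=
    mul_ne_zero h0 (Finset.prod_ne_zero_iff.mpr fun i _ => X_ne_zero _)
  obtain ⟨u, hu⟩ : ∃ u, eval u (h * ∏ i, X (i, pivot (p i))) ≠ 0 := by
    by_contra! hc
    exact hq0 (MvPolynomial.funext fun u => by rw [hc, map_zero])
  rw [map_mul, map_prod] at hu
  have h2 := left_ne_zero_of_mul hu
  have h3 := right_ne_zero_of_mul hu
  simp only [Finset.prod_ne_zero_iff, eval_X, Finset.mem_univ, forall_const] at h3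
  -- normalize the pivot coordinates to one
  have h4 : eval (fun v => (u (v.1, pivot (p v.1)))⁻¹ * u v) h ≠ 0 := by
    rw [eval_smul_form hh (fun i => (u (i, pivot (p i)))⁻¹) u]
    exact mul_ne_zero
      (Finset.prod_ne_zero_iff.mpr fun i _ => pow_ne_zero _ (inv_ne_zero (h3 i))) h2
  let u' : Fin D.k × Fin (D.m + 1) → F := fun v => (u (v.1, pivot (p v.1)))⁻¹ * u v
  let y : Fin D.k × Fin D.m → F := fun v =>
    u' (v.1, (pivot (p v.1)).succAbove v.2)
      - (p v.1).rep ((pivot (p v.1)).succAbove v.2) / (p v.1).rep (pivot (p v.1))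
  let z : Fin 2 → F := Function.extend (fun v : Fin D.k × Fin D.m => D.locIdx v.1 v.2) y 0
  have hz : ∀ v : Fin D.k × Fin D.m, z (D.locIdx v.1 v.2) = y v :=
    fun v => (locIdx_injective D).extend_apply y 0 v
  have key : ((eval z).comp (dehom D p : Coord F D.k D.m →+* Loc F)) = eval u' := by
    refine MvPolynomial.ringHom_ext (fun c => by simp) ?_
    rintro ⟨i, j⟩
    rcases eq_or_ne j (pivot (p i)) with rfl | hj
    · simp [dehom_X_pivot, u', h3]
    · obtain ⟨a, rfl⟩ := Fin.exists_succAbove_eq hj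
      have := hz (i, a)
      simp [dehom_X_succAbove, this, y]
  intro hc
  apply h4
  have := RingHom.congr_fun key h
  rw [← this]
  simp [hc]

lemma exists_local_coordinate (p : Pt F D.k D.m) (z : Fin 2) :
    ∃ (i : Fin D.k) (l : Coord F D.k D.m), l ∈ forms F D.k D.m (Pi.single i 1) ∧
      dehom D p l = X z := by
  obtain ⟨i, a, rfl⟩ := exists_locIdx D z
  refine ⟨i, X (i, (pivot (p i)).succAbove a)
    - ((p i).rep ((pivot (p i)).succAbove a) / (p i).rep (pivot (p i))) • X (i, pivot (p i)),
    Submodule.sub_mem _ (X_mem_forms _) (Submodule.smul_mem _ _ (X_mem_forms _)), ?_⟩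
  rw [map_sub, map_smul, dehom_X_pivot, dehom_X_succAbove, smul_eq_C_mul]
  ring

/-! ### Jets of forms at several points -/

lemma exists_form_monomial (p : Pt F D.k D.m) (E : Fin D.k → ℕ) (x : Fin 2 →₀ ℕ)
    (hx : ∀ i, x.degree ≤ E i) (c : F) :
    ∃ v ∈ forms F D.k D.m (fun i => (E i : ℤ)), dehom D p v = monomial x c := by
  obtain ⟨i0, l0, hl0, e0⟩ := exists_local_coordinate p 0
  obtain ⟨i1, l1, hl1, e1⟩ := exists_local_coordinate p 1
  let r : Fin D.k → ℕ := fun i => E i - ((if i = i0 then x 0 else 0) + if i = i1 then x 1 else 0)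
  refine ⟨c • (l0 ^ x 0 * l1 ^ x 1 * ∏ i, X (i, pivot (p i)) ^ r i),
    Submodule.smul_mem _ _ ?_, ?_⟩
  · have h := mul_mem_forms (mul_mem_forms (pow_mem_forms hl0 (x 0)) (pow_mem_forms hl1 (x 1)))
      (prod_mem_forms Finset.univ fun i _ =>
        pow_mem_forms (X_mem_forms (F := F) (i, pivot (p i))) (r i))
    convert h using 2
    funext i
    have hr : (r i : ℤ) = E i - ((if i = i0 then (x 0 : ℤ) else 0) + if i = i1 then (x 1 : ℤ) else 0) := by
      have := hx i
      rw [degree_fin2] at this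
      simp only [r]
      split_ifs <;> omega
    simp only [Pi.add_apply, Pi.smul_apply, Finset.sum_apply, Pi.single_apply]
    simp only [nsmul_eq_mul, mul_ite, mul_one, mul_zero, Finset.sum_ite_eq, Finset.mem_univ,
      if_true, hr]
    ring
  · rw [map_smul, map_mul, map_mul, map_pow, map_pow, e0, e1, map_prod]
    simp only [map_pow, dehom_X_pivot, one_pow, Finset.prod_const_one, mul_one]
    rw [monomial_eq, Finsupp.prod_fintype _ _ (by simp), Fin.prod_univ_two, smul_eq_C_mul]

/-- Forms of high degree have arbitrary jets at finitely many points. -/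
lemma exists_form_jets (Ps : Finset (Pt F D.k D.m)) (K : ℕ) {E : ℕ} (hE : K * Ps.card + K ≤ E)
    (g : Pt F D.k D.m → Loc F) :
    ∃ v ∈ forms F D.k D.m (fun _ => (E : ℤ)), ∀ p ∈ Ps, dehom D p v - g p ∈ origin F ^ K := by
  classical
  have one : ∀ p ∈ Ps, ∃ v ∈ forms F D.k D.m (fun _ => (E : ℤ)),
      dehom D p v - g p ∈ origin F ^ K ∧ ∀ q ∈ Ps, q ≠ p → dehom D q v ∈ origin F ^ K := by
    intro p hp
    have sep : ∀ q, ∃ (e : Fin D.k → ℕ) (l : Coord F D.k D.m), (∀ j, e j ≤ 1) ∧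
        l ∈ forms F D.k D.m (fun j => (e j : ℤ)) ∧ (q ≠ p → val q l = 0 ∧ val p l ≠ 0) := by
      intro q
      by_cases hqp : q = p
      · exact ⟨0, 0, by simp, Submodule.zero_mem _, fun h => absurd hqp h⟩
      · obtain ⟨i, l, hl, h⟩ := exists_separating_form (Ne.symm hqp)
        refine ⟨fun j => if j = i then 1 else 0, l, fun j => by dsimp only; split_ifs <;> simp, ?_,
          fun _ => h⟩
        convert hl using 2
        funext j
        simp [Pi.single_apply]
    choose e l he hl hq using sep
    -- `Q` takes care of the other points, and is invertible at `p` modulo `origin F ^ K`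
    let Q := ∏ q ∈ Ps.erase p, l q ^ K
    let δ : Fin D.k → ℕ := fun j => ∑ q ∈ Ps.erase p, K * e q j
    have hδ : ∀ j, δ j + K ≤ E := by
      intro j
      have h1 : δ j ≤ ∑ q ∈ Ps.erase p, K :=
        Finset.sum_le_sum fun q _ => by simpa using Nat.mul_le_mul_left K (he q j)
      rw [Finset.sum_const, smul_eq_mul, mul_comm] at h1
      have h2 : (Ps.erase p).card ≤ Ps.card := Finset.card_le_card (Finset.erase_subset _ _)
      have := Nat.mul_le_mul_left K h2
      omega
    have hQ : Q ∈ forms F D.k D.m (fun j => (δ j : ℤ)) := by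
      have h := prod_mem_forms (Ps.erase p) fun q _ => pow_mem_forms (hl q) K
      convert h using 2
      funext j
      simp [δ]
    have hQp : dehom D p Q ∉ origin F := by
      rw [dehom_mem_origin_iff p hQ, val_prod, Finset.prod_eq_zero_iff]
      rintro ⟨q, hq', h⟩
      refine (hq q (Finset.ne_of_mem_erase hq')).2 ?_
      simp only [val, map_pow] at h ⊢
      exact eq_zero_of_pow_eq_zero h
    obtain ⟨R, hR⟩ := exists_inverse_mod_origin_pow hQp K
    obtain ⟨v, hv, hv'⟩ := exists_sub_mem_of_monomials
      (forms F D.k D.m fun j => ((E - δ j : ℕ) : ℤ)) (dehom D p).toLinearMap K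
      (fun x c hx => exists_form_monomial p _ x (fun j => by have := hδ j; omega) c) (R * g p)
    have hQv := mul_mem_forms hQ hv
    refine ⟨Q * v, ?_, ?_, ?_⟩
    · convert hQv using 2
      funext j
      have := hδ j
      simp only [Pi.add_apply]
      omega
    · rw [map_mul]
      have : dehom D p Q * dehom D p v - g p
        = dehom D p Q * ((dehom D p).toLinearMap v - R * g p) + g p * (dehom D p Q * R - 1) := by
        simp only [AlgHom.toLinearMap_apply]; ring
      rw [this]
      exact Ideal.add_mem _ (Ideal.mul_mem_left _ _ hv') (Ideal.mul_mem_left _ _ hR)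
    · intro q hqPs hqp
      have hq' : q ∈ Ps.erase p := Finset.mem_erase.mpr ⟨hqp, hqPs⟩
      rw [map_mul, map_prod, ← Finset.mul_prod_erase _ _ hq', map_pow]
      refine Ideal.mul_mem_right _ _ (Ideal.mul_mem_right _ _ (Ideal.pow_mem_pow ?_ K))
      exact (dehom_mem_origin_iff q (hl q)).mpr (hq q hqp).1
  choose! w hw h1 h2 using one
  refine ⟨∑ p ∈ Ps, w p, Submodule.sum_mem _ hw, fun p hp => ?_⟩
  rw [map_sum, ← Finset.add_sum_erase _ _ hp, add_sub_right_comm]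
  refine Ideal.add_mem _ (h1 p hp) (Ideal.sum_mem _ fun q hq => ?_)
  exact h2 q (Finset.mem_of_mem_erase hq) p hp (Finset.ne_of_mem_erase hq).symm

/-! ### Bézout's inequality -/

/-- Coprime forms have at most as many intersections as their intersection product says. -/
lemma bezout {a b : Fin D.k → ℤ} {A B : Coord F D.k D.m} (hA : A ∈ forms F D.k D.m a)
    (hB : B ∈ forms F D.k D.m b) (hA0 : A ≠ 0) (hB0 : B ≠ 0) (hAB : IsRelPrime A B)
    (Ps : Finset (Pt F D.k D.m)) (K : Pt F D.k D.m → ℕ) :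
    (∑ p ∈ Ps, (interNum (dehom D p A) (dehom D p B) (K p) : ℤ)) ≤ D.pair a b := by
  classical
  set K' := Ps.sup K
  obtain ⟨M, hM⟩ : ∃ M : ℕ, ∀ i, a i + b i ≤ M := by
    refine ⟨∑ i, (a i + b i).toNat, fun i => ?_⟩
    have : (a i + b i).toNat ≤ ∑ i, (a i + b i).toNat :=
      Finset.single_le_sum (f := fun i => (a i + b i).toNat) (fun _ _ => Nat.zero_le _)
        (Finset.mem_univ i)
    omega
  set E := K' * Ps.card + K' + M
  let e : Fin D.k → ℤ := fun _ => (E : ℤ)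
  have hfin := finiteDimensional_forms (F := F) D
  let J : Ps → Submodule F (Loc F) := fun p => interSpace (dehom D p.1 A) (dehom D p.1 B) K'
  let S := forms F D.k D.m e
  let Λ : S →ₗ[F] ((p : Ps) → Loc F ⧸ J p) :=
    LinearMap.pi fun p => (J p).mkQ ∘ₗ (dehom D p.1).toLinearMap ∘ₗ S.subtype
  have hΛ : Function.Surjective Λ := by
    intro y
    choose g hg using fun p => Submodule.mkQ_surjective (J p) (y p)
    obtain ⟨v, hv, hv'⟩ := exists_form_jets Ps K' (E := E) (by omega)
      (fun p => if h : p ∈ Ps then g ⟨p, h⟩ else 0)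
    refine ⟨⟨v, hv⟩, funext fun p => ?_⟩
    rw [← hg]
    have h := hv' p.1 p.2
    rw [dif_pos p.2] at h
    exact (Submodule.Quotient.eq _).mpr (originPow_le_interSpace _ _ K' h)
  have hmul : ∀ {c : Fin D.k → ℤ} {Z : Coord F D.k D.m}, Z ∈ forms F D.k D.m c →
      ∀ z ∈ forms F D.k D.m (e - c), Z * z ∈ S := by
    intro c Z hZ z hz
    have := mul_mem_forms hZ hz
    rwa [add_sub_cancel] at this
  let mA : forms F D.k D.m (e - a) →ₗ[F] S :=
    (LinearMap.mulLeft F A).restrict (fun z hz => hmul hA z hz)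
  let mB : forms F D.k D.m (e - b) →ₗ[F] S :=
    (LinearMap.mulLeft F B).restrict (fun z hz => hmul hB z hz)
  have injA : Function.Injective mA := fun x y h =>
    Subtype.ext (mul_left_cancel₀ hA0 (congrArg Subtype.val h))
  have injB : Function.Injective mB := fun x y h =>
    Subtype.ext (mul_left_cancel₀ hB0 (congrArg Subtype.val h))
  have hkA : LinearMap.range mA ≤ LinearMap.ker Λ := by
    rintro _ ⟨z, rfl⟩
    rw [LinearMap.mem_ker]
    funext p
    refine (Submodule.Quotient.mk_eq_zero _).mpr ?_
    change dehom D p.1 (A * z.1) ∈ J p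
    rw [map_mul, mul_comm]
    exact left_mem_interSpace _ _ _ _
  have hkB : LinearMap.range mB ≤ LinearMap.ker Λ := by
    rintro _ ⟨z, rfl⟩
    rw [LinearMap.mem_ker]
    funext p
    refine (Submodule.Quotient.mk_eq_zero _).mpr ?_
    change dehom D p.1 (B * z.1) ∈ J p
    rw [map_mul, mul_comm]
    exact right_mem_interSpace _ _ _ _
  -- a common multiple of the two coprime forms is a multiple of their product
  have hcap : Module.finrank F ↥(LinearMap.range mA ⊓ LinearMap.range mB)
      ≤ Module.finrank F (forms F D.k D.m (e - a - b)) := by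
    have hAB' : A * B ∈ forms F D.k D.m (a + b) := mul_mem_forms hA hB
    have hm : ∀ z ∈ forms F D.k D.m (e - a - b), A * B * z ∈ S := by
      intro z hz
      have := mul_mem_forms hAB' hz
      have e1 : a + b + (e - a - b) = e := by abel
      rwa [e1] at this
    let mAB : forms F D.k D.m (e - a - b) →ₗ[F] S :=
      (LinearMap.mulLeft F (A * B)).restrict hm
    have hle : LinearMap.range mA ⊓ LinearMap.range mB ≤ LinearMap.range mAB := by
      rintro _ ⟨⟨u, rfl⟩, ⟨w, hw⟩⟩
      have hw' : B * w.1 = A * u.1 := congrArg Subtype.val hw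
      have hdvd : B ∣ u.1 := (hAB.symm).dvd_of_dvd_mul_left ⟨w.1, hw'.symm⟩
      obtain ⟨z, hz⟩ := hdvd
      have hzf : z ∈ forms F D.k D.m (e - a - b) :=
        mem_forms_of_mul_mem hB hB0 (hz ▸ u.2)
      refine ⟨⟨z, hzf⟩, Subtype.ext ?_⟩
      change A * B * z = A * u.1
      rw [hz]; ring
    exact (Submodule.finrank_mono hle).trans (LinearMap.finrank_range_le mAB)
  have h1 := Submodule.finrank_sup_add_finrank_inf_eq (LinearMap.range mA) (LinearMap.range mB)
  rw [LinearMap.finrank_range_of_inj injA, LinearMap.finrank_range_of_inj injB] at h1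
  have h2 := Submodule.finrank_mono (sup_le hkA hkB)
  have h3 := Λ.finrank_range_add_finrank_ker
  rw [LinearMap.range_eq_top.mpr hΛ, finrank_top, Module.finrank_pi_fintype] at h3
  have h4 := finrank_forms_second_difference (F := F) D (a := a) (b := b) (E := e)
    (deg_nonneg hA hA0) (deg_nonneg hB hB0) (fun i => by
      have := hM i
      simp only [Pi.sub_apply, e, E]
      push_cast
      have : (0 : ℤ) ≤ (K' : ℤ) * Ps.card := by positivity
      omega)
  have h5 : ∑ p ∈ Ps, interNum (dehom D p A) (dehom D p B) (K p)
      ≤ ∑ p : Ps, Module.finrank F (Loc F ⧸ J p) := by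
    rw [← Finset.sum_coe_sort Ps]
    exact Finset.sum_le_sum fun p _ => interNum_mono _ _ (Finset.le_sup p.2)
  have h6 : (∑ p ∈ Ps, (interNum (dehom D p A) (dehom D p B) (K p) : ℤ))
      = ((∑ p ∈ Ps, interNum (dehom D p A) (dehom D p B) (K p) : ℕ) : ℤ) := by push_cast; rfl
  rw [h6, ← h4]
  have h7 : Module.finrank F S = Module.finrank F (forms F D.k D.m e) := rfl
  omega

end Dehom


/-! ### Multiplicities of linear systems -/

lemma mem_origin_pow_locMult {V : Submodule F (Loc F)} {v : Loc F} (hv : v ∈ V) :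
    v ∈ origin F ^ locMult V := by
  by_cases hb : BddAbove {e : ℕ | ∀ v ∈ V, v ∈ origin F ^ e}
  · have : locMult V ∈ {e : ℕ | ∀ v ∈ V, v ∈ origin F ^ e} :=
      Nat.sSup_mem ⟨0, fun v _ => by simp⟩ hb
    exact this v hv
  -- the supremum of an unbounded set of natural numbers is zero
  · have : locMult V = 0 := Nat.sSup_of_not_bddAbove hb
    simp [this]

lemma locMult_bot : locMult (⊥ : Submodule F (Loc F)) = 0 := by
  refine Nat.sSup_of_not_bddAbove fun ⟨b, hb⟩ => ?_
  have := hb (a := b + 1) (fun v hv => by rw [(Submodule.mem_bot F).mp hv]; exact Ideal.zero_mem _)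
  omega

lemma exists_exact {V : Submodule F (Loc F)} (hV : V ≠ ⊥) :
    ∃ v ∈ V, v ∉ origin F ^ (locMult V + 1) := by
  by_contra! hc
  obtain ⟨v, hv, hv0⟩ := Submodule.exists_mem_ne_zero_of_ne_bot hV
  obtain ⟨n, hn⟩ := exists_notMem_origin_pow hv0
  have hb : BddAbove {e : ℕ | ∀ v ∈ V, v ∈ origin F ^ e} := by
    refine ⟨n, fun e he => ?_⟩
    by_contra hne
    exact hn (Ideal.pow_le_pow_right (by omega) (he v hv))
  have : locMult V + 1 ≤ locMult V := le_csSup hb hc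
  omega

lemma transform_eq (V : Submodule F (Loc F)) (t : Option F) :
    transform V t = V.map (virt t (locMult V)) := by
  ext w
  simp only [transform, Submodule.mem_comap, Submodule.mem_map, LinearMap.mulLeft_apply,
    AlgHom.toLinearMap_apply]
  constructor
  · rintro ⟨v, hv, e⟩
    exact ⟨v, hv, virt_eq e⟩
  · rintro ⟨v, hv, rfl⟩
    exact ⟨v, hv, (exc_pow_mul_virt t (mem_origin_pow_locMult hv)).symm⟩

/-- The map that takes the members of a linear system to their virtual transforms at an infinitely
near point. -/
def iterVirt : Submodule F (Loc F) → List (Option F) → (Loc F →ₗ[F] Loc F)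
  | _, [] => LinearMap.id
  | V, t :: l => iterVirt (transform V t) l ∘ₗ virt t (locMult V)

lemma foldl_transform_eq (l : List (Option F)) : ∀ V : Submodule F (Loc F),
    l.foldl transform V = V.map (iterVirt V l) := by
  induction l with
  | nil => intro V; simp [iterVirt]
  | cons t l ih =>
    intro V
    rw [List.foldl_cons, ih, iterVirt, Submodule.map_comp, ← transform_eq]

lemma iterVirt_append (l : List (Option F)) (t : Option F) : ∀ V : Submodule F (Loc F),
    iterVirt V (l ++ [t]) = virt t (locMult (l.foldl transform V)) ∘ₗ iterVirt V l := by
  induction l with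
  | nil => intro V; simp [iterVirt]
  | cons s l ih =>
    intro V
    rw [List.cons_append, iterVirt, ih, iterVirt, List.foldl_cons, LinearMap.comp_assoc]

lemma isVirtual_iterVirt {V : Submodule F (Loc F)} {v : Loc F} (hv : v ∈ V) :
    IsVirtual (fun l => locMult (l.foldl transform V)) (fun l => iterVirt V l v) := by
  intro l
  have h : iterVirt V l v ∈ origin F ^ locMult (l.foldl transform V) := by
    apply mem_origin_pow_locMult
    rw [foldl_transform_eq]
    exact ⟨v, hv, rfl⟩
  refine ⟨h, fun t => ?_⟩
  simp only [iterVirt_append, LinearMap.comp_apply]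
  exact (exc_pow_mul_virt t h).symm

lemma foldl_transform_bot (l : List (Option F)) :
    l.foldl transform (⊥ : Submodule F (Loc F)) = ⊥ := by
  rw [foldl_transform_eq, Submodule.map_bot]

section Global
variable {D : Dom}

/-- The virtual transform at `q` of a member of the linear system `V`. -/
def virtAt (V : Submodule F (Coord F D.k D.m)) (q : Bubble F D) : Coord F D.k D.m →ₗ[F] Loc F :=
  iterVirt (V.map (dehom D q.1).toLinearMap) q.2 ∘ₗ (dehom D q.1).toLinearMap

lemma virtAt_nil (V : Submodule F (Coord F D.k D.m)) (p : Pt F D.k D.m) (v : Coord F D.k D.m) :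
    virtAt V (p, []) v = dehom D p v := rfl

lemma isVirtual_virtAt {V : Submodule F (Coord F D.k D.m)} {v : Coord F D.k D.m} (hv : v ∈ V)
    (p : Pt F D.k D.m) :
    IsVirtual (fun l => mult V (p, l)) (fun l => virtAt V (p, l) v) :=
  isVirtual_iterVirt (V := V.map (dehom D p).toLinearMap) ⟨v, hv, rfl⟩

/-- The members of `V` that have higher multiplicity at `q` than the general member. -/
def special (V : Submodule F (Coord F D.k D.m)) (q : Bubble F D) :
    Submodule F (Coord F D.k D.m) :=
  (originPow F (mult V q + 1)).comap (virtAt V q)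

lemma not_le_special {V : Submodule F (Coord F D.k D.m)} {p : Pt F D.k D.m}
    {l l' : List (Option F)} (h : mult V (p, l ++ l') ≠ 0) : ¬ V ≤ special V (p, l) := by
  intro hle
  have hbot : l.foldl transform (V.map (dehom D p).toLinearMap) ≠ ⊥ := by
    intro hb
    apply h
    rw [mult, List.foldl_append]
    simp only [hb, foldl_transform_bot, locMult_bot]
  obtain ⟨w, hw, hw'⟩ := exists_exact hbot
  rw [foldl_transform_eq] at hw
  obtain ⟨_, ⟨v, hv, rfl⟩, rfl⟩ := hw
  exact hw' (hle hv)

/-- The forms `v` that have virtual multiplicities at least `c`. -/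
def HasVirtMult (c : Bubble F D → ℕ) (v : Coord F D.k D.m) : Prop :=
  ∀ p, ∃ w : List (Option F) → Loc F, w [] = dehom D p v ∧ IsVirtual (fun l => c (p, l)) w

lemma hasVirtMult_of_mem {V : Submodule F (Coord F D.k D.m)} {v : Coord F D.k D.m} (hv : v ∈ V) :
    HasVirtMult (mult V) v :=
  fun p => ⟨fun l => virtAt V (p, l) v, rfl, isVirtual_virtAt hv p⟩

lemma HasVirtMult.add {c : Bubble F D → ℕ} {v v' : Coord F D.k D.m} (h : HasVirtMult c v)
    (h' : HasVirtMult c v') : HasVirtMult c (v + v') := by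
  intro p
  obtain ⟨w, hw0, hw⟩ := h p
  obtain ⟨w', hw0', hw'⟩ := h' p
  refine ⟨fun l => w l + w' l, by simp [hw0, hw0'], fun l =>
    ⟨Ideal.add_mem _ (hw l).1 (hw' l).1, fun t => ?_⟩⟩
  rw [map_add, (hw l).2 t, (hw' l).2 t, mul_add]

lemma HasVirtMult.mul {c c' : Bubble F D → ℕ} {v v' : Coord F D.k D.m} (h : HasVirtMult c v)
    (h' : HasVirtMult c' v') : HasVirtMult (c + c') (v * v') := by
  intro p
  obtain ⟨w, hw0, hw⟩ := h p
  obtain ⟨w', hw0', hw'⟩ := h' p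
  refine ⟨fun l => w l * w' l, by simp [hw0, hw0'], fun l => ⟨?_, fun t => ?_⟩⟩
  · change _ ∈ origin F ^ (c (p, l) + c' (p, l))
    rw [pow_add]
    exact Ideal.mul_mem_mul (hw l).1 (hw' l).1
  · change _ = exc t ^ (c (p, l) + c' (p, l)) * _
    rw [map_mul, (hw l).2 t, (hw' l).2 t]
    ring

lemma hasVirtMult_zero (v : Coord F D.k D.m) : HasVirtMult (0 : Bubble F D → ℕ) v := by
  intro p
  refine ⟨fun l => l.foldl (fun u t => blow t u) (dehom D p v), rfl, fun l => ⟨by simp, fun t => ?_⟩⟩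
  simp [List.foldl_append]

lemma HasVirtMult.pow {c : Bubble F D → ℕ} {v : Coord F D.k D.m} (h : HasVirtMult c v) (n : ℕ) :
    HasVirtMult (n • c) (v ^ n) := by
  induction n with
  | zero => simpa using hasVirtMult_zero 1
  | succ n ih => rw [pow_succ, succ_nsmul]; exact ih.mul h

lemma HasVirtMult.prod {c : Bubble F D → ℕ} {ι : Type*} (s : Finset ι) (v : ι → Coord F D.k D.m)
    (n : ι → ℕ) (h : ∀ i ∈ s, HasVirtMult c (v i)) :
    HasVirtMult ((∑ i ∈ s, n i) • c) (∏ i ∈ s, v i ^ n i) := by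
  classical
  induction s using Finset.induction_on with
  | empty => simpa using hasVirtMult_zero 1
  | insert a s ha ih =>
    rw [Finset.sum_insert ha, Finset.prod_insert ha, add_smul]
    exact ((h a (Finset.mem_insert_self a s)).pow _).mul
      (ih fun i hi => h i (Finset.mem_insert_of_mem hi))

lemma hasVirtMult_zero_vec (c : Bubble F D → ℕ) : HasVirtMult c (0 : Coord F D.k D.m) :=
  fun p => ⟨fun _ => 0, by simp, fun l => ⟨Ideal.zero_mem _, fun t => by simp⟩⟩

lemma HasVirtMult.sum {c : Bubble F D → ℕ} {ι : Type*} (s : Finset ι) (v : ι → Coord F D.k D.m)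
    (h : ∀ i ∈ s, HasVirtMult c (v i)) : HasVirtMult c (∑ i ∈ s, v i) := by
  classical
  induction s using Finset.induction_on with
  | empty => simpa using hasVirtMult_zero_vec c
  | insert a s ha ih =>
    rw [Finset.sum_insert ha]
    exact (h a (Finset.mem_insert_self a s)).add
      (ih fun i hi => h i (Finset.mem_insert_of_mem hi))

/-- A form of degree `n` in members of a linear system has `n` times the multiplicities of the
system. -/
lemma hasVirtMult_aeval {c : Bubble F D → ℕ} {r : ℕ} {g : Fin (r + 1) → Coord F D.k D.m}
    (hg : ∀ a, HasVirtMult c (g a)) {n : ℕ} {P : Coord F 1 r} (hP : P ∈ forms F 1 r fun _ => (n : ℤ)) :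
    HasVirtMult (n • c) (aeval (fun v : Fin 1 × Fin (r + 1) => g v.2) P) := by
  rw [aeval_def, eval₂_eq']
  refine HasVirtMult.sum _ _ fun x hx => ?_
  have h1 : ∑ v : Fin 1 × Fin (r + 1), x v = n := by
    have := mem_forms_iff.mp hP x (mem_support_iff.mp hx) 0
    rw [← Nat.cast_sum, Nat.cast_inj] at this
    rw [Fintype.sum_prod_type, Fin.sum_univ_one, this]
  have h2 := (hasVirtMult_zero (C (coeff x P) : Coord F D.k D.m)).mul
    (HasVirtMult.prod Finset.univ (fun v : Fin 1 × Fin (r + 1) => g v.2) x fun v _ => hg v.2)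
  rw [h1, zero_add] at h2
  exact h2

/-- Noether's inequality: a general member `A` of a linear system `V` and a form `h` with given
virtual multiplicities, which in addition has multiplicity `s` at another point `x` of `A`. -/
lemma noether_inequality [Infinite F] {V : Submodule F (Coord F D.k D.m)} {a b : Fin D.k → ℤ}
    {A h : Coord F D.k D.m}
    (hAV : A ∈ V) (hA : A ∈ forms F D.k D.m a) (hh : h ∈ forms F D.k D.m b) (hA0 : A ≠ 0)
    (hh0 : h ≠ 0) (hAh : IsRelPrime A h) {c : Bubble F D → ℕ} (hc : HasVirtMult c h)
    (T : Finset (Bubble F D)) (hex : ∀ p l l', (p, l ++ l') ∈ T → A ∉ special V (p, l))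
    {x : Pt F D.k D.m} (hx : ∀ q ∈ T, q.1 ≠ x) (hxA : val x A = 0) {s : ℕ}
    (hs : dehom D x h ∈ origin F ^ s) :
    ((∑ q ∈ T, mult V q * c q + s : ℕ) : ℤ) ≤ D.pair a b := by
  classical
  let Tp : Pt F D.k D.m → Finset (List (Option F)) := fun p =>
    T.preimage (fun l => (p, l)) (fun _ _ _ _ h => (Prod.mk.inj h).2)
  have hTp : ∀ p l, l ∈ Tp p ↔ (p, l) ∈ T := fun p l => Finset.mem_preimage
  have hloc : ∀ p, ∃ K, ∑ l ∈ Tp p, mult V (p, l) * c (p, l)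
      ≤ interNum (dehom D p A) (dehom D p h) K := by
    intro p
    obtain ⟨w, hw0, hw⟩ := hc p
    have hex' : ∀ l l', l ++ l' ∈ Tp p →
        virtAt V (p, l) A ∉ origin F ^ (mult V (p, l) + 1) :=
      fun l l' hl => hex p l l' ((hTp _ _).mp hl)
    have hlen : ∀ l ∈ Tp p, l.length < (Tp p).sup List.length + 1 :=
      fun l hl => Nat.lt_succ_of_le (Finset.le_sup (f := List.length) hl)
    have := local_noether _ (Tp p) (fun l => mult V (p, l)) (fun l => c (p, l))
      (fun l => virtAt V (p, l) A) w hlen (isVirtual_virtAt hAV p) hw hex'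
    rwa [virtAt_nil, hw0] at this
  have hlocx : ∃ K, s ≤ interNum (dehom D x A) (dehom D x h) K := by
    obtain ⟨μ, hμ, hμ'⟩ := exists_order (dehom_ne_zero x hA hA0)
    have hμ1 : 1 ≤ μ := by
      by_contra hc
      obtain rfl : μ = 0 := by omega
      rw [zero_add, pow_one, dehom_mem_origin_iff x hA] at hμ'
      exact hμ' hxA
    obtain ⟨K, hK⟩ := local_noether_step hμ hμ' hs ∅ 0
    rw [Finset.sum_empty, add_zero] at hK
    exact ⟨K, (Nat.le_mul_of_pos_left s hμ1).trans hK⟩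
  choose K hK using hloc
  obtain ⟨Kx, hKx⟩ := hlocx
  have hxT : x ∉ T.image Prod.fst := by
    intro hc
    obtain ⟨q, hq, e⟩ := Finset.mem_image.mp hc
    exact hx q hq e
  have hB := bezout hA hh hA0 hh0 hAh (insert x (T.image Prod.fst))
    (fun p => if p = x then Kx else K p)
  refine le_trans ?_ hB
  rw [Finset.sum_insert hxT, if_pos rfl, add_comm (∑ q ∈ T, _) s]
  have h1 : ∑ q ∈ T, mult V q * c q
      ≤ ∑ p ∈ T.image Prod.fst, interNum (dehom D p A) (dehom D p h) (if p = x then Kx else K p) := by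
    rw [← Finset.sum_fiberwise_of_maps_to (g := Prod.fst) (t := T.image Prod.fst)
      (fun q hq => Finset.mem_image_of_mem _ hq)]
    refine Finset.sum_le_sum fun p hp => ?_
    rw [if_neg (by rintro rfl; exact hxT hp)]
    refine le_trans (le_of_eq ?_) (hK p)
    symm
    refine Finset.sum_bij (fun l _ => (p, l)) ?_ ?_ ?_ ?_
    · intro l hl
      exact Finset.mem_filter.mpr ⟨(hTp p l).mp hl, rfl⟩
    · intro l _ l' _ e
      exact (Prod.mk.inj e).2
    · rintro ⟨p', l⟩ hq
      obtain ⟨hq', rfl⟩ := Finset.mem_filter.mp hq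
      exact ⟨l, (hTp _ l).mpr hq', rfl⟩
    · intro l _
      rfl
  push_cast
  exact_mod_cast add_le_add hKx h1

end Global


/-! ### Dominant nets and contracted curves -/

/-- Substitution of the components of a map to `ℙ²` into the forms on `ℙ²`. -/
def pull {k m : ℕ} (f : Fin 3 → Coord F k m) : Coord F 1 2 →ₐ[F] Coord F k m :=
  aeval fun v => f v.2

/-- No nonzero form vanishes on the image of the map with the components `f`. -/
def Dominant {k m : ℕ} (f : Fin 3 → Coord F k m) : Prop :=
  ∀ (d : Fin 1 → ℤ) (h : Coord F 1 2), h ∈ forms F 1 2 d → pull f h = 0 → h = 0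

lemma pull_mem_forms {k m : ℕ} {f : Fin 3 → Coord F k m} {d : Fin k → ℤ}
    (hf : ∀ a, f a ∈ forms F k m d) {n : ℤ} {P : Coord F 1 2} (hP : P ∈ forms F 1 2 fun _ => n) :
    pull f P ∈ forms F k m (n • d) := by
  have := aeval_mem_forms hP (e := fun _ => d) (g := fun v => f v.2) (fun v => hf v.2)
  simpa using! this

lemma eval_pull {k m : ℕ} (f : Fin 3 → Coord F k m) (u : Fin k × Fin (m + 1) → F)
    (P : Coord F 1 2) :
    eval u (pull f P) = eval (fun v : Fin 1 × Fin 3 => eval u (f v.2)) P := by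
  have : (eval u).comp (pull f : Coord F 1 2 →+* Coord F k m)
      = eval (fun v : Fin 1 × Fin 3 => eval u (f v.2)) :=
    MvPolynomial.ringHom_ext (fun c => by simp [pull]) (fun v => by simp [pull])
  exact RingHom.congr_fun this P

section Contracted
variable {D : Dom} {f : Fin 3 → Coord F D.k D.m} {d : Fin D.k → ℤ}

lemma finrank_forms_le (D : Dom) (E : Fin D.k → ℤ) (hE : ∀ i, 0 ≤ E i) :
    (Module.finrank F (forms F D.k D.m E) : ℤ) ≤ (∑ i, E i + 1) ^ 2 := by
  cases D with
  | plane =>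
    have h := (finrank_forms_plane (F := F) E hE).2
    have h0 : 0 ≤ E (0 : Fin 1) := hE (0 : Fin 1)
    have hs : ∑ i, E i = E (0 : Fin 1) := Fin.sum_univ_one E
    rw [hs]
    have : (Module.finrank F (forms F 1 2 E) : ℤ) ≤ (E (0 : Fin 1) + 1) ^ 2 := by nlinarith
    exact this
  | quadric =>
    have h := (finrank_forms_quadric (F := F) E hE).2
    have h0 : 0 ≤ E (0 : Fin 2) := hE (0 : Fin 2)
    have h1 : 0 ≤ E (1 : Fin 2) := hE (1 : Fin 2)
    have hs : ∑ i, E i = E (0 : Fin 2) + E (1 : Fin 2) := Fin.sum_univ_two E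
    rw [hs]
    have : (Module.finrank F (forms F 2 1 E) : ℤ) ≤ (E (0 : Fin 2) + E (1 : Fin 2) + 1) ^ 2 := by
      rw [h]; nlinarith
    exact this

/-- The ratio of two coordinates of the domain is algebraic over the field generated by the
ratios of the components: there are more products of a monomial of degree `M` in the two
coordinates and a form of degree `M` in the components than forms of that degree. -/
lemma exists_relation (hf : ∀ a, f a ∈ forms F D.k D.m d) (hd : ∀ i, 0 ≤ d i) (i : Fin D.k)
    (a b : Fin (D.m + 1)) :
    ∃ (M : ℕ) (Φ : Fin (M + 1) → Coord F 1 2), (∀ j, Φ j ∈ forms F 1 2 fun _ => (M : ℤ)) ∧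
      Φ ≠ 0 ∧ ∑ j, X (i, a) ^ j.1 * X (i, b) ^ (M - j.1) * pull f (Φ j) = 0 := by
  obtain ⟨s, hs⟩ := Int.eq_ofNat_of_zero_le (Finset.sum_nonneg fun i (_ : i ∈ Finset.univ) => hd i)
  set M : ℕ := 2 * (s + 1) ^ 2 with hM
  let E : Fin D.k → ℤ := fun j => M * (if j = i then 1 else 0) + M * d j
  have hE : ∀ j, 0 ≤ E j := by
    intro j
    have := hd j
    dsimp only [E]
    split_ifs <;> positivity
  have hterm : ∀ (j : Fin (M + 1)) (P : forms F 1 2 fun _ => (M : ℤ)),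
      X (i, a) ^ j.1 * X (i, b) ^ (M - j.1) * pull f P.1 ∈ forms F D.k D.m E := by
    intro j P
    have h := mul_mem_forms (mul_mem_forms (pow_mem_forms (X_mem_forms (F := F) (i, a)) j.1)
      (pow_mem_forms (X_mem_forms (F := F) (i, b)) (M - j.1))) (pull_mem_forms hf P.2)
    convert h using 2
    funext l
    have hj : ((M - j.1 : ℕ) : ℤ) = M - j.1 := by omega
    simp only [Pi.add_apply, Pi.smul_apply, Pi.single_apply, E]
    simp only [nsmul_eq_mul, smul_eq_mul, hj]
    ring
  let Λ₁ : Fin (M + 1) → ((forms F 1 2 fun _ => (M : ℤ)) →ₗ[F] forms F D.k D.m E) := fun j =>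
    LinearMap.codRestrict _ (LinearMap.mulLeft F (X (i, a) ^ j.1 * X (i, b) ^ (M - j.1)) ∘ₗ
      (pull f).toLinearMap ∘ₗ Submodule.subtype _) (fun P => hterm j P)
  let Λ : (Fin (M + 1) → forms F 1 2 fun _ => (M : ℤ)) →ₗ[F] forms F D.k D.m E :=
    ∑ j, Λ₁ j ∘ₗ LinearMap.proj j
  have h1 := (finrank_forms_plane' (F := F) M).1
  have h2 := finiteDimensional_forms (F := F) D E
  have hlt : Module.finrank F (forms F D.k D.m E)
      < Module.finrank F (Fin (M + 1) → forms F 1 2 fun _ => (M : ℤ)) := by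
    rw [Module.finrank_pi_fintype, Finset.sum_const, Finset.card_univ, Fintype.card_fin,
      (finrank_forms_plane' (F := F) M).2, smul_eq_mul]
    have h3 := finrank_forms_le (F := F) D E hE
    have h4 : ∑ j, E j = M + M * s := by
      simp only [E, Finset.sum_add_distrib, ← Finset.mul_sum, hs, Finset.sum_ite_eq',
        Finset.mem_univ, if_true, mul_one]
    rw [h4] at h3
    have h5 := two_mul_tri (M + 1)
    have h6 : (M : ℤ) = 2 * (s + 1) ^ 2 := by rw [hM]; push_cast; ring
    zify at h5 ⊢
    refine lt_of_le_of_lt h3 ?_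
    have h7 : ((M : ℤ) + M * s + 1) ^ 2 ≤ ((M + 1) * (s + 1)) ^ 2 := by
      have h0 : (0 : ℤ) ≤ M + M * s + 1 := by positivity
      refine pow_le_pow_left₀ h0 ?_ 2
      nlinarith [Int.natCast_nonneg s]
    have h8 : 2 * (((M : ℤ) + 1) * tri (M + 1)) = (M + 1) ^ 2 * (M + 2) := by
      linear_combination (M + 1 : ℤ) * h5
    have h9 : (((M : ℤ) + 1) * (s + 1)) ^ 2 * 2 = (M + 1) ^ 2 * M := by
      rw [mul_pow, h6]; ring
    have h10 : (0 : ℤ) < (M + 1) ^ 2 := by positivity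
    nlinarith
  obtain ⟨P, hP, hP0⟩ := Submodule.exists_mem_ne_zero_of_ne_bot
    (LinearMap.ker_ne_bot_of_finrank_lt hlt (f := Λ))
  refine ⟨M, fun j => (P j).1, fun j => (P j).2, ?_, ?_⟩
  · intro h
    exact hP0 (funext fun j => Subtype.ext (congrFun h j))
  · have h := congrArg Subtype.val (LinearMap.mem_ker.mp hP)
    simpa [Λ, Λ₁, mul_assoc] using! h

/-- A binary form in two coordinates with the coefficients `c`. -/
def binary {σ : Type*} (v w : σ) {M : ℕ} (c : Fin (M + 1) → F) : MvPolynomial σ F :=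
  ∑ j, C (c j) * (X v ^ j.1 * X w ^ (M - j.1))

lemma binary_ne_zero {σ : Type*} {v w : σ} (hvw : v ≠ w) {M : ℕ} {c : Fin (M + 1) → F}
    (hc : c ≠ 0) : binary v w c ≠ 0 := by
  classical
  obtain ⟨j, hj⟩ := Function.ne_iff.mp hc
  refine ne_zero_iff.mpr ⟨Finsupp.single v j.1 + Finsupp.single w (M - j.1), ?_⟩
  have : coeff (Finsupp.single v j.1 + Finsupp.single w (M - j.1)) (binary v w c) = c j := by
    rw [binary, coeff_sum, Finset.sum_eq_single j]
    · rw [coeff_C_mul, X_pow_eq_monomial, X_pow_eq_monomial, monomial_mul, coeff_monomial]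
      simp
    · intro j' _ hj'
      rw [coeff_C_mul, X_pow_eq_monomial, X_pow_eq_monomial, monomial_mul, coeff_monomial, if_neg,
        mul_zero]
      intro h
      have := DFunLike.congr_fun h v
      simp [hvw.symm] at this
      exact hj' (Fin.ext this)
    · simp
  rwa [this]

lemma degreeOf_eq_zero_iff {σ : Type*} (z : σ) (p : MvPolynomial σ F) :
    degreeOf z p = 0 ↔ ∀ x ∈ p.support, x z = 0 := by
  rw [degreeOf_eq_sup, ← nonpos_iff_eq_zero, Finset.sup_le_iff]
  simp

lemma degreeOf_binary {σ : Type*} {v w z : σ} (hv : z ≠ v) (hw : z ≠ w) {M : ℕ}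
    (c : Fin (M + 1) → F) : degreeOf z (binary v w c) = 0 := by
  classical
  rw [degreeOf_eq_zero_iff]
  intro x hx
  rw [mem_support_iff, binary, coeff_sum] at hx
  obtain ⟨j, -, hj⟩ := Finset.exists_ne_zero_of_sum_ne_zero hx
  rw [coeff_C_mul, X_pow_eq_monomial, X_pow_eq_monomial, monomial_mul, coeff_monomial] at hj
  have : Finsupp.single v j.1 + Finsupp.single w (M - j.1) = x := by
    by_contra hne
    rw [if_neg hne] at hj
    simp at hj
  rw [← this]
  simp [hv, hw]

/-- On a curve that the map contracts to the point `y`, the relation between two coordinates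
of the domain becomes an equation with constant coefficients. -/
lemma dvd_binary_of_contracted {P : Coord F D.k D.m} (hP : Prime P) {y : Fin 3 → F} (hy : y ≠ 0)
    (hc : ∀ i j, P ∣ C (y i) * f j - C (y j) * f i) (hgcd : ∃ j, ¬ P ∣ f j)
    {i : Fin D.k} {a b : Fin (D.m + 1)} {M : ℕ} {Φ : Fin (M + 1) → Coord F 1 2}
    (hΦ : ∀ j, Φ j ∈ forms F 1 2 fun _ => (M : ℤ))
    (hrel : ∑ j, X (i, a) ^ j.1 * X (i, b) ^ (M - j.1) * pull f (Φ j) = 0) :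
    P ∣ binary (i, a) (i, b) (fun j => eval (fun v : Fin 1 × Fin 3 => y v.2) (Φ j)) := by
  have hprime : (Ideal.span {P}).IsPrime := (Ideal.span_singleton_prime hP.ne_zero).mpr hP
  let R := Coord F D.k D.m ⧸ Ideal.span {P}
  let φ : Coord F D.k D.m →ₐ[F] R := Ideal.Quotient.mkₐ F (Ideal.span {P})
  have hφ : ∀ z, φ z = 0 ↔ P ∣ z := fun z =>
    Ideal.Quotient.eq_zero_iff_mem.trans Ideal.mem_span_singleton
  obtain ⟨l, hl⟩ := Function.ne_iff.mp hy
  have hl : y l ≠ 0 := hl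
  set t : R := φ (C (y l)⁻¹ * f l)
  have hft : ∀ j, φ (f j) = t * algebraMap F R (y j) := by
    intro j
    have h1 : φ (C (y l) * f j - C (y j) * f l) = 0 := (hφ _).mpr (hc l j)
    have h2 : C (y l)⁻¹ * (C (y l) * f j - C (y j) * f l)
        = f j - C (y l)⁻¹ * f l * C (y j) := by
      have : (C (y l)⁻¹ * C (y l) : Coord F D.k D.m) = 1 := by
        rw [← C_mul, inv_mul_cancel₀ hl, C_1]
      linear_combination f j * this
    have h3 : φ (f j - C (y l)⁻¹ * f l * C (y j)) = 0 := by rw [← h2, map_mul, h1, mul_zero]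
    rw [map_sub, sub_eq_zero, map_mul] at h3
    rw [h3]
    congr 1
  have ht : t ≠ 0 := by
    intro ht
    obtain ⟨j, hj⟩ := hgcd
    exact hj ((hφ _).mp (by rw [hft, ht, zero_mul]))
  have hpull : ∀ j, φ (pull f (Φ j))
      = t ^ M * algebraMap F R (eval (fun v : Fin 1 × Fin 3 => y v.2) (Φ j)) := by
    intro j
    have h1 : φ (pull f (Φ j)) = aeval (fun v : Fin 1 × Fin 3 => t * algebraMap F R (y v.2)) (Φ j) := by
      rw [pull, comp_aeval_apply]
      simp only [hft]
    rw [h1, aeval_smul_form (hΦ j) (fun _ => t) (fun v => algebraMap F R (y v.2))]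
    congr 1
    · simp
    · exact aeval_algebraMap_apply R (fun v : Fin 1 × Fin 3 => y v.2) (Φ j)
  have h := congrArg φ hrel
  rw [map_sum, map_zero] at h
  have h2 : t ^ M * φ (binary (i, a) (i, b)
      (fun j => eval (fun v : Fin 1 × Fin 3 => y v.2) (Φ j))) = 0 := by
    rw [← h, binary, map_sum, Finset.mul_sum]
    refine Finset.sum_congr rfl fun j _ => ?_
    rw [map_mul, map_mul φ (_ * _), hpull]
    have : φ (C (eval (fun v : Fin 1 × Fin 3 => y v.2) (Φ j)))
      = algebraMap F R (eval (fun v : Fin 1 × Fin 3 => y v.2) (Φ j)) := rfl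
    rw [this]
    ring
  exact (hφ _).mp ((mul_eq_zero.mp h2).resolve_left (pow_ne_zero M ht))

lemma exists_pair_avoiding : ∀ (D : Dom) (w : Fin D.k × Fin (D.m + 1)),
    ∃ (i : Fin D.k) (a b : Fin (D.m + 1)), a ≠ b ∧ w ≠ (i, a) ∧ w ≠ (i, b)
  | .plane => (by decide : ∀ w : Fin 1 × Fin 3,
      ∃ (i : Fin 1) (a b : Fin 3), a ≠ b ∧ w ≠ (i, a) ∧ w ≠ (i, b))
  | .quadric => (by decide : ∀ w : Fin 2 × Fin 2,
      ∃ (i : Fin 2) (a b : Fin 2), a ≠ b ∧ w ≠ (i, a) ∧ w ≠ (i, b))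

/-- If a polynomial divides nonzero binary forms in any two coordinates of the same factor, then
it is constant. -/
lemma isUnit_of_dvd_binary {P : Coord F D.k D.m}
    (h : ∀ (i : Fin D.k) (a b : Fin (D.m + 1)), a ≠ b → ∃ (M : ℕ) (c : Fin (M + 1) → F), c ≠ 0 ∧
      P ∣ binary (i, a) (i, b) c) : IsUnit P := by
  have hP0 : P ≠ 0 := by
    rintro rfl
    obtain ⟨i, a, b, hab, -⟩ := exists_pair_avoiding D
      (match D with | .plane => ((0 : Fin 1), (0 : Fin 3)) | .quadric => ((0 : Fin 2), (0 : Fin 2)))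
    obtain ⟨M, c, hc, hd⟩ := h i a b hab
    exact binary_ne_zero (by simpa using hab) hc (zero_dvd_iff.mp hd)
  have hdeg : ∀ w, degreeOf w P = 0 := by
    intro w
    obtain ⟨i, a, b, hab, hwa, hwb⟩ := exists_pair_avoiding D w
    obtain ⟨M, c, hc, z, hz⟩ := h i a b hab
    have hne := binary_ne_zero (v := (i, a)) (w := (i, b)) (by simpa using hab) hc
    have h1 := degreeOf_binary hwa hwb c
    rw [hz] at hne
    rw [hz, degreeOf_mul_eq (left_ne_zero_of_mul hne) (right_ne_zero_of_mul hne)] at h1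
    omega
  have hC : P = C (coeff 0 P) := by
    ext x
    rw [coeff_C]
    split_ifs with hx
    · rw [hx]
    · by_contra hc
      apply hx
      ext w
      exact ((degreeOf_eq_zero_iff _ _).mp (hdeg w) x (mem_support_iff.mpr hc)).symm
  rw [hC]
  refine IsUnit.map C (isUnit_iff_ne_zero.mpr fun h0 => hP0 ?_)
  rw [hC, h0, C_0]

end Contracted


/-! ### The coordinates of the domain as functions of the components -/

section Generic
variable {k m : ℕ} {P Q : Pt F k m → Prop}

lemma Generic.mono (hP : Generic P) (h : ∀ x, P x → Q x) : Generic Q := by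
  obtain ⟨d, g, hg, hg0, H⟩ := hP
  exact ⟨d, g, hg, hg0, fun x hx => h x (H x hx)⟩

lemma Generic.and (hP : Generic P) (hQ : Generic Q) : Generic fun x => P x ∧ Q x := by
  obtain ⟨d, g, hg, hg0, H⟩ := hP
  obtain ⟨d', g', hg', hg0', H'⟩ := hQ
  refine ⟨_, g * g', mul_mem_forms hg hg', mul_ne_zero hg0 hg0', fun x hx => ?_⟩
  rw [val_mul] at hx
  exact ⟨H x (left_ne_zero_of_mul hx), H' x (right_ne_zero_of_mul hx)⟩

lemma generic_of_forall (h : ∀ x, P x) : Generic P :=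
  ⟨0, 1, by simpa using C_mem_forms (1 : F), one_ne_zero, fun x _ => h x⟩

lemma generic_forall_mem {ι : Type*} (s : Finset ι) {P : ι → Pt F k m → Prop}
    (h : ∀ i ∈ s, Generic (P i)) : Generic fun x => ∀ i ∈ s, P i x := by
  classical
  induction s using Finset.induction_on with
  | empty => exact generic_of_forall (by simp)
  | insert a s ha ih =>
    refine ((h a (Finset.mem_insert_self a s)).and
      (ih fun i hi => h i (Finset.mem_insert_of_mem hi))).mono fun x hx => ?_
    intro i hi
    rcases Finset.mem_insert.mp hi with rfl | hi
    · exact hx.1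
    · exact hx.2 i hi

lemma generic_forall {ι : Type*} [Finite ι] {P : ι → Pt F k m → Prop}
    (h : ∀ i, Generic (P i)) : Generic fun x => ∀ i, P i x := by
  have := Fintype.ofFinite ι
  exact (generic_forall_mem Finset.univ fun i _ => h i).mono fun x hx i => hx i (Finset.mem_univ i)

lemma Generic.exists [Infinite F] (hP : Generic P) : ∃ x, P x := by
  obtain ⟨d, g, hg, hg0, H⟩ := hP
  obtain ⟨x, hx⟩ := exists_val_ne_zero hg hg0
  exact ⟨x, H x hx⟩

lemma generic_val_ne_zero {d : Fin k → ℤ} {h : Coord F k m} (hh : h ∈ forms F k m d)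
    (h0 : h ≠ 0) : Generic fun x : Pt F k m => val x h ≠ 0 :=
  ⟨d, h, hh, h0, fun _ hx => hx⟩

end Generic

/-- A subspace is not covered by finitely many subspaces that do not contain it. -/
lemma exists_mem_avoiding [Infinite F] {V ι : Type*} [AddCommGroup V] [Module F V]
    (W : Submodule F V) (I : Finset ι) (S : ι → Submodule F V) (h : ∀ i ∈ I, ¬ W ≤ S i) :
    ∃ w ∈ W, ∀ i ∈ I, w ∉ S i := by
  classical
  by_contra! hc
  refine Subspace.biUnion_ne_univ_of_top_notMem (k := F) (E := W)
    (s := I.image fun i => (S i).comap W.subtype) ?_ ?_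
  · intro ht
    obtain ⟨i, hi, e⟩ := Finset.mem_image.mp ht
    refine h i hi fun w hw => ?_
    have : (⟨w, hw⟩ : W) ∈ (S i).comap W.subtype := by rw [e]; trivial
    exact this
  · rw [Set.eq_univ_iff_forall]
    rintro ⟨w, hw⟩
    obtain ⟨i, hi, hwi⟩ := hc w hw
    simp only [Set.mem_iUnion]
    exact ⟨_, Finset.mem_image_of_mem _ hi, hwi⟩

section Main
variable {D : Dom}

lemma pair_smul_add (D : Dom) (d e : Fin D.k → ℤ) (n : ℤ) :
    D.pair d (e + n • d) = D.pair d e + n * D.pair d d := by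
  cases D with
  | plane =>
    change d (0 : Fin 1) * (e (0 : Fin 1) + n * d (0 : Fin 1))
      = d (0 : Fin 1) * e (0 : Fin 1) + n * (d (0 : Fin 1) * d (0 : Fin 1))
    ring
  | quadric =>
    change d (0 : Fin 2) * (e (1 : Fin 2) + n * d (1 : Fin 2))
        + d (1 : Fin 2) * (e (0 : Fin 2) + n * d (0 : Fin 2))
      = d (0 : Fin 2) * e (1 : Fin 2) + d (1 : Fin 2) * e (0 : Fin 2)
        + n * (d (0 : Fin 2) * d (1 : Fin 2) + d (1 : Fin 2) * d (0 : Fin 2))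
    ring

/-- The value of polynomials at a point, as a linear map. -/
def valMap (x : Pt F D.k D.m) : Coord F D.k D.m →ₗ[F] F :=
  (aeval fun v : Fin D.k × Fin (D.m + 1) => (x v.1).rep v.2 :
    Coord F D.k D.m →ₐ[F] F).toLinearMap

/-- The members of `V` that vanish at `x`. -/
def through (V : Submodule F (Coord F D.k D.m)) (x : Pt F D.k D.m) :
    Submodule F (Coord F D.k D.m) :=
  V ⊓ LinearMap.ker (valMap x)

lemma finrank_le_through (V : Submodule F (Coord F D.k D.m)) [FiniteDimensional F V]
    (x : Pt F D.k D.m) : Module.finrank F V ≤ Module.finrank F (through V x) + 1 := by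
  have h := (valMap x ∘ₗ V.subtype).finrank_range_add_finrank_ker
  have h1 : Module.finrank F (LinearMap.range (valMap x ∘ₗ V.subtype)) ≤ 1 :=
    (Submodule.finrank_le _).trans (by simp)
  have h2 : Module.finrank F (LinearMap.ker (valMap x ∘ₗ V.subtype))
      ≤ Module.finrank F (through V x) := by
    have : FiniteDimensional F (through V x) := Submodule.finiteDimensional_of_le inf_le_left
    rw [← Submodule.finrank_map_subtype_eq]
    refine Submodule.finrank_mono ?_
    rintro _ ⟨⟨v, hv⟩, h, rfl⟩
    exact ⟨hv, h⟩
  omega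

lemma generic_ne (p : Pt F D.k D.m) : Generic fun x => p ≠ x := by
  obtain ⟨i, l, hl, e⟩ := exists_local_coordinate p 0
  have h0 : l ≠ 0 := by rintro rfl; rw [map_zero] at e; exact X_ne_zero (R := F) _ e.symm
  refine (generic_val_ne_zero hl h0).mono ?_
  rintro x hx rfl
  exact hx ((dehom_mem_origin_iff p hl).mp (by rw [e]; exact X_mem_origin 0))

variable {f : Fin 3 → Coord F D.k D.m} {d : Fin D.k → ℤ}

lemma Dominant.linearIndependent {k m : ℕ} {f : Fin 3 → Coord F k m} (hdom : Dominant f) :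
    LinearIndependent F f := by
  rw [Fintype.linearIndependent_iff]
  intro u hu
  have hform : (∑ j, u j • X ((0 : Fin 1), j) : Coord F 1 2) ∈ forms F 1 2 (Pi.single 0 1) :=
    Submodule.sum_mem _ fun j _ => Submodule.smul_mem _ _ (X_mem_forms ((0 : Fin 1), j))
  have h0 := hdom _ _ hform (by
    rw [map_sum, ← hu]
    refine Finset.sum_congr rfl fun j _ => ?_
    rw [map_smul]
    simp [pull])
  intro j
  have := congrArg (coeff (Finsupp.single ((0 : Fin 1), j) 1)) h0
  simpa [coeff_sum, coeff_X, Finsupp.single_left_inj] using! this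

lemma finrank_span_net (hdom : Dominant f) :
    Module.finrank F (Submodule.span F (Set.range f)) = 3 := by
  rw [finrank_span_eq_card hdom.linearIndependent, Fintype.card_fin]

lemma span_le_forms (hf : ∀ a, f a ∈ forms F D.k D.m d) :
    Submodule.span F (Set.range f) ≤ forms F D.k D.m d := by
  rw [Submodule.span_le]
  rintro _ ⟨a, rfl⟩
  exact hf a

/-- Some members through a general point have the general multiplicity at `q`. -/
lemma generic_not_through_le_special (hf : ∀ a, f a ∈ forms F D.k D.m d) (hdom : Dominant f)
    {q : Bubble F D} (hq : ¬ Submodule.span F (Set.range f) ≤ special (Submodule.span F (Set.range f)) q) :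
    Generic fun x => ¬ through (Submodule.span F (Set.range f)) x
      ≤ special (Submodule.span F (Set.range f)) q := by
  set V := Submodule.span F (Set.range f) with hV
  have hfin : FiniteDimensional F V := FiniteDimensional.span_of_finite F (Set.finite_range f)
  have h3 : Module.finrank F V = 3 := finrank_span_net hdom
  have key : ∀ x, through V x ≤ special V q → V ⊓ special V q = through V x := by
    intro x hx
    have hle : through V x ≤ V ⊓ special V q := le_inf inf_le_left hx
    have : FiniteDimensional F ↥(V ⊓ special V q) := Submodule.finiteDimensional_of_le inf_le_left
    have hlt : V ⊓ special V q < V := lt_of_le_of_ne inf_le_left fun e => hq (inf_eq_left.mp e)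
    have h1 := Submodule.finrank_lt_finrank_of_lt hlt
    have h2 := finrank_le_through V x
    exact (Submodule.eq_of_le_of_finrank_le hle (by omega)).symm
  by_cases hC : ∃ C ∈ V ⊓ special V q, C ≠ 0
  · obtain ⟨C, hC, hC0⟩ := hC
    refine (generic_val_ne_zero (span_le_forms hf hC.1) hC0).mono fun x hx hle => ?_
    rw [key x hle] at hC
    exact hx hC.2
  · refine generic_of_forall fun x hle => ?_
    have h2 := finrank_le_through V x
    have : through V x = ⊥ := by
      rw [← key x hle, Submodule.eq_bot_iff]
      intro C hC'
      by_contra h0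
      exact hC ⟨C, hC', h0⟩
    rw [this, finrank_bot] at h2
    omega

/-- A dominant map contracts no curve to the image of a general point. -/
lemma generic_not_contracted (hf : ∀ a, f a ∈ forms F D.k D.m d) (hd : ∀ i, 0 ≤ d i)
    (hdom : Dominant f) (hgcd : ∀ q, (∀ a, q ∣ f a) → IsUnit q) :
    Generic fun x => ∀ P : Coord F D.k D.m, Prime P →
      ¬ through (Submodule.span F (Set.range f)) x ≤ (Ideal.span {P}).restrictScalars F := by
  choose M Φ hΦ hΦ0 hrel using fun v : Fin D.k × Fin (D.m + 1) × Fin (D.m + 1) =>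
    exists_relation hf hd v.1 v.2.1 v.2.2
  have hne := fun v => Function.ne_iff.mp (hΦ0 v)
  choose j hj using hne
  have hj' : ∀ v, pull f (Φ v (j v)) ≠ 0 := fun v h => hj v (hdom _ _ (hΦ v (j v)) h)
  have h0 : ∃ a, f a ≠ 0 := by
    by_contra! hc
    have := hgcd 0 (fun a => by rw [hc])
    exact not_isUnit_zero this
  obtain ⟨a0, ha0⟩ := h0
  refine ((generic_val_ne_zero (hf a0) ha0).and (generic_forall fun v =>
    generic_val_ne_zero (pull_mem_forms hf (hΦ v (j v))) (hj' v))).mono ?_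
  rintro x ⟨hx0, hx⟩ P hP hle
  set y : Fin 3 → F := fun a => val x (f a)
  have hy : y ≠ 0 := fun h => hx0 (congrFun h a0)
  have hc : ∀ i j, P ∣ C (y i) * f j - C (y j) * f i := by
    intro i j
    rw [← Ideal.mem_span_singleton]
    refine hle ⟨?_, ?_⟩
    · rw [← smul_eq_C_mul, ← smul_eq_C_mul]
      exact Submodule.sub_mem _ (Submodule.smul_mem _ _ (Submodule.subset_span ⟨j, rfl⟩))
        (Submodule.smul_mem _ _ (Submodule.subset_span ⟨i, rfl⟩))
    · change val x (C (y i) * f j - C (y j) * f i) = 0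
      simp only [val, map_sub, map_mul, eval_C, y]
      ring
  have hg : ∃ j, ¬ P ∣ f j := by
    by_contra! hc'
    exact hP.not_isUnit (hgcd P hc')
  -- `f` is constant along `P = 0`, so `P` divides binary forms in all pairs of coordinates
  refine hP.not_isUnit (isUnit_of_dvd_binary fun i a b _ => ?_)
  refine ⟨_, _, ?_, dvd_binary_of_contracted hP hy hc hg (hΦ (i, a, b)) (hrel (i, a, b))⟩
  intro h
  have h1 := congrFun h (j (i, a, b))
  have h2 := hx (i, a, b)
  rw [val, eval_pull] at h2
  exact h2 h1

/-- Finitely many points account for a self-intersection number one. -/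
lemma exists_finite_support {g : Bubble F D → ℕ} {c : ℤ} (hD : c - ∑ᶠ q, (g q : ℤ) * g q = 1) :
    ∃ T : Finset (Bubble F D), (∀ q ∈ T, g q ≠ 0) ∧ c = ((∑ q ∈ T, g q * g q : ℕ) : ℤ) + 1 := by
  by_cases hfin : (Function.support fun q => (g q : ℤ) * g q).Finite
  · refine ⟨hfin.toFinset, fun q hq h0 => ?_, ?_⟩
    · rw [Set.Finite.mem_toFinset, Function.mem_support] at hq
      exact hq (by simp [h0])
    · rw [finsum_eq_sum _ hfin] at hD
      push_cast
      linarith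
  -- an infinite sum has the value zero, and the empty set will do
  · refine ⟨∅, by simp, ?_⟩
    rw [finsum_of_infinite_support hfin] at hD
    simp
    linarith

/-- Over the function field of the target, two coordinates of the domain are linearly dependent.
Otherwise the forms `X_a P(f) + X_b Q(f)` with `P` and `Q` of a large degree `n` make up a space of
dimension `(n + 1)(n + 2)`, and there is one with multiplicity more than `n + c` at a general
point `x`. It would meet a general member of the net through `x` in too many points. -/
lemma exists_linear_relation [Infinite F] (hf : ∀ a, f a ∈ forms F D.k D.m d)
    (hdom : Dominant f) (hgcd : ∀ q, (∀ a, q ∣ f a) → IsUnit q)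
    (hself : D.pair d d - ∑ᶠ q, (mult (Submodule.span F (Set.range f)) q : ℤ)
      * mult (Submodule.span F (Set.range f)) q = 1) (i : Fin D.k) (a b : Fin (D.m + 1)) :
    ∃ (n : ℕ) (P Q : Coord F 1 2), P ∈ (forms F 1 2 fun _ => (n : ℤ)) ∧
      Q ∈ (forms F 1 2 fun _ => (n : ℤ)) ∧ (P ≠ 0 ∨ Q ≠ 0) ∧
      X (i, a) * pull f P + X (i, b) * pull f Q = 0 := by
  classical
  by_contra! hindep
  set V := Submodule.span F (Set.range f) with hV
  have hd : ∀ i, 0 ≤ d i := by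
    intro i
    by_contra hc
    have := hgcd 0 fun a => by
      by_contra h
      exact hc (deg_nonneg (hf a) (fun h0 => h (by rw [h0])) i)
    exact not_isUnit_zero this
  obtain ⟨T, hT, hself⟩ := exists_finite_support hself
  -- the base points of the net and the points that precede them
  let prefixes : Finset (Bubble F D) := T.biUnion fun q => q.2.inits.toFinset.image fun l => (q.1, l)
  have hpre : ∀ p l l', (p, l ++ l') ∈ T → (p, l) ∈ prefixes := by
    intro p l l' h
    refine Finset.mem_biUnion.mpr ⟨_, h, Finset.mem_image.mpr ⟨l, ?_, rfl⟩⟩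
    rw [List.mem_toFinset, List.mem_inits]
    exact List.prefix_append l l'
  have hpre' : ∀ q ∈ prefixes, ¬ V ≤ special V q := by
    intro q hq
    obtain ⟨q', hq', h⟩ := Finset.mem_biUnion.mp hq
    obtain ⟨l, hl, rfl⟩ := Finset.mem_image.mp h
    rw [List.mem_toFinset, List.mem_inits] at hl
    obtain ⟨l', hl'⟩ := hl
    refine not_le_special (l' := l') ?_
    rw [hl']
    exact hT q' hq'
  obtain ⟨x, hx1, hx2, hx3⟩ := ((generic_forall_mem T fun q _ => generic_ne q.1).and
    ((generic_forall_mem prefixes fun q hq => generic_not_through_le_special hf hdom (hpre' q hq)).and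
      (generic_not_contracted hf hd hdom hgcd))).exists
  -- a form with a point of large multiplicity
  set e : Fin D.k → ℤ := Pi.single i 1
  set c : ℕ := (D.pair d e).toNat
  -- chosen such that `s (s + 1) / 2 < (n + 1) (n + 2)`
  set n : ℕ := 4 * c + 4
  set s : ℕ := n + c + 1
  let N := forms F 1 2 fun _ => (n : ℤ)
  have : FiniteDimensional F N := (finrank_forms_plane' n).1
  let Λ₀ : N × N →ₗ[F] Coord F D.k D.m :=
    (LinearMap.mulLeft F (X (i, a)) ∘ₗ (pull f).toLinearMap ∘ₗ N.subtype).coprod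
      (LinearMap.mulLeft F (X (i, b)) ∘ₗ (pull f).toLinearMap ∘ₗ N.subtype)
  let Λ : N × N →ₗ[F] Loc F ⧸ originPow F s :=
    (originPow F s).mkQ ∘ₗ (dehom D x).toLinearMap ∘ₗ Λ₀
  have hlt : Module.finrank F (Loc F ⧸ originPow F s) < Module.finrank F (N × N) := by
    rw [finrank_jets, Module.finrank_prod, (finrank_forms_plane' n).2]
    have h1 := two_mul_tri s
    have h2 := two_mul_tri (n + 1)
    simp only [s, n] at h1 h2 ⊢
    nlinarith
  obtain ⟨⟨P, Q⟩, hPQ, hPQ0⟩ := Submodule.exists_mem_ne_zero_of_ne_bot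
    (LinearMap.ker_ne_bot_of_finrank_lt hlt (f := Λ))
  set h : Coord F D.k D.m := X (i, a) * pull f P.1 + X (i, b) * pull f Q.1
  have hPQ1 : P.1 ≠ 0 ∨ Q.1 ≠ 0 := by
    by_contra! hc
    exact hPQ0 (Prod.ext (Subtype.ext hc.1) (Subtype.ext hc.2))
  have hh0 : h ≠ 0 := hindep n P.1 Q.1 P.2 Q.2 hPQ1
  have hhs : dehom D x h ∈ origin F ^ s :=
    (Submodule.Quotient.mk_eq_zero _).mp (LinearMap.mem_ker.mp hPQ)
  have hhf : h ∈ forms F D.k D.m (e + (n : ℤ) • d) :=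
    Submodule.add_mem _ (mul_mem_forms (X_mem_forms _) (pull_mem_forms hf P.2))
      (mul_mem_forms (X_mem_forms _) (pull_mem_forms hf Q.2))
  have hfV : ∀ a, f a ∈ V := fun a => Submodule.subset_span ⟨a, rfl⟩
  have hhm : HasVirtMult (n • mult V) h := by
    have hterm : ∀ (v : Fin D.k × Fin (D.m + 1)) (P : N),
        HasVirtMult (n • mult V) (X v * pull f P.1) := by
      intro v P
      have := (hasVirtMult_zero (X v : Coord F D.k D.m)).mul
        (hasVirtMult_aeval (fun a => hasVirtMult_of_mem (hfV a)) P.2)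
      rwa [zero_add] at this
    exact (hterm _ P).add (hterm _ Q)
  -- a general member of the net through the point
  obtain ⟨A, hAx, hA⟩ := exists_mem_avoiding (through V x)
    ((prefixes.image (special V)) ∪
      ((UniqueFactorizationMonoid.factors h).toFinset.image fun P =>
        (Ideal.span {P}).restrictScalars F)) id (by
    intro S hS
    rcases Finset.mem_union.mp hS with hS | hS
    · obtain ⟨q, hq, rfl⟩ := Finset.mem_image.mp hS
      exact hx2 q hq
    · obtain ⟨P, hP, rfl⟩ := Finset.mem_image.mp hS
      exact hx3 P (UniqueFactorizationMonoid.prime_of_factor P (Multiset.mem_toFinset.mp hP)))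
  have hA1 : ∀ p l l', (p, l ++ l') ∈ T → A ∉ special V (p, l) := fun p l l' hl =>
    hA _ (Finset.mem_union_left _ (Finset.mem_image_of_mem _ (hpre p l l' hl)))
  have hcop : IsRelPrime A h := by
    intro z hzA hzh
    by_contra hz
    obtain ⟨P, hP, hPz⟩ := WfDvdMonoid.exists_irreducible_factor hz
      (fun h0 => hh0 (zero_dvd_iff.mp (h0 ▸ hzh)))
    obtain ⟨P', hP', hass⟩ := UniqueFactorizationMonoid.exists_mem_factors_of_dvd hh0 hP
      (hPz.trans hzh)
    refine hA ((Ideal.span {P'}).restrictScalars F) (Finset.mem_union_right _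
      (Finset.mem_image_of_mem _ (Multiset.mem_toFinset.mpr hP'))) ?_
    exact Ideal.mem_span_singleton.mpr (hass.symm.dvd.trans (hPz.trans hzA))
  have hA0 : A ≠ 0 := by
    rintro rfl
    -- a form without common factor with zero would be constant
    have hu : IsUnit h := hcop (dvd_zero h) dvd_rfl
    have : dehom D x h ∈ origin F := Ideal.pow_le_self (by omega) hhs
    exact (origin_isPrime (F := F)).ne_top (Ideal.eq_top_of_isUnit_mem _ this (hu.map (dehom D x)))
  have hN := noether_inequality hAx.1 (span_le_forms hf hAx.1) hhf hA0 hh0 hcop hhm T hA1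
    hx1 hAx.2 hhs
  rw [pair_smul_add, hself] at hN
  have hsum : ∑ q ∈ T, mult V q * (n • mult V) q = n * ∑ q ∈ T, mult V q * mult V q := by
    rw [Finset.mul_sum]
    refine Finset.sum_congr rfl fun q _ => ?_
    rw [Pi.smul_apply, smul_eq_mul]; ring
  rw [hsum] at hN
  have hc : D.pair d e ≤ c := Int.self_le_toNat _
  simp only [s] at hN
  push_cast at hN
  nlinarith

end Main


/-! ### The inverse of a birational map to the plane -/

lemma eq_mk_of_proportional {n : ℕ} (y : Projectivization F (Fin (n + 1) → F))
    {u : Fin (n + 1) → F} (hu : u ≠ 0) (h : ∀ a b, u a * y.rep b = u b * y.rep a) :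
    y = Projectivization.mk F u hu := by
  obtain ⟨b, hb⟩ := Function.ne_iff.mp hu
  have hb : u b ≠ 0 := hb
  conv_lhs => rw [← y.mk_rep]
  rw [Projectivization.mk_eq_mk_iff']
  refine ⟨y.rep b / u b, funext fun a => ?_⟩
  rw [Pi.smul_apply, smul_eq_mul]
  field_simp
  linear_combination h a b

lemma proportional_of_eq_mk {n : ℕ} {y : Projectivization F (Fin (n + 1) → F)}
    {u : Fin (n + 1) → F} {hu : u ≠ 0} (h : y = Projectivization.mk F u hu) (a b : Fin (n + 1)) :
    u a * y.rep b = u b * y.rep a := by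
  obtain ⟨c, hc⟩ := Projectivization.exists_smul_eq_mk_rep F u hu
  rw [h, ← hc]
  simp only [Units.smul_def, Pi.smul_apply, smul_eq_mul]
  ring

lemma eval_aeval {σ τ : Type*} (u : τ → F) (g : σ → MvPolynomial τ F) (P : MvPolynomial σ F) :
    eval u (aeval g P) = eval (fun v => eval u (g v)) P := by
  have : (eval u).comp (aeval g : MvPolynomial σ F →ₐ[F] _).toRingHom
      = eval (fun v => eval u (g v)) :=
    MvPolynomial.ringHom_ext (fun c => by simp) (fun v => by simp)
  exact RingHom.congr_fun this P

/-- If the coordinates `X (i, b)` of the domain are, up to common factors `W i`, forms in the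
components of a dominant map, then these forms define the inverse map. -/
lemma isInverse_of_relation [Infinite F] {k m : ℕ} (r : RatMap F k m 1 2) (s : RatMap F 1 2 k m)
    (hdom : Dominant (r.comp 0)) (W : Fin k → Coord F k m) {dW : Fin k → Fin k → ℤ}
    (hW : ∀ i, W i ∈ forms F k m (dW i)) (hW0 : ∀ i, W i ≠ 0)
    (hrel : ∀ i b, X (i, 0) * pull (r.comp 0) (s.comp i b) = W i * X (i, b)) :
    r.IsInverse s := by
  obtain ⟨a0, ha0⟩ := Function.ne_iff.mp (r.nonzero 0)
  have ha0 : r.comp 0 a0 ≠ 0 := ha0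
  set f := r.comp 0 with hf
  have hfd : ∀ a, f a ∈ forms F k m (r.deg 0) := r.homog 0
  have hpt : ∀ x : Pt F k m, val x (f a0) ≠ 0 → ∀ _ : Fin 1, (fun a => val x (f a)) ≠ 0 :=
    fun x hx _ h => hx (congrFun h a0)
  constructor
  · refine ((generic_val_ne_zero (hfd a0) ha0).and ((generic_forall fun i =>
      generic_val_ne_zero (hW i) (hW0 i)).and (generic_forall fun i : Fin k =>
        generic_val_ne_zero (X_mem_forms (F := F) (i, (0 : Fin (m + 1)))) (X_ne_zero _)))).mono ?_
    rintro x ⟨hx, hxW, hxX⟩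
    refine ⟨pt (fun _ a => val x (f a)) (hpt x hx), ?_, ?_⟩
    · intro j
      obtain rfl : j = 0 := Subsingleton.elim _ _
      exact ⟨hpt x hx 0, rfl⟩
    · intro i
      obtain ⟨c, hc, e⟩ := exists_val_pt (fun (_ : Fin 1) a => val x (f a)) (hpt x hx) (s.deg i)
      have hv : ∀ b, val x (X (i, 0)) * val (pt (fun _ a => val x (f a)) (hpt x hx)) (s.comp i b)
          = c * (val x (W i) * (x i).rep b) := by
        intro b
        rw [e _ (s.homog i b)]
        have h1 := congrArg (val x) (hrel i b)
        rw [val_mul, val_mul] at h1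
        have h2 : val x (pull f (s.comp i b))
            = eval (fun v : Fin 1 × Fin 3 => val x (f v.2)) (s.comp i b) := eval_pull _ _ _
        have h3 : val x (X (i, b)) = (x i).rep b := by simp [val]
        rw [h2, h3] at h1
        linear_combination c * h1
      have hne : (fun b => val (pt (fun _ a => val x (f a)) (hpt x hx)) (s.comp i b)) ≠ 0 := by
        intro h
        obtain ⟨b, hb⟩ := Function.ne_iff.mp (x i).rep_nonzero
        have h1 := hv b
        have h2 := congrFun h b
        simp only [Pi.zero_apply] at h2
        rw [h2, mul_zero] at h1
        exact mul_ne_zero hc (mul_ne_zero (hxW i) hb) h1.symm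
      refine ⟨hne, eq_mk_of_proportional _ hne fun a b => ?_⟩
      refine mul_left_cancel₀ (hxX i) ?_
      rw [← mul_assoc, ← mul_assoc, hv, hv]
      ring
  · let fs : Fin 3 → Coord F 1 2 := fun a => aeval (fun v : Fin k × Fin (m + 1) => s.comp v.1 v.2) (f a)
    have hfs : ∀ a, fs a ∈ forms F 1 2 (∑ i, r.deg 0 i • s.deg i) := fun a =>
      aeval_mem_forms (hfd a) (fun v => s.homog v.1 v.2)
    set Xd : Coord F k m := ∏ i, X (i, (0 : Fin (m + 1))) ^ (r.deg 0 i).toNat with hXd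
    set Wd : Coord F k m := ∏ i, W i ^ (r.deg 0 i).toNat with hWd
    have hXd0 : Xd ≠ 0 := Finset.prod_ne_zero_iff.mpr fun i _ => pow_ne_zero _ (X_ne_zero _)
    have hWd0 : Wd ≠ 0 := Finset.prod_ne_zero_iff.mpr fun i _ => pow_ne_zero _ (hW0 i)
    -- by homogeneity, `f (s (f X))` is proportional to `f X`
    have hpull : ∀ a, Xd * pull f (fs a) = Wd * f a := by
      intro a
      have h1 : pull f (fs a) = aeval (fun v : Fin k × Fin (m + 1) => pull f (s.comp v.1 v.2)) (f a) :=
        comp_aeval_apply _ _ _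
      have h2 := aeval_smul_form (hfd a) (fun i => X (i, (0 : Fin (m + 1))))
        (fun v : Fin k × Fin (m + 1) => pull f (s.comp v.1 v.2))
      have h3 := aeval_smul_form (hfd a) W (fun v : Fin k × Fin (m + 1) => (X v : Coord F k m))
      have h4 : ∀ v : Fin k × Fin (m + 1),
          X (v.1, (0 : Fin (m + 1))) * pull f (s.comp v.1 v.2) = W v.1 * X v := fun v => hrel v.1 v.2
      simp only [h4] at h2
      rw [h1, ← h2, h3, aeval_X_left_apply]
    have hprop : ∀ a b, fs a * X (0, b) = fs b * X (0, a) := by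
      intro a b
      rw [← sub_eq_zero]
      refine hdom _ _ (Submodule.sub_mem _ (mul_mem_forms (hfs a) (X_mem_forms (0, b)))
        (mul_mem_forms (hfs b) (X_mem_forms (0, a)))) ?_
      refine mul_left_cancel₀ hXd0 ?_
      have h1 : ∀ c, pull f (X ((0 : Fin 1), c)) = f c := fun c => by simp [pull]
      rw [map_sub, map_mul, map_mul, h1, h1, mul_zero, mul_sub, ← mul_assoc, ← mul_assoc, hpull,
        hpull]
      ring
    have hfs0 : fs a0 ≠ 0 := by
      intro h
      have := hpull a0
      rw [h, map_zero, mul_zero] at this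
      exact mul_ne_zero hWd0 ha0 this.symm
    have hs0 : ∀ i, s.comp i 0 ≠ 0 := by
      intro i h
      have := hrel i 0
      rw [h, map_zero, mul_zero] at this
      exact mul_ne_zero (hW0 i) (X_ne_zero _) this.symm
    refine ((generic_val_ne_zero (hfs a0) hfs0).and (generic_forall fun i =>
      generic_val_ne_zero (s.homog i 0) (hs0 i))).mono ?_
    rintro y ⟨hy, hys⟩
    have hne : ∀ i, (fun b => val y (s.comp i b)) ≠ 0 := fun i h => hys i (congrFun h 0)
    refine ⟨pt (fun i b => val y (s.comp i b)) hne, fun i => ⟨hne i, rfl⟩, fun j => ?_⟩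
    obtain rfl : j = 0 := Subsingleton.elim _ _
    obtain ⟨c, hc, e⟩ := exists_val_pt (fun i b => val y (s.comp i b)) hne (r.deg 0)
    have hv : ∀ a, val (pt (fun i b => val y (s.comp i b)) hne) (f a) = c * val y (fs a) := by
      intro a
      rw [e _ (hfd a)]
      congr 1
      exact (eval_aeval _ _ _).symm
    have hne' : (fun a => val (pt (fun i b => val y (s.comp i b)) hne) (f a)) ≠ 0 := by
      intro h
      have := congrFun h a0
      simp only [Pi.zero_apply] at this
      rw [hv] at this
      exact mul_ne_zero hc hy this
    refine ⟨hne', eq_mk_of_proportional _ hne' fun a b => ?_⟩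
    have h1 := congrArg (val y) (hprop a b)
    rw [val_mul, val_mul] at h1
    have h2 : ∀ b, val y (X ((0 : Fin 1), b)) = (y 0).rep b := fun b => by simp [val]
    rw [h2, h2] at h1
    rw [hv, hv]
    linear_combination c * h1

/-- A dominant net without fixed components and with self-intersection one defines a birational
map. -/
lemma exists_isInverse [Infinite F] {D : Dom} (r : RatMap F D.k D.m 1 2)
    (hdom : Dominant (r.comp 0)) (hgcd : ∀ q, (∀ a, q ∣ r.comp 0 a) → IsUnit q)
    (hself : D.pair (r.deg 0) (r.deg 0)
      - ∑ᶠ q, (mult (Submodule.span F (Set.range (r.comp 0))) q : ℤ)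
        * mult (Submodule.span F (Set.range (r.comp 0))) q = 1) :
    ∃ s, r.IsInverse s := by
  classical
  have hlin : ∀ (i : Fin D.k) (b : Fin (D.m + 1)), ∃ (n : ℕ) (den num : Coord F 1 2),
      den ∈ (forms F 1 2 fun _ => (n : ℤ)) ∧ num ∈ (forms F 1 2 fun _ => (n : ℤ)) ∧ den ≠ 0 ∧
      X (i, 0) * pull (r.comp 0) num = X (i, b) * pull (r.comp 0) den := by
    intro i b
    obtain ⟨n, P, Q, hP, hQ, hPQ, h⟩ := exists_linear_relation (r.homog 0) hdom hgcd hself i b 0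
    refine ⟨n, P, -Q, hP, Submodule.neg_mem _ hQ, ?_, ?_⟩
    · rintro rfl
      rw [map_zero, mul_zero, zero_add] at h
      have := hdom _ _ hQ ((mul_eq_zero.mp h).resolve_left (X_ne_zero _))
      simp [this] at hPQ
    · rw [map_neg]
      linear_combination -h
  choose n den num hden hnum hden0 hrel using hlin
  -- the quotients `num / den` written with a common denominator
  let s : RatMap F 1 2 D.k D.m :=
    { deg := fun i _ => ((∑ b, n i b : ℕ) : ℤ)
      comp := fun i b => num i b * ∏ b' ∈ Finset.univ.erase b, den i b'
      homog := by
        intro i b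
        have h := mul_mem_forms (hnum i b)
          (prod_mem_forms (Finset.univ.erase b) fun b' _ => hden i b')
        convert h using 2
        funext j
        rw [Pi.add_apply, Finset.sum_apply, Finset.add_sum_erase _ (fun b => (n i b : ℤ))
          (Finset.mem_univ b)]
        push_cast
        rfl
      nonzero := by
        intro i h
        have h0 := congrFun h 0
        have h1 := hrel i 0
        have h2 : num i 0 ≠ 0 := by
          intro h3
          rw [h3, map_zero, mul_zero] at h1
          exact hden0 i 0 (hdom _ _ (hden i 0)
            ((mul_eq_zero.mp h1.symm).resolve_left (X_ne_zero _)))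
        exact mul_ne_zero h2 (Finset.prod_ne_zero_iff.mpr fun b _ => hden0 i b) h0 }
  refine ⟨s, isInverse_of_relation r s hdom (fun i => pull (r.comp 0) (∏ b, den i b))
    (dW := fun i => (∑ b, n i b : ℤ) • r.deg 0) (fun i => ?_) (fun i h => ?_) fun i b => ?_⟩
  · refine pull_mem_forms (r.homog 0) ?_
    have h := prod_mem_forms Finset.univ fun b _ => hden i b
    convert h using 2
    funext j
    rw [Finset.sum_apply]
  · have h1 : (∏ b, den i b) ∈ forms F 1 2 (∑ b, fun _ => (n i b : ℤ)) :=
      prod_mem_forms Finset.univ fun b _ => hden i b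
    exact Finset.prod_ne_zero_iff.mpr (fun b _ => hden0 i b) (hdom _ _ h1 h)
  · change X (i, 0) * pull (r.comp 0) (num i b * ∏ b' ∈ Finset.univ.erase b, den i b')
      = pull (r.comp 0) (∏ b, den i b) * X (i, b)
    rw [← Finset.mul_prod_erase Finset.univ (den i) (Finset.mem_univ b), map_mul, map_mul,
      ← mul_assoc, hrel]
    ring


/-! ### The image is the plane -/

lemma val_of_sends {k m l n : ℕ} {r : RatMap F k m l n} {x : Pt F k m} {y : Pt F l n}
    (h : r.Sends x y) {d : Fin l → ℤ} {P : Coord F l n} (hP : P ∈ forms F l n d) :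
    ∃ c : F, c ≠ 0 ∧
      val y P = c * val x (aeval (fun v : Fin l × Fin (n + 1) => r.comp v.1 v.2) P) := by
  choose h0 e using h
  obtain rfl : y = pt (fun j a => val x (r.comp j a)) h0 := funext e
  obtain ⟨c, hc, H⟩ := exists_val_pt (fun j a => val x (r.comp j a)) h0 d
  refine ⟨c, hc, ?_⟩
  rw [H P hP]
  congr 1
  exact (eval_aeval _ _ _).symm

lemma val_img_eq_zero {k m n : ℕ} {r : RatMap F k m 1 n} {d : Fin 1 → ℤ} {P : Coord F 1 n}
    (hP : P ∈ forms F 1 n d) (h0 : aeval (fun v : Fin 1 × Fin (n + 1) => r.comp 0 v.2) P = 0)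
    {y : Pt F 1 n} (hy : y ∈ r.img) : val y P = 0 := by
  refine hy d P hP ?_
  rintro z ⟨x, hx⟩
  obtain ⟨c, -, e⟩ := val_of_sends hx hP
  have h1 : (fun v : Fin 1 × Fin (n + 1) => r.comp v.1 v.2) = fun v => r.comp 0 v.2 := by
    funext v
    rw [Subsingleton.elim v.1 0]
  rw [e, h1, h0]
  simp [val]

/-- A form is zero if it vanishes wherever a given nonzero form does not. -/
lemma eq_zero_of_val_of_ne [Infinite F] {k m : ℕ} {d e : Fin k → ℤ} {h g : Coord F k m}
    (hh : h ∈ forms F k m d) (hg : g ∈ forms F k m e) (hg0 : g ≠ 0)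
    (H : ∀ x : Pt F k m, val x g ≠ 0 → val x h = 0) : h = 0 := by
  have h1 : g * h = 0 := by
    refine eq_zero_of_val (mul_mem_forms hg hh) fun x => ?_
    rw [val_mul]
    by_cases hx : val x g = 0
    · rw [hx, zero_mul]
    · rw [H x hx, mul_zero]
  exact (mul_eq_zero.mp h1).resolve_left hg0

/-- If the coordinates of the plane are, up to a common factor, forms `H` in forms `G`, then no
form `Φ` vanishes on `G`: the forms in the `H` of degree `n` have independent classes modulo `Φ`, but
the dimension of the space of forms modulo `Φ` grows linearly. -/
lemma pull_ne_zero_of_left_inverse {G H : Fin 3 → Coord F 1 2} {d₂ : Fin 1 → ℤ}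
    (hH : ∀ a, H a ∈ forms F 1 2 d₂) (hG0 : ∃ a, G a ≠ 0)
    (hHG : ∃ a, pull G (H a) ≠ 0)
    (hprop : ∀ a b, X ((0 : Fin 1), a) * pull G (H b) = X ((0 : Fin 1), b) * pull G (H a))
    {e : Fin 1 → ℤ} {Φ : Coord F 1 2} (hΦ : Φ ∈ forms F 1 2 e) (hΦ0 : Φ ≠ 0) : pull G Φ ≠ 0 := by
  intro hvan
  obtain ⟨k, hk⟩ := hG0
  obtain ⟨l, hl⟩ := hHG
  have hHl : H l ≠ 0 := by rintro h; rw [h, map_zero] at hl; exact hl rfl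
  obtain ⟨m, hm⟩ := Int.eq_ofNat_of_zero_le (deg_nonneg hΦ hΦ0 0)
  obtain ⟨e₂, he₂⟩ := Int.eq_ofNat_of_zero_le (deg_nonneg (hH l) hHl 0)
  obtain rfl : e = fun _ => (m : ℤ) := by
    funext j; rw [Subsingleton.elim j 0]; exact hm
  obtain rfl : d₂ = fun _ => (e₂ : ℤ) := by
    funext j; rw [Subsingleton.elim j 0]; exact he₂
  -- chosen such that there are more forms of degree `n` than classes modulo `Φ` of degree `n e₂ + m`
  set n : ℕ := 2 * m * e₂ + m + 3
  set N : ℕ := n * e₂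
  let Sn := forms F 1 2 fun _ => (n : ℤ)
  let SN := forms F 1 2 fun _ => (N : ℤ)
  let SM := forms F 1 2 fun _ => ((N + m : ℕ) : ℤ)
  have : FiniteDimensional F Sn := (finrank_forms_plane' n).1
  have : FiniteDimensional F SN := (finrank_forms_plane' N).1
  have : FiniteDimensional F SM := (finrank_forms_plane' (N + m)).1
  have hmulΦ : ∀ R ∈ SN, Φ * R ∈ SM := by
    intro R hR
    have h := mul_mem_forms hΦ hR
    convert h using 2
    funext j
    simp only [Pi.add_apply]
    push_cast; ring
  let μ : SN →ₗ[F] SM := (LinearMap.mulLeft F Φ).restrict hmulΦ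
  have hμ : Function.Injective μ := fun x y h =>
    Subtype.ext (mul_left_cancel₀ hΦ0 (congrArg Subtype.val h))
  have hmap : ∀ Q : Sn, X ((0 : Fin 1), k) ^ m * pull H Q.1 ∈ SM := by
    intro Q
    have h := mul_mem_forms (pow_mem_forms (X_mem_forms (F := F) ((0 : Fin 1), k)) m)
      (pull_mem_forms hH Q.2)
    convert h using 2
    funext j
    obtain rfl : j = 0 := Subsingleton.elim _ _
    simp [N]
    ring
  -- the factor `X_k ^ m` ensures a degree that is at least the degree of `Φ`
  let ν₀ : Sn →ₗ[F] SM := LinearMap.codRestrict SM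
    (LinearMap.mulLeft F (X ((0 : Fin 1), k) ^ m) ∘ₗ (pull H).toLinearMap ∘ₗ Sn.subtype) hmap
  let ν : Sn →ₗ[F] SM ⧸ LinearMap.range μ := (LinearMap.range μ).mkQ ∘ₗ ν₀
  have hlt : Module.finrank F (SM ⧸ LinearMap.range μ) < Module.finrank F Sn := by
    have h1 := (LinearMap.range μ).finrank_quotient_add_finrank
    rw [LinearMap.finrank_range_of_inj hμ, (finrank_forms_plane' (N + m)).2,
      (finrank_forms_plane' N).2] at h1
    rw [(finrank_forms_plane' n).2]
    have t1 := two_mul_tri (N + m + 1)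
    have t2 := two_mul_tri (N + 1)
    have t3 := two_mul_tri (n + 1)
    have key : m * (2 * N + m + 3) < (n + 1) * (n + 1 + 1) := by
      have hn : n = 2 * m * e₂ + m + 3 := rfl
      have h2 : m * (2 * N) = n * (n - (m + 3)) := by
        have : n - (m + 3) = 2 * m * e₂ := by omega
        rw [this]; simp only [N]; ring
      have h3 : n * (n - (m + 3)) + n * (m + 3) = n * n := by
        rw [← mul_add]; congr 1; omega
      have h4 : m * (m + 3) ≤ n * (m + 3) := Nat.mul_le_mul_right _ (by omega)
      nlinarith
    nlinarith
  obtain ⟨Q, hQ, hQ0⟩ := Submodule.exists_mem_ne_zero_of_ne_bot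
    (LinearMap.ker_ne_bot_of_finrank_lt hlt (f := ν))
  obtain ⟨R, hR⟩ := (Submodule.Quotient.mk_eq_zero _).mp (LinearMap.mem_ker.mp hQ)
  have hR' : Φ * R.1 = X ((0 : Fin 1), k) ^ m * pull H Q.1 := congrArg Subtype.val hR
  -- `Q(H)` is a multiple of `Φ`, so it vanishes on `G`, but `Q(H(G))` is proportional to `Q`
  have h1 : pull G (pull H Q.1) = 0 := by
    have h2 := congrArg (pull G) hR'
    rw [map_mul, hvan, zero_mul, map_mul, map_pow] at h2
    have h3 : pull G (X ((0 : Fin 1), k)) = G k := by simp [pull]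
    rw [h3] at h2
    exact (mul_eq_zero.mp h2.symm).resolve_left (pow_ne_zero _ hk)
  have h2 : pull G (pull H Q.1) = aeval (fun v : Fin 1 × Fin 3 => pull G (H v.2)) Q.1 :=
    comp_aeval_apply _ _ _
  have h3 := aeval_smul_form Q.2 (fun _ => X ((0 : Fin 1), l))
    (fun v : Fin 1 × Fin 3 => pull G (H v.2))
  have h4 := aeval_smul_form Q.2 (fun _ => pull G (H l))
    (fun v : Fin 1 × Fin 3 => (X v : Coord F 1 2))
  have h5 : ∀ v : Fin 1 × Fin 3, X ((0 : Fin 1), l) * pull G (H v.2) = pull G (H l) * X v := by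
    rintro ⟨i, b⟩
    obtain rfl : i = 0 := Subsingleton.elim _ _
    rw [hprop l b, mul_comm]
  simp only [h5] at h3
  rw [h4, ← h2, h1, mul_zero, aeval_X_left_apply] at h3
  have h6 := (mul_eq_zero.mp h3).resolve_left
    (Finset.prod_ne_zero_iff.mpr fun _ _ => pow_ne_zero _ hl)
  exact hQ0 (Subtype.ext h6)

/-- A map to the plane whose image is isomorphic to the plane is dominant. -/
lemma dominant_of_varIso [Infinite F] {k m : ℕ} (r : RatMap F k m 1 2)
    (hiso : VarIso r.img (Set.univ : Set (Pt F 1 2))) : Dominant (r.comp 0) := by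
  intro e Φ hΦ hvan
  by_contra hΦ0
  obtain ⟨φ, ψ, -, hψ, hinv, hφr, hψr⟩ := hiso
  obtain ⟨x0⟩ : Nonempty (Pt F 1 2) := inferInstance
  obtain ⟨d₁, G, hG, hGx0, hGψ⟩ := hψr x0 trivial 0
  obtain ⟨d₂, H, hH, hHy0, hHφ⟩ := hφr (ψ x0) (hψ trivial) 0
  have hψpt : ∀ x (h : (fun a => val x (G a)) ≠ 0),
      ψ x = pt (fun _ a => val x (G a)) (fun _ => h) := by
    intro x h
    funext j
    obtain rfl : j = 0 := Subsingleton.elim _ _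
    exact hGψ x trivial h
  have hval : ∀ x (_ : (fun a => val x (G a)) ≠ 0) (d : Fin 1 → ℤ), ∃ c : F, c ≠ 0 ∧
      ∀ P ∈ forms F 1 2 d, val (ψ x) P = c * val x (pull G P) := by
    intro x h d
    obtain ⟨c, hc, e⟩ := exists_val_pt (fun (_ : Fin 1) a => val x (G a)) (fun _ => h) d
    refine ⟨c, hc, fun P hP => ?_⟩
    rw [hψpt x h, e P hP]
    congr 1
    exact (eval_pull _ _ _).symm
  obtain ⟨k', hk'⟩ := Function.ne_iff.mp hGx0
  have hGk : G k' ≠ 0 := by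
    intro h
    apply hk'
    simp [h, val]
  have hne : ∀ x, val x (G k') ≠ 0 → (fun a => val x (G a)) ≠ 0 := fun x h h0 => h (congrFun h0 k')
  have hpullH : ∀ a, pull G (H a) ∈ forms F 1 2 (∑ i, d₂ i • d₁) := fun a =>
    aeval_mem_forms (hH a) (e := fun _ => d₁) (fun v => hG v.2)
  refine pull_ne_zero_of_left_inverse hH ⟨k', hGk⟩ ?_ ?_ hΦ hΦ0 ?_
  · obtain ⟨l, hl⟩ := Function.ne_iff.mp hHy0
    refine ⟨l, fun h => hl ?_⟩
    obtain ⟨c, -, e⟩ := hval x0 hGx0 d₂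
    change val (ψ x0) (H l) = 0
    rw [e _ (hH l), h]
    simp [val]
  · intro a b
    rw [← sub_eq_zero]
    refine eq_zero_of_val_of_ne (Submodule.sub_mem _
      (mul_mem_forms (X_mem_forms ((0 : Fin 1), a)) (hpullH b))
      (mul_mem_forms (X_mem_forms ((0 : Fin 1), b)) (hpullH a))) (hG k') hGk fun x hx => ?_
    have hx' := hne x hx
    obtain ⟨c, hc, e⟩ := hval x hx' d₂
    have hX : ∀ b, val x (X ((0 : Fin 1), b)) = (x 0).rep b := fun b => by simp [val]
    have hsub : val x (X ((0 : Fin 1), a) * pull G (H b) - X ((0 : Fin 1), b) * pull G (H a))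
        = (x 0).rep a * val x (pull G (H b)) - (x 0).rep b * val x (pull G (H a)) := by
      rw [← hX, ← hX, ← val_mul, ← val_mul]
      simp [val]
    rw [hsub]
    by_cases hz : (fun a => val (ψ x) (H a)) = 0
    · have hz' : ∀ a, val x (pull G (H a)) = 0 := by
        intro a
        have := congrFun hz a
        simp only [Pi.zero_apply] at this
        rw [e _ (hH a)] at this
        exact (mul_eq_zero.mp this).resolve_left hc
      rw [hz', hz']; ring
    · have h1 := hHφ (ψ x) (hψ trivial) hz
      rw [hinv.2 (Set.mem_univ x)] at h1
      have h2 := proportional_of_eq_mk h1 a b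
      rw [e _ (hH a), e _ (hH b)] at h2
      refine (mul_right_injective₀ hc) ?_
      change c * _ = c * 0
      linear_combination -h2
  · refine eq_zero_of_val_of_ne (aeval_mem_forms hΦ (e := fun _ => d₁) (fun v => hG v.2)) (hG k') hGk
      fun x hx => ?_
    obtain ⟨c, hc, e⟩ := hval x (hne x hx) e
    have h1 := e Φ hΦ
    rw [val_img_eq_zero hΦ hvan (hψ trivial)] at h1
    exact (mul_eq_zero.mp h1.symm).resolve_left hc


/-! ### Automorphisms of the plane -/

/-- The polynomial `P(tX)` in `t`. -/
def scale (σ F : Type*) [Field F] :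
    MvPolynomial σ F →ₐ[F] Polynomial (MvPolynomial σ F) :=
  aeval fun v => Polynomial.X * Polynomial.C (X v)

lemma coeff_coeff_scale {σ : Type*} [Fintype σ] (P : MvPolynomial σ F) (i : ℕ) (x : σ →₀ ℕ) :
    ((scale σ F P).coeff i).coeff x = if ∑ v, x v = i then P.coeff x else 0 := by
  classical
  induction P using MvPolynomial.induction_on' with
  | monomial y c =>
    have h : scale σ F (monomial y c) = Polynomial.monomial (∑ v, y v) (monomial y c) := by
      rw [scale, aeval_monomial, Finsupp.prod_fintype _ _ (by simp)]
      simp only [mul_pow, Finset.prod_mul_distrib, Finset.prod_pow_eq_pow_sum]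
      rw [monomial_eq, Finsupp.prod_fintype _ _ (by simp), ← Polynomial.C_mul_X_pow_eq_monomial,
        map_mul, map_prod]
      simp only [Polynomial.C_pow]
      have : algebraMap F (Polynomial (MvPolynomial σ F)) c = Polynomial.C (C c) := rfl
      rw [this]
      ring
    rw [h, Polynomial.coeff_monomial, coeff_monomial]
    by_cases hy : y = x
    · subst hy
      by_cases hi : ∑ v, y v = i <;> simp [hi]
    · rw [if_neg hy, ite_self]
      split_ifs <;> simp [coeff_monomial, hy]
  | add p q hp hq =>
    rw [map_add, Polynomial.coeff_add, coeff_add, hp, hq, coeff_add]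
    split_ifs <;> simp

/-- The factors of a form `h` are forms: as `h(tX)` is a monomial in `t`, so are its factors. -/
lemma exists_mem_forms_of_mul_mem {m : ℕ} {P Q : Coord F 1 m} {d : Fin 1 → ℤ}
    (h : P * Q ∈ forms F 1 m d) (h0 : P * Q ≠ 0) : ∃ e, P ∈ forms F 1 m e := by
  classical
  set A := scale (Fin 1 × Fin (m + 1)) F P
  set B := scale (Fin 1 × Fin (m + 1)) F Q
  obtain ⟨n, hn⟩ := Int.eq_ofNat_of_zero_le (deg_nonneg h h0 0)
  have hAB : A * B = Polynomial.monomial n (P * Q) := by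
    rw [← map_mul]
    refine Polynomial.ext fun i => MvPolynomial.ext _ _ fun x => ?_
    rw [coeff_coeff_scale, Polynomial.coeff_monomial]
    by_cases hx : coeff x (P * Q) = 0
    · split_ifs <;> simp [hx]
    · have hs := mem_forms_iff.mp h x hx 0
      rw [hn, ← Nat.cast_sum, Nat.cast_inj] at hs
      rw [Fintype.sum_prod_type, Fin.sum_univ_one, hs]
      split_ifs <;> simp
  have hAB0 : A * B ≠ 0 := by rw [hAB]; simpa using h0
  have hA := left_ne_zero_of_mul hAB0
  have hB := right_ne_zero_of_mul hAB0
  have h1 := Polynomial.natDegree_mul hA hB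
  have h2 := Polynomial.natTrailingDegree_mul hA hB
  rw [hAB, Polynomial.natDegree_monomial_eq _ h0] at h1
  rw [hAB, Polynomial.natTrailingDegree_monomial h0] at h2
  have h3 := A.natTrailingDegree_le_natDegree
  have h4 := B.natTrailingDegree_le_natDegree
  refine ⟨fun _ => (A.natDegree : ℤ), mem_forms_iff.mpr fun x hx i => ?_⟩
  obtain rfl : i = 0 := Subsingleton.elim _ _
  have h5 : A.coeff (∑ v, x v) ≠ 0 := by
    intro hc
    have := coeff_coeff_scale P (∑ v, x v) x
    rw [if_pos rfl] at this
    exact hx (by rw [← this, hc, coeff_zero])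
  have h6 := Polynomial.le_natDegree_of_ne_zero h5
  have h7 := Polynomial.natTrailingDegree_le_of_ne_zero h5
  have h8 : ∑ v, x v = ∑ j, x (0, j) := by rw [Fintype.sum_prod_type, Fin.sum_univ_one]
  rw [← Nat.cast_sum, ← h8]
  congr 1
  omega

lemma val_X (x : Pt F 1 2) (b : Fin 3) : val x (X ((0 : Fin 1), b)) = (x 0).rep b := by
  simp [val]

/-- A morphism from the plane to itself is given by one triple of forms without common zero: local
triples are proportional, and hence they are multiples of the same triple of coprime forms. -/
lemma exists_global_forms [Infinite F] {p : Pt F 1 2 → Pt F 1 2}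
    (hp : IsRegularOn Set.univ p) :
    ∃ (d : Fin 1 → ℤ) (K : Fin 3 → Coord F 1 2), (∀ a, K a ∈ forms F 1 2 d) ∧
      ∀ x, ∃ h : (fun a => val x (K a)) ≠ 0, p x 0 = Projectivization.mk F _ h := by
  classical
  obtain ⟨x0⟩ : Nonempty (Pt F 1 2) := inferInstance
  obtain ⟨d, G, hG, hGx0, hGp⟩ := hp x0 trivial 0
  obtain ⟨a0, ha0⟩ := Function.ne_iff.mp hGx0
  have hGa : G a0 ≠ 0 := fun h => ha0 (by simp [h, val])
  let _ : StrongNormalizationMonoid (Coord F 1 2) :=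
    UniqueFactorizationMonoid.strongNormalizationMonoid
  let _ : NormalizedGCDMonoid (Coord F 1 2) := UniqueFactorizationMonoid.toNormalizedGCDMonoid _
  obtain ⟨K, hK, hK1⟩ := Finset.extract_gcd G (s := Finset.univ) Finset.univ_nonempty
  set q := Finset.univ.gcd G
  have hK : ∀ a, G a = q * K a := fun a => hK a (Finset.mem_univ a)
  have hqK : q * K a0 ≠ 0 := by rw [← hK]; exact hGa
  obtain ⟨e, he⟩ := exists_mem_forms_of_mul_mem (P := q) (Q := K a0) (by rw [← hK]; exact hG a0) hqK
  have hKf : ∀ a, K a ∈ forms F 1 2 (d - e) := fun a =>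
    mem_forms_of_mul_mem he (left_ne_zero_of_mul hqK) (by rw [← hK]; exact hG a)
  refine ⟨d - e, K, hKf, fun x => ?_⟩
  obtain ⟨d', G', hG', hGx', hGp'⟩ := hp x trivial 0
  obtain ⟨b0, hb0⟩ := Function.ne_iff.mp hGx'
  have hGb : G' b0 ≠ 0 := fun h => hb0 (by simp [h, val])
  have hcross : ∀ a b, G' a * K b = G' b * K a := by
    intro a b
    rw [← sub_eq_zero]
    refine eq_zero_of_val_of_ne (Submodule.sub_mem _ (mul_mem_forms (hG' a) (hKf b))
      (mul_mem_forms (hG' b) (hKf a))) (mul_mem_forms (hG a0) (hG' b0)) (mul_ne_zero hGa hGb)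
      fun z hz => ?_
    rw [val_mul] at hz
    have h1 : (fun a => val z (G a)) ≠ 0 := fun h => left_ne_zero_of_mul hz (congrFun h a0)
    have h2 : (fun a => val z (G' a)) ≠ 0 := fun h => right_ne_zero_of_mul hz (congrFun h b0)
    have e1 := proportional_of_eq_mk (hGp z trivial h1)
    have e2 := proportional_of_eq_mk (hGp' z trivial h2)
    have e0 := left_ne_zero_of_mul hz
    obtain ⟨c, hc⟩ := Function.ne_iff.mp (p z 0).rep_nonzero
    have hc : (p z 0).rep c ≠ 0 := hc
    have hs : val z (G' a * K b - G' b * K a) = val z (G' a) * val z (K b)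
        - val z (G' b) * val z (K a) := by simp [val]
    rw [hs]
    rw [hK, val_mul] at e0
    have hq := left_ne_zero_of_mul e0
    simp only [hK, val_mul] at e1
    have e1' : ∀ a b, val z (K a) * (p z 0).rep b = val z (K b) * (p z 0).rep a := fun a b =>
      mul_left_cancel₀ hq (by linear_combination e1 a b)
    refine mul_left_cancel₀ (mul_ne_zero hc hc) ?_
    linear_combination (p z 0).rep c * val z (K b) * e2 a c
      + val z (G' c) * (p z 0).rep a * e1' b c - (p z 0).rep c * val z (K a) * e2 b c
      - val z (G' c) * (p z 0).rep b * e1' a c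
  have hdvd : K a0 ∣ G' a0 := by
    have h1 : K a0 ∣ Finset.univ.gcd fun b => G' a0 * K b :=
      Finset.dvd_gcd fun b _ => Dvd.intro_left _ (hcross b a0)
    have h2 := (Finset.gcd_mul_left' Finset.univ K (G' a0)).dvd
    rw [hK1, mul_one] at h2
    exact h1.trans h2
  obtain ⟨ρ, hρ⟩ := hdvd
  have hG'K : ∀ a, G' a = ρ * K a := by
    intro a
    refine mul_left_cancel₀ (right_ne_zero_of_mul hqK) ?_
    linear_combination hcross a a0 + K a * hρ
  have hρx : val x ρ ≠ 0 := by
    intro h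
    refine hb0 ?_
    simp only [hG'K, val_mul, h, zero_mul, Pi.zero_apply]
  have hKx : (fun a => val x (K a)) ≠ 0 := by
    intro h
    refine hb0 ?_
    have := congrFun h b0
    simp only [Pi.zero_apply] at this
    simp only [hG'K, val_mul, this, mul_zero, Pi.zero_apply]
  refine ⟨hKx, eq_mk_of_proportional _ hKx fun a b => mul_left_cancel₀ hρx ?_⟩
  have h1 := proportional_of_eq_mk (hGp' x trivial hGx') a b
  simp only [hG'K, val_mul] at h1
  linear_combination h1

/-- A form without zeros is constant. -/
lemma eq_zero_of_no_zero [IsAlgClosed F] {d : Fin 1 → ℤ} {h : Coord F 1 2}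
    (hh : h ∈ forms F 1 2 d) (h0 : ∀ x, val x h ≠ 0) : d 0 = 0 := by
  have hinf : Infinite F := IsAlgClosed.instInfinite
  have hne : h ≠ 0 := by
    obtain ⟨x0⟩ : Nonempty (Pt F 1 2) := inferInstance
    rintro rfl
    exact h0 x0 (by simp [val])
  obtain ⟨n, hn⟩ := Int.eq_ofNat_of_zero_le (deg_nonneg hh hne 0)
  by_contra hd
  have hn0 : n ≠ 0 := by rintro rfl; exact hd hn
  have hev : ∀ u : Fin 3 → F, u ≠ 0 → eval (fun v : Fin 1 × Fin 3 => u v.2) h ≠ 0 := fun u hu =>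
    (val_pt_ne_zero_iff (fun _ => u) (fun _ => hu) hh).mp (h0 _)
  -- a form without zeros has constant values along polynomial maps from the affine line
  have hconst : ∀ U : Fin 3 → Polynomial F, (∀ t, (fun a => (U a).eval t) ≠ 0) → ∀ t,
      eval (fun v : Fin 1 × Fin 3 => (U v.2).eval t) h
        = eval (fun v : Fin 1 × Fin 3 => (U v.2).eval 1) h := by
    intro U hU
    have he : ∀ t, eval (fun v : Fin 1 × Fin 3 => (U v.2).eval t) h
        = (aeval (fun v : Fin 1 × Fin 3 => U v.2) h : Polynomial F).eval t := by
      intro t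
      have : (eval fun v : Fin 1 × Fin 3 => (U v.2).eval t) = (Polynomial.evalRingHom t).comp
          (aeval (fun v : Fin 1 × Fin 3 => U v.2) : Coord F 1 2 →ₐ[F] Polynomial F).toRingHom :=
        MvPolynomial.ringHom_ext (fun c => by simp) (fun v => by simp)
      exact RingHom.congr_fun this h
    have hdeg : (aeval (fun v : Fin 1 × Fin 3 => U v.2) h : Polynomial F).degree = 0 := by
      by_contra hc
      obtain ⟨t, ht⟩ := IsAlgClosed.exists_root _ hc
      exact hev _ (hU t) ((he t).trans ht)
    intro t
    rw [he, he, Polynomial.eq_C_of_degree_eq_zero hdeg]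
    simp
  classical
  obtain ⟨z, hz⟩ := Infinite.exists_notMem_finset ({0, 1} : Finset F)
  simp only [Finset.mem_insert, Finset.mem_singleton, not_or] at hz
  obtain ⟨s, hs⟩ := IsAlgClosed.exists_pow_nat_eq z (Nat.pos_of_ne_zero hn0)
  have hs0 : s ≠ 0 := by
    rintro rfl
    rw [zero_pow hn0] at hs
    exact hz.1 hs.symm
  -- `h (1, t, 0)` and `h (s, 1, 0)` are constant, but `h (s, 1, 0) = s ^ n * h (1, s⁻¹, 0)`
  have e1 := hconst ![1, Polynomial.X, 0] (fun t h => one_ne_zero (α := F)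
    (by simpa using congrFun h 0)) s⁻¹
  have e2 := hconst ![Polynomial.X, 1, 0] (fun t h => one_ne_zero (α := F)
    (by simpa using congrFun h 1)) s
  have e3 := eval_smul_form hh (fun _ => s)
    (fun v : Fin 1 × Fin 3 => ((![1, Polynomial.X, 0] : Fin 3 → Polynomial F) v.2).eval s⁻¹)
  rw [Fin.prod_univ_one, hn, Int.toNat_natCast, hs, e1] at e3
  have e4 : (fun v : Fin 1 × Fin 3 =>
      s * ((![1, Polynomial.X, 0] : Fin 3 → Polynomial F) v.2).eval s⁻¹)
      = fun v => ((![Polynomial.X, 1, 0] : Fin 3 → Polynomial F) v.2).eval s := by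
    funext ⟨i, j⟩
    fin_cases j <;> simp [hs0]
  have e5 : (fun v : Fin 1 × Fin 3 => ((![1, Polynomial.X, 0] : Fin 3 → Polynomial F) v.2).eval 1)
      = fun v => ((![Polynomial.X, 1, 0] : Fin 3 → Polynomial F) v.2).eval 1 := by
    funext ⟨i, j⟩
    fin_cases j <;> simp
  rw [e4, e2, e5] at e3
  have e6 := hev (fun a => ((![Polynomial.X, 1, 0] : Fin 3 → Polynomial F) a).eval 1)
    (fun h => one_ne_zero (α := F) (by simpa using congrFun h 0))
  exact hz.2 (mul_right_cancel₀ e6 (by rw [one_mul]; exact e3.symm))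

lemma eq_sum_of_mem_forms_one {h : Coord F 1 2} (hh : h ∈ forms F 1 2 fun _ => 1) :
    h = ∑ b, C (coeff (Finsupp.single ((0 : Fin 1), b) 1) h) * X ((0 : Fin 1), b) := by
  classical
  ext x
  rw [coeff_sum]
  simp only [coeff_C_mul, coeff_X]
  by_cases hx : ∃ b, Finsupp.single ((0 : Fin 1), b) 1 = x
  · obtain ⟨b, rfl⟩ := hx
    rw [Finset.sum_eq_single b]
    · simp
    · intro b' _ hb
      simp [Finsupp.single_left_inj, hb]
    · simp
  · rw [Finset.sum_eq_zero]
    · by_contra hc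
      have h1 := mem_forms_iff.mp hh x hc 0
      have h2 : x.sum (fun _ n => n) = 1 := by
        rw [Finsupp.sum_fintype _ _ (by simp), Fintype.sum_prod_type, Fin.sum_univ_one]
        exact_mod_cast h1
      obtain ⟨⟨i, b⟩, hb⟩ := (Finsupp.sum_eq_one_iff x).mp h2
      obtain rfl : i = 0 := Subsingleton.elim _ _
      exact hx ⟨b, hb.symm⟩
    · intro b _
      rw [if_neg (fun h => hx ⟨b, h⟩), mul_zero]

/-- The biregular maps of the plane to itself are linear. -/
lemma exists_eq_linAut [IsAlgClosed F] {p : Pt F 1 2 ≃ Pt F 1 2}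
    (hp : IsRegularOn Set.univ p) (hp' : IsRegularOn Set.univ p.symm) :
    ∃ (c : Fin 9 → F) (hc : c ∈ normIdx F), ∀ y, p y = linAut c hc y := by
  classical
  have hinf : Infinite F := IsAlgClosed.instInfinite
  obtain ⟨d, K, hK, hKp⟩ := exists_global_forms hp
  obtain ⟨d', K', hK', hKp'⟩ := exists_global_forms hp'
  have hd' : d' = fun _ => d' 0 := by funext i; rw [Subsingleton.elim i 0]
  have hpull : ∀ a, pull K (K' a) ∈ forms F 1 2 (d' 0 • d) := fun a =>
    pull_mem_forms hK (by rw [← hd']; exact hK' a)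
  have hval : ∀ x, ∃ c : F, c ≠ 0 ∧ ∀ a, val (p x) (K' a) = c * val x (pull K (K' a)) := by
    intro x
    obtain ⟨h, e⟩ := hKp x
    have hpt : p x = pt (fun _ a => val x (K a)) (fun _ => h) := by
      funext j
      obtain rfl : j = 0 := Subsingleton.elim _ _
      exact e
    obtain ⟨c, hc, H⟩ := exists_val_pt (fun (_ : Fin 1) a => val x (K a)) (fun _ => h) d'
    refine ⟨c, hc, fun a => ?_⟩
    rw [hpt, H _ (hK' a)]
    congr 1
    exact (eval_pull _ _ _).symm
  have hcross : ∀ a b, X ((0 : Fin 1), b) * pull K (K' a) = X ((0 : Fin 1), a) * pull K (K' b) := by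
    intro a b
    rw [← sub_eq_zero]
    refine eq_zero_of_val (Submodule.sub_mem _ (mul_mem_forms (X_mem_forms ((0 : Fin 1), b)) (hpull a))
      (mul_mem_forms (X_mem_forms ((0 : Fin 1), a)) (hpull b))) fun x => ?_
    have hs : val x (X ((0 : Fin 1), b) * pull K (K' a) - X ((0 : Fin 1), a) * pull K (K' b))
        = (x 0).rep b * val x (pull K (K' a)) - (x 0).rep a * val x (pull K (K' b)) := by
      rw [← val_X, ← val_X, ← val_mul, ← val_mul]
      simp [val]
    obtain ⟨c, hc, e⟩ := hval x
    obtain ⟨h, e'⟩ := hKp' (p x)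
    rw [p.symm_apply_apply] at e'
    have h1 := proportional_of_eq_mk e' a b
    rw [e, e] at h1
    rw [hs]
    refine mul_left_cancel₀ hc ?_
    linear_combination h1
  -- the composition `K' ∘ K` is a multiple `h X` of the coordinates
  have hX : ¬ X ((0 : Fin 1), (0 : Fin 3)) ∣ (X ((0 : Fin 1), (1 : Fin 3)) : Coord F 1 2) := by
    rw [X_dvd_X]
    simp
  have hdvd : X ((0 : Fin 1), (0 : Fin 3)) ∣ pull K (K' 0) :=
    ((X_prime (R := F) (i := ((0 : Fin 1), (0 : Fin 3)))).dvd_or_dvd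
      (Dvd.intro _ (hcross 0 1).symm)).resolve_left hX
  obtain ⟨h, hh⟩ := hdvd
  have hh' : ∀ b, pull K (K' b) = X ((0 : Fin 1), b) * h := by
    intro b
    refine mul_left_cancel₀ (X_ne_zero (R := F) ((0 : Fin 1), (0 : Fin 3))) ?_
    rw [← hcross, hh]
    ring
  have hhx : ∀ x, val x h ≠ 0 := by
    intro x hx
    obtain ⟨c, hc, e⟩ := hval x
    obtain ⟨h0, -⟩ := hKp' (p x)
    refine h0 (funext fun a => ?_)
    rw [e, hh', val_mul, hx, mul_zero, mul_zero]
    rfl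
  -- the form `h` is constant, so `K` and `K'` have degree one
  have hhd : h ∈ forms F 1 2 (d' 0 • d - Pi.single 0 1) :=
    mem_forms_of_mul_mem (X_mem_forms _) (X_ne_zero ((0 : Fin 1), (0 : Fin 3)))
      (by rw [← hh]; exact hpull 0)
  have hdd : d' 0 * d 0 = 1 := by
    have := eq_zero_of_no_zero hhd hhx
    simp at this
    omega
  have hK0 : ∃ a, K a ≠ 0 := by
    obtain ⟨x0⟩ : Nonempty (Pt F 1 2) := inferInstance
    obtain ⟨a, ha⟩ := Function.ne_iff.mp (hKp x0).1
    exact ⟨a, fun h => ha (by simp [h, val])⟩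
  obtain ⟨a0, ha0⟩ := hK0
  have hd1 : d = fun _ => 1 := by
    funext i
    rw [Subsingleton.elim i 0]
    exact Int.eq_one_of_mul_eq_one_left (deg_nonneg (hK a0) ha0 0) hdd
  subst hd1
  set M : Matrix (Fin 3) (Fin 3) F := fun a b =>
    coeff (Finsupp.single ((0 : Fin 1), b) 1) (K a) with hM
  have hKM : ∀ (u : Fin 3 → F) a,
      eval (fun v : Fin 1 × Fin 3 => u v.2) (K a) = M.mulVec u a := by
    intro u a
    rw [eq_sum_of_mem_forms_one (hK a), map_sum]
    simp [Matrix.mulVec, dotProduct, hM]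
  have hdet : M.det ≠ 0 := by
    intro hdet
    obtain ⟨u, hu, h0⟩ := Matrix.exists_mulVec_eq_zero_iff.mpr hdet
    obtain ⟨h1, -⟩ := hKp (pt (fun _ => u) (fun _ => hu))
    refine h1 (funext fun a => ?_)
    obtain ⟨c, -, e⟩ := exists_val_pt (fun _ : Fin 1 => u) (fun _ => hu) (fun _ => 1)
    rw [e _ (hK a), hKM, h0]
    simp
  set c₀ : Fin 9 → F := ![M 0 0, M 0 1, M 0 2, M 1 0, M 1 1, M 1 2, M 2 0, M 2 1, M 2 2] with hc₀
  have hmat : ∀ s : F, mat (fun i => s * c₀ i) = s • M := by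
    intro s
    ext i j
    fin_cases i <;> fin_cases j <;> rfl
  have hne : ∃ i, c₀ i ≠ 0 := by
    by_contra! hc
    have h1 := hmat 1
    rw [one_smul] at h1
    apply hdet
    rw [← h1]
    simp [hc, mat, Matrix.det_fin_three]
  -- the first nonzero entry is normalized to one
  obtain ⟨i, hi, hmin⟩ := WellFounded.has_min (wellFounded_lt (α := Fin 9)) {i | c₀ i ≠ 0} hne
  have hi : c₀ i ≠ 0 := hi
  have hmem : (fun j => (c₀ i)⁻¹ * c₀ j) ∈ normIdx F := by
    refine ⟨?_, i, inv_mul_cancel₀ hi, fun j hj => ?_⟩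
    · rw [hmat, Matrix.det_smul]
      exact mul_ne_zero (pow_ne_zero _ (inv_ne_zero hi)) hdet
    · have : c₀ j = 0 := by
        by_contra hc
        exact hmin j hc hj
      simp only [this, mul_zero]
  refine ⟨_, hmem, fun y => funext fun j => ?_⟩
  obtain rfl : j = 0 := Subsingleton.elim _ _
  obtain ⟨h1, e1⟩ := hKp y
  rw [e1]
  have hlin := congrFun (congrArg (linAut _ hmem) (eq_pt y)) 0
  rw [hlin]
  refine Eq.trans ?_ (Projectivization.map_mk _ _ _ _).symm
  rw [Projectivization.mk_eq_mk_iff']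
  refine ⟨c₀ i, ?_⟩
  have hv : ∀ a, val y (K a) = M.mulVec (y 0).rep a := by
    intro a
    rw [← hKM]
    unfold val
    congr 2
    funext ⟨i, j⟩
    rw [Subsingleton.elim i 0]
  rw [Matrix.toLin'_apply, hmat, Matrix.smul_mulVec, smul_smul, mul_inv_cancel₀ hi, one_smul]
  exact (funext hv).symm


/-! ### The base case -/

/-- The image does not lie in a hyperplane. -/
lemma PMap.linearIndependent (f : PMap F) : LinearIndependent F (f.map.comp 0) := by
  rw [Fintype.linearIndependent_iff]
  intro u hu
  by_contra! hne
  obtain ⟨y, hy, h⟩ := f.nondegenerate u (Function.ne_iff.mpr hne)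
  have hform : (∑ a, C (u a) * X ((0 : Fin 1), a) : Coord F 1 f.dim)
      ∈ forms F 1 f.dim (Pi.single 0 1) := by
    refine Submodule.sum_mem _ fun a _ => ?_
    rw [← smul_eq_C_mul]
    exact Submodule.smul_mem _ _ (X_mem_forms ((0 : Fin 1), a))
  refine h ?_
  have h1 := val_img_eq_zero hform (by
    rw [map_sum, ← hu]
    refine Finset.sum_congr rfl fun a _ => ?_
    rw [← smul_eq_C_mul, map_smul, aeval_X]) hy
  simpa [val] using h1

/-- The components of a map are global sections of its class. -/
lemma PMap.assoc_le_space (f : PMap F) : f.assoc ≤ f.cls.space := by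
  intro v hv
  refine ⟨?_, fun p => ⟨fun l => virtAt f.assoc (p, l) v, virtAt_nil _ _ _, ?_⟩⟩
  · have h : f.assoc ≤ forms F f.dom.k f.dom.m (f.map.deg 0) := by
      refine Submodule.span_le.mpr ?_
      rintro _ ⟨a, rfl⟩
      exact f.map.homog 0 a
    exact h hv
  · intro l
    have h : (f.cls.mult (p, l)).toNat = mult f.assoc (p, l) := Int.toNat_natCast _
    rw [h]
    exact isVirtual_virtAt hv p l

/-- The independent components of `f` lie in a space of dimension three, which they span because
the linear series is complete. -/
lemma PMap.IsB1.dim_eq_two {f : PMap F} (hf : f.IsB1) : f.dim = 2 := by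
  obtain ⟨h0, -, -, h3, -, -⟩ := hf
  have hfin : FiniteDimensional F f.cls.space :=
    Module.finite_of_finrank_pos (by
      have : Module.finrank F f.cls.space = 3 := h3
      omega)
  have h1 := Submodule.finrank_mono f.assoc_le_space
  have h2 : Module.finrank F f.assoc = f.dim + 1 := by
    rw [PMap.assoc, finrank_span_eq_card f.linearIndependent, Fintype.card_fin]
  have h3' : Module.finrank F f.cls.space = 3 := h3
  unfold PMap.c0 at h0
  rw [h3] at h0
  push_cast at h0
  omega

lemma PMap.IsB1.exists_isInverse [IsAlgClosed F] {f : PMap F} (hf : f.IsB1) (df : f.dim = 2) :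
    ∃ s, (f.map.castTarget df).IsInverse s := by
  have hinf : Infinite F := IsAlgClosed.instInfinite
  obtain ⟨D, n, r, hgcd, hnd⟩ := f
  obtain rfl : n = 2 := df
  obtain ⟨-, -, -, -, h1, hiso⟩ := hf
  exact SurfIso.exists_isInverse r (dominant_of_varIso r hiso) hgcd h1

lemma RatMap.Sends.unique {k m l n : ℕ} {r : RatMap F k m l n} {x : Pt F k m} {y y' : Pt F l n}
    (h : r.Sends x y) (h' : r.Sends x y') : y = y' :=
  funext fun j => (h j).2.trans (h' j).2.symm

/-- General points are mapped to general points by birational maps. -/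
lemma Generic.pullback [Infinite F] {k m l n : ℕ} {r : RatMap F k m l n} (hr : r.IsBirational)
    {P : Pt F l n → Prop} (hP : Generic P) : Generic fun x => ∃ z, r.Sends x z ∧ P z := by
  obtain ⟨s, hrs, hsr⟩ := hr
  obtain ⟨d, h, hh, h0, H⟩ := hP
  obtain ⟨z, ⟨x, -, hx⟩, hz⟩ := (hsr.and (generic_val_ne_zero hh h0)).exists
  have h1 : aeval (fun v : Fin l × Fin (n + 1) => r.comp v.1 v.2) h ≠ 0 := by
    intro hc
    obtain ⟨c, -, e⟩ := val_of_sends hx hh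
    apply hz
    rw [e, hc]
    simp [val]
  refine (hrs.and (generic_val_ne_zero
    (aeval_mem_forms hh fun v => r.homog v.1 v.2) h1)).mono ?_
  rintro x ⟨⟨z, hz, -⟩, hx⟩
  refine ⟨z, hz, H z ?_⟩
  obtain ⟨c, hc, e⟩ := val_of_sends hz hh
  rw [e]
  exact mul_ne_zero hc hx

/-- If `p ∘ f = g ∘ r` and `g` has an inverse, then `r = g⁻¹ ∘ p ∘ f`. -/
lemma generic_sends_inverse [Infinite F] {k m k' m' n n' : ℕ} {f : RatMap F k m 1 n}
    {g : RatMap F k' m' 1 n'} {s : RatMap F 1 n' k' m'} (hs : g.IsInverse s)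
    {r : RatMap F k m k' m'} (hr : r.IsBirational) {p : Pt F 1 n → Pt F 1 n'}
    (h : Generic fun x => ∃ y z, f.Sends x y ∧ r.Sends x z ∧ g.Sends z (p y)) :
    Generic fun x => ∃ y z, f.Sends x y ∧ s.Sends (p y) z ∧ r.Sends x z := by
  refine (h.and (hs.1.pullback hr)).mono ?_
  rintro x ⟨⟨y, z, hf, hrz, hg⟩, z', hrz', y', hg', hsy⟩
  obtain rfl := hrz.unique hrz'
  obtain rfl := hg.unique hg'
  exact ⟨y, z, hf, hsy, hrz⟩

end

end SurfIso

theorem mainTheorem5 {F : Type*} [Field F] [IsAlgClosed F] (f g : PMap F)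
    (hf : f.IsB1) (hg : g.IsB1) :
    ∃ (df : f.dim = 2) (dg : g.dim = 2) (ginv : RatMap F 1 2 g.dom.k g.dom.m),
      (g.map.castTarget dg).IsInverse ginv ∧
      reparam f g ⊆ {r | ∃ (c : Fin 9 → F) (hc : c ∈ normIdx F),
        Generic fun x => ∃ y z, (f.map.castTarget df).Sends x y ∧
          ginv.Sends (linAut c hc y) z ∧ r.Sends x z} := by
  have hinf : Infinite F := IsAlgClosed.instInfinite
  have df := hf.dim_eq_two
  have dg := hg.dim_eq_two
  obtain ⟨ginv, hinv⟩ := hg.exists_isInverse dg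
  refine ⟨df, dg, ginv, hinv, ?_⟩
  clear hf hg
  obtain ⟨D, n, f, hf, hf'⟩ := f
  obtain ⟨D', n', g, hg, hg'⟩ := g
  obtain rfl : n = 2 := df
  obtain rfl : n' = 2 := dg
  rintro r ⟨hr, p, ⟨hp, hp', -⟩, h⟩
  obtain ⟨c, hc, e⟩ := exists_eq_linAut hp hp'
  refine ⟨c, hc, ?_⟩
  simp only [← e]
  exact generic_sends_inverse hinv hr h
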